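/- Let $k$ be a commutative ring with unit and let $A$ be an associative unital $k$-algebra that is projective as a $k$-module. Put $A^e=A\otimes_k A^{op}$ and identify $A$-bimodules on which the two actions of $k$ agree with $A^e$-modules; let $Z=Z(A)$ be the center of $A$. For bimodules $N,M$ let $H_n(A,N)=H_n(N\otimes_{A^e}\mathrm{Bar}(A)_\bullet)$ and $H^m(A,M)=H^m(\mathrm{Hom}_{A^e}(\mathrm{Bar}(A)_\bullet,M))$ be Hochschild homology and cohomology, where $\mathrm{Bar}(A)_n=A^{\otimes (n+2)}$ with $d_n(a_0\otimes\cdots\otimes a_{n+1})=\sum_{i=0}^n(-1)^i a_0\otimes\cdots\otimes a_ia_{i+1}\otimes\cdots\otimes a_{n+1}$ and augmentation $d_0:A\otimes A\to A$ the multiplication. The center $Z$ acts on $H_n(A,N)$ and $H^m(A,M)$ through its action on the coefficients. Let $\delta$ and $\partial$ denote the connecting homomorphisms of $H_\bullet(A,-)$ and $H^\bullet(A,-)$, given by the snake lemma for the complexes above, where the coboundary of a cochain $t\in\mathrm{Hom}_{A^e}(\mathrm{Bar}(A)_m,M)$ is $t\,d_{m+1}$. Let $[N,A]$ be the submodule of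 $N$ generated by the elements $ax-xa$, let $M^A=\{y\in M: ay=ya \text{ for all } a\in A\}$, let $\psi:H_0(A,N)\to N/[N,A]$ be the isomorphism $[x\otimes p]\mapsto[x\,d_0(p)]$, and let $\varphi:H^0(A,M)\to M^A$ be the isomorphism $[t]\mapsto t(1\otimes 1)$. Then there is exactly one family of $k$-linear maps $$\cap: H_n(A,N)\otimes_k H^m(A,M)\to H_{n-m}(A,N\otimes_A M),$$ defined for all integers $0\le m\le n$ and all bimodules $N,M$, with the following properties. (QI) $\cap$ induces a morphism of $Z$-modules $H_n(A,N)\otimes_Z H^m(A,M)\to H_{n-m}(A,N\otimes_A M)$. (QII$_1$) If $0\to N_1\to N_2\to N_3\to 0$ is a short exact sequence of bimodules and the induced sequence $0\to N_1\otimes_A M\to N_2\otimes_A M\to N_3\otimes_A M\to 0$ is exact, then, for $0\le m\le n$, $\gamma\in H_{n+1}(A,N_3)$ and $\epsilon\in H^m(A,M)$, $\delta(\gamma\cap\epsilon)=(-1)^m(\delta\gamma)\cap\epsilon$. (QII$_2$) If $0\to M_1\to M_2\to M_3\to 0$ is a short exact sequence of bimodules and the induced sequence $0\to N\otimes_A M_1\to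 N\otimes_A M_2\to N\otimes_A M_3\to 0$ is exact, then, for $0\le m<n$, $\gamma\in H_n(A,N)$ and $\epsilon\in H^m(A,M_3)$, $\delta(\gamma\cap\epsilon)=(-1)^{m+1}\gamma\cap(\partial\epsilon)$. (QIII) In degree $(0,0)$, for $\gamma\in H_0(A,N)$ and $\epsilon\in H^0(A,M)$, $\psi(\gamma\cap\epsilon)$ is the image of $(\psi(\gamma),\varphi(\epsilon))$ under the map $N/[N,A]\otimes_Z M^A\to (N\otimes_A M)/[N\otimes_A M,A]$, $[x]\otimes y\mapsto[x\otimes y]$. -/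

import Mathlib

open scoped TensorProduct

universe u v w

namespace HochschildCap

noncomputable section

/-! ### Tensor products over a noncommutative ring -/

section Balanced

variable {ι N M X : Type*} [AddCommGroup N] [AddCommGroup M] [AddCommGroup X]

/-- The subgroup of `N ⊗_ℤ M` generated by the elements `ρ i x ⊗ y - x ⊗ l i y`. -/
def balancedRel (ρ : ι → N →+ N) (l : ι → M →+ M) : AddSubgroup (N ⊗[ℤ] M) :=
  AddSubgroup.closure {z | ∃ (i : ι) (x : N) (y : M), z = ρ i x ⊗ₜ[ℤ] y - x ⊗ₜ[ℤ] l i y}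

/-- The quotient of `N ⊗_ℤ M` by the relations `ρ i x ⊗ y = x ⊗ l i y`. If `ρ` and `l` are a right
and a left action of a ring `R`, this is the tensor product `N ⊗_R M`. -/
def Balanced (ρ : ι → N →+ N) (l : ι → M →+ M) : Type _ := (N ⊗[ℤ] M) ⧸ balancedRel ρ l

instance (ρ : ι → N →+ N) (l : ι → M →+ M) : AddCommGroup (Balanced ρ l) :=
  inferInstanceAs (AddCommGroup ((N ⊗[ℤ] M) ⧸ balancedRel ρ l))

namespace Balanced

variable {ρ : ι → N →+ N} {l : ι → M →+ M}

variable (ρ l) in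
/-- The class of `x ⊗ y`. -/
def mk (x : N) (y : M) : Balanced ρ l := QuotientAddGroup.mk (x ⊗ₜ[ℤ] y)

lemma mk_add_left (x x' : N) (y : M) : mk ρ l (x + x') y = mk ρ l x y + mk ρ l x' y := by
  simp only [mk, TensorProduct.add_tmul]; rfl

lemma mk_add_right (x : N) (y y' : M) : mk ρ l x (y + y') = mk ρ l x y + mk ρ l x y' := by
  simp only [mk, TensorProduct.tmul_add]; rfl

variable (ρ l) in
/-- The biadditive map `(x, y) ↦ x ⊗ y`. -/
def mkHom : N →+ M →+ Balanced ρ l :=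
  AddMonoidHom.mk' (fun x => AddMonoidHom.mk' (fun y => mk ρ l x y) (mk_add_right x))
    (fun x x' => by ext y; exact mk_add_left x x' y)

@[simp] lemma mkHom_apply (x : N) (y : M) : mkHom ρ l x y = mk ρ l x y := rfl

lemma balance (i : ι) (x : N) (y : M) : mk ρ l (ρ i x) y = mk ρ l x (l i y) := by
  refine QuotientAddGroup.eq_iff_sub_mem.2 (AddSubgroup.subset_closure ⟨i, x, y, rfl⟩)

/-- A biadditive balanced map factors through the balanced tensor product. -/
def lift (f : N →+ M →+ X) (h : ∀ i x y, f (ρ i x) y = f x (l i y)) : Balanced ρ l →+ X :=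
  QuotientAddGroup.lift (balancedRel ρ l)
    (TensorProduct.liftAddHom f (fun r x y => by simp)) (by
      rw [balancedRel, AddSubgroup.closure_le]
      rintro _ ⟨i, x, y, rfl⟩
      simp [h])

@[simp] lemma lift_mk (f : N →+ M →+ X) (h : ∀ i x y, f (ρ i x) y = f x (l i y)) (x : N) (y : M) :
    lift f h (mk ρ l x y) = f x y := by
  rfl

@[elab_as_elim]
lemma induction {p : Balanced ρ l → Prop} (z : Balanced ρ l) (h0 : p 0)
    (hmk : ∀ x y, p (mk ρ l x y)) (hadd : ∀ z z', p z → p z' → p (z + z')) : p z := by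
  obtain ⟨z, rfl⟩ := QuotientAddGroup.mk_surjective z
  induction z using TensorProduct.induction_on with
  | zero => exact h0
  | tmul x y => exact hmk x y
  | add a b ha hb => exact hadd _ _ ha hb

lemma hom_ext {f g : Balanced ρ l →+ X} (h : ∀ x y, f (mk ρ l x y) = g (mk ρ l x y)) : f = g := by
  ext z
  induction z using induction with
  | h0 => simp
  | hmk x y => exact h x y
  | hadd a b ha hb => simp [ha, hb]

variable {N' M' : Type*} [AddCommGroup N'] [AddCommGroup M'] {ρ' : ι → N' →+ N'} {l' : ι → M' →+ M'}

/-- The map `x ⊗ y ↦ f x ⊗ g y`. -/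
def map (f : N →+ N') (g : M →+ M') (hf : ∀ i x, f (ρ i x) = ρ' i (f x))
    (hg : ∀ i y, g (l i y) = l' i (g y)) : Balanced ρ l →+ Balanced ρ' l' :=
  lift (((mkHom ρ' l').comp f).compr₂ (AddMonoidHom.id _) |>.compl₂ g) (fun i x y => by
    simp [hf, hg, balance])

@[simp] lemma map_mk (f : N →+ N') (g : M →+ M') (hf : ∀ i x, f (ρ i x) = ρ' i (f x))
    (hg : ∀ i y, g (l i y) = l' i (g y)) (x : N) (y : M) :
    map f g hf hg (mk ρ l x y) = mk ρ' l' (f x) (g y) := rfl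

end Balanced

end Balanced

/-! ### Bimodules as modules over the enveloping algebra -/

section Bimodule

/-- The enveloping algebra `A^e = A ⊗_k A^op`. A bimodule is a (left) `A^e`-module. -/
abbrev Env (k : Type u) (A : Type v) [CommRing k] [Ring A] [Algebra k A] : Type v :=
  A ⊗[k] Aᵐᵒᵖ

variable (k : Type u) {A : Type v} [CommRing k] [Ring A] [Algebra k A]

section
variable {N : Type*} [AddCommGroup N] [Module (Env k A) N]

/-- The left action `x ↦ a x` on a bimodule. -/
def lact (a : A) : N →+ N := DistribSMul.toAddMonoidHom N (a ⊗ₜ[k] (1 : Aᵐᵒᵖ))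

/-- The right action `x ↦ x a` on a bimodule. -/
def ract (a : A) : N →+ N := DistribSMul.toAddMonoidHom N ((1 : A) ⊗ₜ[k] MulOpposite.op a)

lemma lact_apply (a : A) (x : N) : lact k a x = (a ⊗ₜ[k] (1 : Aᵐᵒᵖ)) • x := rfl

lemma ract_apply (a : A) (x : N) : ract k a x = ((1 : A) ⊗ₜ[k] MulOpposite.op a) • x := rfl

lemma lact_ract (a b : A) (x : N) :
    lact k a (ract k b x) = (a ⊗ₜ[k] MulOpposite.op b) • x := by
  simp [lact_apply, ract_apply, smul_smul]

lemma ract_lact (a b : A) (x : N) :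
    ract k b (lact k a x) = (a ⊗ₜ[k] MulOpposite.op b) • x := by
  simp [lact_apply, ract_apply, smul_smul]

lemma lact_one (x : N) : lact k (1 : A) x = x := by
  rw [lact_apply, ← Algebra.TensorProduct.one_def, one_smul]

lemma lact_zero (x : N) : lact k (0 : A) x = 0 := by
  rw [lact_apply, TensorProduct.zero_tmul]; exact zero_smul (Env k A) x

lemma lact_add (a b : A) (x : N) : lact k (a + b) x = lact k a x + lact k b x := by
  rw [lact_apply, TensorProduct.add_tmul, add_smul]; rfl

lemma lact_mul (a b : A) (x : N) : lact k (a * b) x = lact k a (lact k b x) := by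
  simp [lact_apply, smul_smul]

lemma ract_one (x : N) : ract k (1 : A) x = x := by
  rw [ract_apply, MulOpposite.op_one, ← Algebra.TensorProduct.one_def, one_smul]

lemma ract_zero (x : N) : ract k (0 : A) x = 0 := by
  rw [ract_apply, MulOpposite.op_zero, TensorProduct.tmul_zero]; exact zero_smul (Env k A) x

lemma ract_add (a b : A) (x : N) : ract k (a + b) x = ract k a x + ract k b x := by
  rw [ract_apply, MulOpposite.op_add, TensorProduct.tmul_add, add_smul]; rfl

lemma ract_mul (a b : A) (x : N) : ract k (a * b) x = ract k b (ract k a x) := by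
  simp [ract_apply, smul_smul]

lemma lact_algebraMap (c : k) (x : N) :
    lact k (algebraMap k A c) x = ract k (algebraMap k A c) x := by
  rw [lact_apply, ract_apply, Algebra.algebraMap_eq_smul_one, MulOpposite.op_smul,
    TensorProduct.smul_tmul]
  rfl

variable {N' : Type*} [AddCommGroup N'] [Module (Env k A) N']

@[simp] lemma map_lact (f : N →ₗ[Env k A] N') (a : A) (x : N) : f (lact k a x) = lact k a (f x) := by
  simp [lact_apply]

@[simp] lemma map_ract (f : N →ₗ[Env k A] N') (a : A) (x : N) : f (ract k a x) = ract k a (f x) := by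
  simp [ract_apply]

/-- An additive map which commutes with the left and the right action of `A` is `A^e`-linear. -/
def homOfActs (f : N →+ N') (hl : ∀ (a : A) x, f (lact k a x) = lact k a (f x))
    (hr : ∀ (a : A) x, f (ract k a x) = ract k a (f x)) : N →ₗ[Env k A] N' where
  toFun := f
  map_add' := f.map_add
  map_smul' r x := by
    induction r using TensorProduct.induction_on with
    | zero =>
      have h1 : (0 : Env k A) • x = 0 := zero_smul (Env k A) x
      have h2 : (0 : Env k A) • f x = 0 := zero_smul (Env k A) (f x)
      exact (congrArg f h1).trans ((map_zero f).trans h2.symm)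
    | tmul a b =>
      have := lact_ract k a b.unop x
      simp only [MulOpposite.op_unop] at this
      rw [← this, hl, hr, lact_ract]; rfl
    | add r s hr hs =>
      simp only [RingHom.id_apply] at hr hs ⊢
      rw [add_smul, map_add, hr, hs, add_smul]

end

/-- The bimodule given by commuting left and right actions of `A` that agree on `k`. -/
abbrev envModule (X : Type*) [AddCommGroup X] (L : A →+* AddMonoid.End X)
    (R : Aᵐᵒᵖ →+* AddMonoid.End X) (hc : ∀ a b x, L a (R b x) = R b (L a x))
    (hk : ∀ (c : k) x, L (algebraMap k A c) x = R (algebraMap k Aᵐᵒᵖ c) x) :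
    Module (Env k A) X :=
  letI : Module A X := Module.compHom X L
  letI : Module Aᵐᵒᵖ X := Module.compHom X R
  letI : Module k X := Module.compHom X (L.comp (algebraMap k A))
  haveI : IsScalarTower k A X := ⟨fun c a x => by
    change L (c • a) x = L (algebraMap k A c) (L a x)
    rw [Algebra.smul_def, map_mul]; rfl⟩
  haveI : IsScalarTower k Aᵐᵒᵖ X := ⟨fun c a x => by
    change R (c • a) x = L (algebraMap k A c) (R a x)
    rw [hk, Algebra.smul_def, map_mul]; rfl⟩
  haveI : SMulCommClass A Aᵐᵒᵖ X := ⟨fun a b x => hc a b x⟩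
  TensorProduct.Algebra.module

lemma envModule_smul (X : Type*) [AddCommGroup X] (L : A →+* AddMonoid.End X)
    (R : Aᵐᵒᵖ →+* AddMonoid.End X) (hc : ∀ a b x, L a (R b x) = R b (L a x))
    (hk : ∀ (c : k) x, L (algebraMap k A c) x = R (algebraMap k Aᵐᵒᵖ c) x) (a : A) (b : Aᵐᵒᵖ)
    (x : X) : letI := envModule k X L R hc hk
      (a ⊗ₜ[k] b : Env k A) • x = L a (R b x) := by
  let : Module A X := Module.compHom X L
  let : Module Aᵐᵒᵖ X := Module.compHom X R
  let : Module k X := Module.compHom X (L.comp (algebraMap k A))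
  have : IsScalarTower k A X := ⟨fun c a x => by
    change L (c • a) x = L (algebraMap k A c) (L a x)
    rw [Algebra.smul_def, map_mul]; rfl⟩
  have : IsScalarTower k Aᵐᵒᵖ X := ⟨fun c a x => by
    change R (c • a) x = L (algebraMap k A c) (R a x)
    rw [hk, Algebra.smul_def, map_mul]; rfl⟩
  have : SMulCommClass A Aᵐᵒᵖ X := ⟨fun a b x => hc a b x⟩
  exact TensorProduct.Algebra.smul_def a b x

variable (A)

/-! ### The bimodule `N ⊗_A M` -/

/-- The tensor product `N ⊗_A M` of bimodules: `x a ⊗ y = x ⊗ a y`. -/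
def TA (N M : Type*) [AddCommGroup N] [Module (Env k A) N] [AddCommGroup M] [Module (Env k A) M] :
    Type _ :=
  Balanced (N := N) (M := M) (fun a : A => ract k a) (fun a : A => lact k a)

section TA

variable {N M : Type*} [AddCommGroup N] [Module (Env k A) N] [AddCommGroup M] [Module (Env k A) M]
variable {N' M' : Type*} [AddCommGroup N'] [Module (Env k A) N']
  [AddCommGroup M'] [Module (Env k A) M']

instance : AddCommGroup (TA k A N M) :=
  inferInstanceAs (AddCommGroup (Balanced _ _))

/-- The element `x ⊗ y` of `N ⊗_A M`. -/
def TA.mk (x : N) (y : M) : TA k A N M := Balanced.mk _ _ x y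

lemma TA.mk_balance (a : A) (x : N) (y : M) :
    TA.mk k A (ract k a x) y = TA.mk k A x (lact k a y) :=
  Balanced.balance a x y

lemma TA.mk_add_left (x x' : N) (y : M) :
    TA.mk k A (x + x') y = TA.mk k A x y + TA.mk k A x' y := Balanced.mk_add_left x x' y

lemma TA.mk_add_right (x : N) (y y' : M) :
    TA.mk k A x (y + y') = TA.mk k A x y + TA.mk k A x y' := Balanced.mk_add_right x y y'

lemma TA.mk_zero_left (y : M) : TA.mk k A (0 : N) y = 0 := by
  simpa using TA.mk_add_left k A (0 : N) 0 y

lemma TA.mk_zero_right (x : N) : TA.mk k A x (0 : M) = 0 := by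
  simpa using TA.mk_add_right k A x (0 : M) 0

lemma TA.hom_ext {X : Type*} [AddCommGroup X] {f g : TA k A N M →+ X}
    (h : ∀ x y, f (TA.mk k A x y) = g (TA.mk k A x y)) : f = g := Balanced.hom_ext h

@[elab_as_elim]
lemma TA.induction {p : TA k A N M → Prop} (z : TA k A N M) (h0 : p 0)
    (hmk : ∀ x y, p (TA.mk k A x y)) (hadd : ∀ z z', p z → p z' → p (z + z')) : p z :=
  Balanced.induction z h0 hmk hadd

/-- The left action `a (x ⊗ y) = a x ⊗ y`. -/
def TA.left (a : A) : TA k A N M →+ TA k A N M :=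
  Balanced.map (lact k a) (AddMonoidHom.id M)
    (fun _ _ => by rw [lact_ract, ract_lact]) (fun _ _ => rfl)

lemma TA.left_mk (a : A) (x : N) (y : M) :
    TA.left k A a (TA.mk k A x y) = TA.mk k A (lact k a x) y := rfl

/-- The right action `(x ⊗ y) a = x ⊗ y a`. -/
def TA.right (a : A) : TA k A N M →+ TA k A N M :=
  Balanced.map (AddMonoidHom.id N) (ract k a)
    (fun _ _ => rfl) (fun _ _ => by rw [lact_ract, ract_lact])

lemma TA.right_mk (a : A) (x : N) (y : M) :
    TA.right k A a (TA.mk k A x y) = TA.mk k A x (ract k a y) := rfl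

/-- The left action as a ring homomorphism. -/
def TA.leftHom : A →+* AddMonoid.End (TA k A N M) where
  toFun a := TA.left k A a
  map_one' := TA.hom_ext k A fun x y => by
    rw [TA.left_mk, lact_one]; rfl
  map_mul' a b := TA.hom_ext k A fun x y => by
    rw [TA.left_mk, lact_mul]; rfl
  map_zero' := TA.hom_ext k A fun x y => by
    rw [TA.left_mk, lact_zero, TA.mk_zero_left]; rfl
  map_add' a b := TA.hom_ext k A fun x y => by
    rw [TA.left_mk, lact_add, TA.mk_add_left]; rfl

/-- The right action as a ring homomorphism. -/
def TA.rightHom : Aᵐᵒᵖ →+* AddMonoid.End (TA k A N M) where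
  toFun a := TA.right k A a.unop
  map_one' := TA.hom_ext k A fun x y => by
    rw [TA.right_mk, MulOpposite.unop_one, ract_one]; rfl
  map_mul' a b := TA.hom_ext k A fun x y => by
    rw [TA.right_mk, MulOpposite.unop_mul, ract_mul]; rfl
  map_zero' := TA.hom_ext k A fun x y => by
    rw [TA.right_mk, MulOpposite.unop_zero, ract_zero, TA.mk_zero_right]; rfl
  map_add' a b := TA.hom_ext k A fun x y => by
    rw [TA.right_mk, MulOpposite.unop_add, ract_add, TA.mk_add_right]; rfl

lemma TA.left_right (a b : A) (z : TA k A N M) :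
    TA.left k A a (TA.right k A b z) = TA.right k A b (TA.left k A a z) := by
  induction z using TA.induction with
  | h0 => simp only [map_zero]
  | hmk x y => rw [TA.right_mk, TA.left_mk, TA.left_mk, TA.right_mk]
  | hadd z z' h h' => simp only [map_add, h, h']

lemma TA.left_algebraMap (c : k) (z : TA k A N M) :
    TA.left k A (algebraMap k A c) z = TA.right k A (algebraMap k A c) z :=
  DFunLike.congr_fun (TA.hom_ext k A fun x y => by
    rw [TA.left_mk, TA.right_mk, lact_algebraMap, TA.mk_balance, lact_algebraMap]) z

instance : Module (Env k A) (TA k A N M) :=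
  envModule k (TA k A N M) (TA.leftHom k A) (TA.rightHom k A)
    (fun a b z => TA.left_right k A a b.unop z) (fun c z => TA.left_algebraMap k A c z)

lemma TA.smul_mk (a b : A) (x : N) (y : M) :
    (a ⊗ₜ[k] MulOpposite.op b : Env k A) • TA.mk k A x y =
      TA.mk k A (lact k a x) (ract k b y) :=
  envModule_smul k (TA k A N M) (TA.leftHom k A) (TA.rightHom k A)
    (fun a b z => TA.left_right k A a b.unop z) (fun c z => TA.left_algebraMap k A c z)
    a (MulOpposite.op b) _

lemma TA.lact_mk (a : A) (x : N) (y : M) :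
    lact k a (TA.mk k A x y) = TA.mk k A (lact k a x) y := by
  have h := TA.smul_mk k A a 1 x y
  rwa [ract_one] at h

lemma TA.ract_mk (a : A) (x : N) (y : M) :
    ract k a (TA.mk k A x y) = TA.mk k A x (ract k a y) := by
  have h := TA.smul_mk k A 1 a x y
  rwa [lact_one] at h

/-- The additive map `f ⊗ g : N ⊗_A M → N' ⊗_A M'`. -/
def TA.mapAdd (f : N →ₗ[Env k A] N') (g : M →ₗ[Env k A] M') : TA k A N M →+ TA k A N' M' :=
  Balanced.map f.toAddMonoidHom g.toAddMonoidHom (fun _ _ => map_ract k f _ _)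
    (fun _ _ => map_lact k g _ _)

lemma TA.mapAdd_mk (f : N →ₗ[Env k A] N') (g : M →ₗ[Env k A] M') (x : N) (y : M) :
    TA.mapAdd k A f g (TA.mk k A x y) = TA.mk k A (f x) (g y) := rfl

/-- The bimodule map `f ⊗ g : N ⊗_A M → N' ⊗_A M'`. -/
def TA.map (f : N →ₗ[Env k A] N') (g : M →ₗ[Env k A] M') :
    TA k A N M →ₗ[Env k A] TA k A N' M' :=
  homOfActs k (TA.mapAdd k A f g)
    (fun a z => by
      induction z using TA.induction with
      | h0 => simp only [map_zero]
      | hmk x y => rw [TA.lact_mk, TA.mapAdd_mk, TA.mapAdd_mk, TA.lact_mk, map_lact]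
      | hadd z z' h h' => simp only [map_add, h, h'])
    (fun a z => by
      induction z using TA.induction with
      | h0 => simp only [map_zero]
      | hmk x y => rw [TA.ract_mk, TA.mapAdd_mk, TA.mapAdd_mk, TA.ract_mk, map_ract]
      | hadd z z' h h' => simp only [map_add, h, h'])

lemma TA.map_mk (f : N →ₗ[Env k A] N') (g : M →ₗ[Env k A] M') (x : N) (y : M) :
    TA.map k A f g (TA.mk k A x y) = TA.mk k A (f x) (g y) := rfl

end TA

/-! ### The group `N ⊗_{A^e} P` -/

/-- The tensor product `N ⊗_{A^e} P`: `b x a ⊗ p = x ⊗ a p b`, where `N` is regarded as a right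
`A^e`-module through `x (a ⊗ b) = b x a`. -/
def TAe (N P : Type*) [AddCommGroup N] [Module (Env k A) N] [AddCommGroup P] [Module (Env k A) P] :
    Type _ :=
  Balanced (N := N) (M := P) (fun ab : A × A => (lact k ab.2).comp (ract k ab.1))
    (fun ab : A × A => (lact k ab.1).comp (ract k ab.2))

section TAe

variable {N P : Type*} [AddCommGroup N] [Module (Env k A) N] [AddCommGroup P] [Module (Env k A) P]
variable {N' P' : Type*} [AddCommGroup N'] [Module (Env k A) N']
  [AddCommGroup P'] [Module (Env k A) P']

instance : AddCommGroup (TAe k A N P) :=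
  inferInstanceAs (AddCommGroup (Balanced _ _))

/-- The element `x ⊗ p` of `N ⊗_{A^e} P`. -/
def TAe.mk (x : N) (p : P) : TAe k A N P := Balanced.mk _ _ x p

/-- The map `f ⊗ g : N ⊗_{A^e} P → N' ⊗_{A^e} P'`. -/
def TAe.map (f : N →ₗ[Env k A] N') (g : P →ₗ[Env k A] P') : TAe k A N P →+ TAe k A N' P' :=
  Balanced.map f.toAddMonoidHom g.toAddMonoidHom
    (fun _ _ => (map_lact k f _ _).trans (congrArg _ (map_ract k f _ _)))
    (fun _ _ => (map_lact k g _ _).trans (congrArg _ (map_ract k g _ _)))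

lemma TAe.map_mk (f : N →ₗ[Env k A] N') (g : P →ₗ[Env k A] P') (x : N) (p : P) :
    TAe.map k A f g (TAe.mk k A x p) = TAe.mk k A (f x) (g p) := rfl

lemma TAe.balance (a b : A) (x : N) (p : P) :
    TAe.mk k A (lact k b (ract k a x)) p = TAe.mk k A x (lact k a (ract k b p)) :=
  Balanced.balance (a, b) x p

lemma TAe.mk_add_left (x x' : N) (p : P) :
    TAe.mk k A (x + x') p = TAe.mk k A x p + TAe.mk k A x' p := Balanced.mk_add_left x x' p

lemma TAe.mk_add_right (x : N) (p p' : P) :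
    TAe.mk k A x (p + p') = TAe.mk k A x p + TAe.mk k A x p' := Balanced.mk_add_right x p p'

@[elab_as_elim]
lemma TAe.induction {q : TAe k A N P → Prop} (z : TAe k A N P) (h0 : q 0)
    (hmk : ∀ x p, q (TAe.mk k A x p)) (hadd : ∀ z z', q z → q z' → q (z + z')) : q z :=
  Balanced.induction z h0 hmk hadd

end TAe

end Bimodule

section Bar

variable (k : Type u) (A : Type v) [CommRing k] [Ring A] [Algebra k A]

/-! ### The bar resolution -/

lemma map_update_tprod (n : ℕ) (i : Fin (n + 1)) (φ : A →ₗ[k] A) (g : Fin (n + 1) → A) :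
    PiTensorProduct.map (Function.update (fun _ : Fin (n + 1) => (LinearMap.id : A →ₗ[k] A)) i φ)
      (PiTensorProduct.tprod k g) = PiTensorProduct.tprod k (Function.update g i (φ (g i))) := by
  rw [PiTensorProduct.map_tprod]
  congr 1
  ext j
  by_cases h : j = i
  · subst h; simp
  · simp [h]

/-- The action of `φ : A → A` on the `i`-th factor of `A^{⊗(n+1)}`. -/
def actAt (n : ℕ) (i : Fin (n + 1)) :
    (A →ₗ[k] A) →ₗ[k] Module.End k (⨂[k] (_ : Fin (n + 1)), A) :=
  (PiTensorProduct.mapMultilinear k (fun _ : Fin (n + 1) => A) (fun _ => A)).toLinearMap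
    (fun _ => LinearMap.id) i

lemma actAt_tprod (n : ℕ) (i : Fin (n + 1)) (φ : A →ₗ[k] A) (g : Fin (n + 1) → A) :
    actAt k A n i φ (PiTensorProduct.tprod k g) =
      PiTensorProduct.tprod k (Function.update g i (φ (g i))) :=
  map_update_tprod k A n i φ g

/-- The left action of `A` on `A^{⊗(n+1)}`, by multiplication of the first factor. -/
def tensorLeft (n : ℕ) : A →ₐ[k] Module.End k (⨂[k] (_ : Fin (n + 1)), A) :=
  AlgHom.ofLinearMap (actAt k A n 0 ∘ₗ LinearMap.mul k A)
    (PiTensorProduct.ext <| MultilinearMap.ext fun g => by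
      refine (actAt_tprod k A n 0 _ g).trans ?_
      simp)
    (fun a b => PiTensorProduct.ext <| MultilinearMap.ext fun g => by
      refine (actAt_tprod k A n 0 _ g).trans ?_
      refine Eq.trans ?_ (congrArg (actAt k A n 0 (LinearMap.mul k A a))
        (actAt_tprod k A n 0 (LinearMap.mul k A b) g).symm)
      rw [actAt_tprod]
      simp [mul_assoc])

/-- The right action of `A` on `A^{⊗(n+1)}`, by multiplication of the last factor. -/
def tensorRight (n : ℕ) : Aᵐᵒᵖ →ₐ[k] Module.End k (⨂[k] (_ : Fin (n + 1)), A) :=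
  AlgHom.ofLinearMap (actAt k A n (Fin.last n) ∘ₗ (LinearMap.mul k A).flip ∘ₗ
      (MulOpposite.opLinearEquiv k).symm.toLinearMap)
    (PiTensorProduct.ext <| MultilinearMap.ext fun g => by
      refine (actAt_tprod k A n _ _ g).trans ?_
      simp)
    (fun a b => PiTensorProduct.ext <| MultilinearMap.ext fun g => by
      refine (actAt_tprod k A n _ _ g).trans ?_
      refine Eq.trans ?_ (congrArg (actAt k A n (Fin.last n) ((LinearMap.mul k A).flip a.unop))
        (actAt_tprod k A n _ ((LinearMap.mul k A).flip b.unop) g).symm)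
      rw [actAt_tprod]
      simp [mul_assoc])

lemma tensorLeft_tprod (n : ℕ) (a : A) (g : Fin (n + 1) → A) :
    tensorLeft k A n a (PiTensorProduct.tprod k g) =
      PiTensorProduct.tprod k (Function.update g 0 (a * g 0)) :=
  actAt_tprod k A n 0 _ g

lemma tensorRight_tprod (n : ℕ) (a : Aᵐᵒᵖ) (g : Fin (n + 1) → A) :
    tensorRight k A n a (PiTensorProduct.tprod k g) =
      PiTensorProduct.tprod k (Function.update g (Fin.last n) (g (Fin.last n) * a.unop)) :=
  actAt_tprod k A n _ _ g

lemma tensor_hom_ext {n : ℕ} {X : Type*} [AddCommGroup X] [Module k X]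
    {f g : (⨂[k] (_ : Fin n), A) →ₗ[k] X}
    (h : ∀ a, f (PiTensorProduct.tprod k a) = g (PiTensorProduct.tprod k a)) : f = g :=
  PiTensorProduct.ext <| MultilinearMap.ext h

lemma tensorLeft_tensorRight (n : ℕ) (a : A) (b : Aᵐᵒᵖ) :
    Commute (tensorLeft k A n a) (tensorRight k A n b) := by
  refine tensor_hom_ext k A fun g => ?_
  simp only [Module.End.mul_apply, tensorLeft_tprod, tensorRight_tprod]
  congr 1
  rcases n with _ | n
  · ext i
    have : i = 0 := Fin.ext (by omega)
    subst this
    simp [mul_assoc]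
  · have h : (0 : Fin (n + 2)) ≠ Fin.last (n + 1) := by simp [Fin.ext_iff]
    rw [Function.update_of_ne h, Function.update_of_ne h.symm, Function.update_comm h]

lemma contractNth_update {n : ℕ} (j : Fin (n + 1)) (s : Fin (n + 2)) (g : Fin (n + 2) → A) :
    ∃ (i : Fin (n + 1)) (φ : A →ₗ[k] A), ∀ x : A,
      Fin.contractNth j.castSucc (· * ·) (Function.update g s x) =
        Function.update (Fin.contractNth j.castSucc (· * ·) g) i (φ x) := by
  rcases lt_trichotomy (s : ℕ) j with h | h | h
  · refine ⟨⟨s, by omega⟩, LinearMap.id, fun x => ?_⟩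
    ext i
    simp only [Fin.contractNth, Function.update_apply, Fin.ext_iff, Fin.val_castSucc, Fin.val_succ,
      LinearMap.id_apply]
    grind
  · refine ⟨j, LinearMap.mulRight k (g j.succ), fun x => ?_⟩
    ext i
    simp only [Fin.contractNth, Function.update_apply, Fin.ext_iff, Fin.val_castSucc, Fin.val_succ,
      LinearMap.mulRight_apply]
    have : ∀ i : Fin (n+1), (i : ℕ) = j → g i.succ = g j.succ := fun i hi => by rw [Fin.ext hi]
    grind
  · by_cases h' : (s : ℕ) = j + 1
    · refine ⟨j, LinearMap.mulLeft k (g j.castSucc), fun x => ?_⟩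
      ext i
      simp only [Fin.contractNth, Function.update_apply, Fin.ext_iff, Fin.val_castSucc,
        Fin.val_succ, LinearMap.mulLeft_apply]
      have : ∀ i : Fin (n+1), (i : ℕ) = j → g i.castSucc = g j.castSucc :=
        fun i hi => by rw [Fin.ext hi]
      grind
    · refine ⟨⟨s - 1, by omega⟩, LinearMap.id, fun x => ?_⟩
      ext i
      simp only [Fin.contractNth, Function.update_apply, Fin.ext_iff, Fin.val_castSucc,
        Fin.val_succ, LinearMap.id_apply]
      grind

/-- The face map `(a_0, …, a_{n+1}) ↦ a_0 ⊗ ⋯ ⊗ a_j a_{j+1} ⊗ ⋯ ⊗ a_{n+1}`. -/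
def face (n : ℕ) (j : Fin (n + 1)) :
    MultilinearMap k (fun _ : Fin (n + 2) => A) (⨂[k] (_ : Fin (n + 1)), A) where
  toFun g := PiTensorProduct.tprod k (Fin.contractNth j.castSucc (· * ·) g)
  map_update_add' {inst} g s x y := by
    obtain ⟨i, φ, h⟩ := contractNth_update k A j s g
    cases Subsingleton.elim inst (instDecidableEqFin (n+2))
    simp only [h, map_add, MultilinearMap.map_update_add]
  map_update_smul' {inst} g s c x := by
    obtain ⟨i, φ, h⟩ := contractNth_update k A j s g
    cases Subsingleton.elim inst (instDecidableEqFin (n+2))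
    simp only [h, map_smul, MultilinearMap.map_update_smul]

/-- The map `a_0 ⊗ ⋯ ⊗ a_{n+1} ↦ ∑_{j=0}^{n} (-1)^j a_0 ⊗ ⋯ ⊗ a_j a_{j+1} ⊗ ⋯ ⊗ a_{n+1}`. -/
def tensorD (n : ℕ) : (⨂[k] (_ : Fin (n + 2)), A) →ₗ[k] ⨂[k] (_ : Fin (n + 1)), A :=
  ∑ j : Fin (n + 1), ((-1 : k) ^ (j : ℕ)) • PiTensorProduct.lift (face k A n j)

lemma tensorD_tprod (n : ℕ) (g : Fin (n + 2) → A) :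
    tensorD k A n (PiTensorProduct.tprod k g) = ∑ j : Fin (n + 1), ((-1 : k) ^ (j : ℕ)) •
      PiTensorProduct.tprod k (Fin.contractNth j.castSucc (· * ·) g) := by
  rw [tensorD, LinearMap.sum_apply]
  refine Finset.sum_congr rfl fun j _ => ?_
  rw [LinearMap.smul_apply, PiTensorProduct.lift.tprod]
  rfl

lemma tensorD_left (n : ℕ) (a : A) (w : ⨂[k] (_ : Fin (n + 2)), A) :
    tensorD k A n (tensorLeft k A (n + 1) a w) = tensorLeft k A n a (tensorD k A n w) := by
  refine LinearMap.congr_fun (f := tensorD k A n ∘ₗ tensorLeft k A (n + 1) a)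
    (g := tensorLeft k A n a ∘ₗ tensorD k A n) (tensor_hom_ext k A fun g => ?_) w
  simp only [LinearMap.comp_apply, tensorLeft_tprod, tensorD_tprod, map_sum, map_smul]
  refine Finset.sum_congr rfl fun j _ => ?_
  congr 2
  ext i
  simp only [Fin.contractNth, Function.update_apply, Fin.ext_iff, Fin.val_castSucc, Fin.val_succ,
    Fin.val_zero]
  by_cases hi : (i : ℕ) = 0
  · have : i = 0 := Fin.ext hi
    subst this
    by_cases hj : (j : ℕ) = 0
    · simp [hj, mul_assoc]
    · simp [Nat.pos_of_ne_zero hj]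
  · simp [hi]

lemma tensorD_right (n : ℕ) (a : Aᵐᵒᵖ) (w : ⨂[k] (_ : Fin (n + 2)), A) :
    tensorD k A n (tensorRight k A (n + 1) a w) = tensorRight k A n a (tensorD k A n w) := by
  refine LinearMap.congr_fun (f := tensorD k A n ∘ₗ tensorRight k A (n + 1) a)
    (g := tensorRight k A n a ∘ₗ tensorD k A n) (tensor_hom_ext k A fun g => ?_) w
  simp only [LinearMap.comp_apply, tensorRight_tprod, tensorD_tprod, map_sum, map_smul]
  refine Finset.sum_congr rfl fun j _ => ?_
  congr 2
  ext i
  simp only [Fin.contractNth, Function.update_apply, Fin.ext_iff, Fin.val_castSucc, Fin.val_succ,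
    Fin.val_last]
  by_cases hi : (i : ℕ) = n
  · have : i = Fin.last n := Fin.ext hi
    subst this
    by_cases hj : n = (j : ℕ)
    · simp [← hj, mul_assoc]
    · have : ¬ n < (j : ℕ) := by omega
      simp [hj, this]
  · have : (i : ℕ) ≠ n + 1 := by omega
    simp [hi, this]

/-- The map `w ↦ 1 ⊗ w`. -/
def tensorS (n : ℕ) : (⨂[k] (_ : Fin n), A) →ₗ[k] ⨂[k] (_ : Fin (n + 1)), A :=
  PiTensorProduct.lift
    ((PiTensorProduct.tprod k (s := fun _ : Fin (n + 1) => A)).curryLeft 1)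

lemma tensorS_tprod (n : ℕ) (g : Fin n → A) :
    tensorS k A n (PiTensorProduct.tprod k g) = PiTensorProduct.tprod k (Fin.cons 1 g) :=
  PiTensorProduct.lift.tprod _

lemma tensorD_tensorS (n : ℕ) (w : ⨂[k] (_ : Fin (n + 2)), A) :
    tensorD k A (n + 1) (tensorS k A (n + 2) w) = w - tensorS k A (n + 1) (tensorD k A n w) := by
  refine LinearMap.congr_fun (f := tensorD k A (n + 1) ∘ₗ tensorS k A (n + 2))
    (g := LinearMap.id - tensorS k A (n + 1) ∘ₗ tensorD k A n) (tensor_hom_ext k A fun g => ?_) w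
  simp only [LinearMap.comp_apply, LinearMap.sub_apply, LinearMap.id_apply, tensorS_tprod,
    tensorD_tprod, map_sum, map_smul]
  rw [Fin.sum_univ_succ, sub_eq_add_neg, ← Finset.sum_neg_distrib]
  congr 1
  · rw [Fin.val_zero, pow_zero, one_smul]
    congr 1
    ext i
    refine Fin.cases ?_ (fun i => ?_) i
    · simp [Fin.contractNth]
    · simp [Fin.contractNth]
  · refine Finset.sum_congr rfl fun j _ => ?_
    rw [Fin.val_succ, pow_succ, mul_neg_one, neg_smul]
    congr 3
    ext i
    refine Fin.cases ?_ (fun i => ?_) i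
    · simp [Fin.contractNth]
    · simp [Fin.contractNth, Fin.castSucc_succ]

lemma tensor_eq_left_tensorS (n : ℕ) (g : Fin (n + 1) → A) :
    PiTensorProduct.tprod k g =
      tensorLeft k A n (g 0) (tensorS k A n (PiTensorProduct.tprod k (Fin.tail g))) := by
  rw [tensorS_tprod, tensorLeft_tprod]
  congr 1
  ext i
  refine Fin.cases ?_ (fun i => ?_) i
  · simp
  · simp [Fin.tail]

lemma tensorD_tensorD (n : ℕ) (w : ⨂[k] (_ : Fin (n + 3)), A) :
    tensorD k A n (tensorD k A (n + 1) w) = 0 := by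
  induction n with
  | zero =>
    refine LinearMap.congr_fun (f := tensorD k A 0 ∘ₗ tensorD k A 1) (g := 0)
      (tensor_hom_ext k A fun g => ?_) w
    rw [LinearMap.comp_apply, tensorD_tprod, Fin.sum_univ_two, map_add, map_smul, map_smul,
      tensorD_tprod, tensorD_tprod, Fin.sum_univ_one, Fin.sum_univ_one, LinearMap.zero_apply]
    simp only [Fin.isValue, Fin.val_zero, pow_zero, one_smul, Fin.val_one, pow_one, neg_smul]
    rw [← sub_eq_add_neg, sub_eq_zero]
    congr 1
    ext i
    have : i = 0 := Fin.ext (by omega)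
    subst this
    simp [Fin.contractNth, mul_assoc]
  | succ n ih =>
    refine LinearMap.congr_fun (f := tensorD k A (n + 1) ∘ₗ tensorD k A (n + 2)) (g := 0)
      (tensor_hom_ext k A fun g => ?_) w
    rw [tensor_eq_left_tensorS, LinearMap.comp_apply, tensorD_left, tensorD_left, tensorD_tensorS,
      map_sub, tensorD_tensorS, ih, map_zero, sub_zero, sub_self, map_zero]
    rfl

end Bar

section BarResolution

variable (k : Type u) (A : Type v) [CommRing k] [Ring A] [Algebra k A]

/-- The degree `n` term `Bar(A)_n = A^{⊗(n+2)}` of the bar resolution. -/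
def Bar (n : ℕ) : Type (max u v) := ⨂[k] (_ : Fin (n + 2)), A

instance (n : ℕ) : AddCommGroup (Bar k A n) :=
  inferInstanceAs (AddCommGroup (⨂[k] (_ : Fin (n + 2)), A))

instance (n : ℕ) : Module k (Bar k A n) :=
  inferInstanceAs (Module k (⨂[k] (_ : Fin (n + 2)), A))

/-- The element `a_0 ⊗ ⋯ ⊗ a_{n+1}` of `Bar(A)_n`. -/
def Bar.tprod {n : ℕ} (a : Fin (n + 2) → A) : Bar k A n := PiTensorProduct.tprod k a

/-- The action of `A^e` on `A^{⊗(n+2)}`. -/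
def Bar.action (n : ℕ) : Env k A →ₐ[k] Module.End k (⨂[k] (_ : Fin (n + 2)), A) :=
  Algebra.TensorProduct.lift (tensorLeft k A (n + 1)) (tensorRight k A (n + 1))
    (tensorLeft_tensorRight k A (n + 1))

instance (n : ℕ) : Module (Env k A) (Bar k A n) :=
  Module.compHom (⨂[k] (_ : Fin (n + 2)), A) (Bar.action k A n).toRingHom

lemma Bar.tmul_smul (n : ℕ) (a : A) (b : Aᵐᵒᵖ) (w : Bar k A n) :
    (a ⊗ₜ[k] b : Env k A) • w = tensorLeft k A (n + 1) a (tensorRight k A (n + 1) b w) :=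
  LinearMap.congr_fun (Algebra.TensorProduct.lift_tmul (tensorLeft k A (n + 1))
    (tensorRight k A (n + 1)) (tensorLeft_tensorRight k A (n + 1)) a b) w

lemma Bar.lact_eq {n : ℕ} (a : A) (w : Bar k A n) :
    lact k a w = tensorLeft k A (n + 1) a w := by
  rw [lact_apply, Bar.tmul_smul, map_one]; rfl

lemma Bar.ract_eq {n : ℕ} (a : A) (w : Bar k A n) :
    ract k a w = tensorRight k A (n + 1) (MulOpposite.op a) w := by
  rw [ract_apply, Bar.tmul_smul, map_one]; rfl

/-- `a (a_0 ⊗ ⋯ ⊗ a_{n+1}) = a a_0 ⊗ ⋯ ⊗ a_{n+1}`. -/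
lemma Bar.lact_tprod {n : ℕ} (a : A) (g : Fin (n + 2) → A) :
    lact k a (Bar.tprod k A g) = Bar.tprod k A (Function.update g 0 (a * g 0)) := by
  rw [Bar.lact_eq]; exact tensorLeft_tprod k A (n + 1) a g

/-- `(a_0 ⊗ ⋯ ⊗ a_{n+1}) a = a_0 ⊗ ⋯ ⊗ a_{n+1} a`. -/
lemma Bar.ract_tprod {n : ℕ} (a : A) (g : Fin (n + 2) → A) :
    ract k a (Bar.tprod k A g) =
      Bar.tprod k A (Function.update g (Fin.last (n + 1)) (g (Fin.last (n + 1)) * a)) := by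
  rw [Bar.ract_eq]; exact tensorRight_tprod k A (n + 1) (MulOpposite.op a) g

/-- The differential `d_{n+1} : Bar(A)_{n+1} → Bar(A)_n`. -/
def Bar.d (n : ℕ) : Bar k A (n + 1) →ₗ[Env k A] Bar k A n :=
  homOfActs k (AddMonoidHomClass.toAddMonoidHom (tensorD k A (n + 1)) : Bar k A (n + 1) →+ Bar k A n)
    (fun a w => by
      rw [Bar.lact_eq, Bar.lact_eq]; exact tensorD_left k A (n + 1) a w)
    (fun a w => by
      rw [Bar.ract_eq, Bar.ract_eq]; exact tensorD_right k A (n + 1) _ w)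

/-- The formula for the differential: the `j`-th summand is
`(-1)^j a_0 ⊗ ⋯ ⊗ a_j a_{j+1} ⊗ ⋯ ⊗ a_{n+2}`. -/
lemma Bar.d_tprod (n : ℕ) (g : Fin (n + 3) → A) :
    Bar.d k A n (Bar.tprod k A g) = ∑ j : Fin (n + 2), ((-1 : k) ^ (j : ℕ)) •
      Bar.tprod k A (Fin.contractNth j.castSucc (· * ·) g) :=
  tensorD_tprod k A (n + 1) g

lemma Bar.d_d (n : ℕ) (w : Bar k A (n + 2)) : Bar.d k A n (Bar.d k A (n + 1) w) = 0 :=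
  tensorD_tensorD k A (n + 1) w

/-- The augmentation `d_0 : Bar(A)_0 = A ⊗ A → A`, the multiplication of `A`. -/
def Bar.aug : Bar k A 0 →+ A :=
  AddMonoidHomClass.toAddMonoidHom (PiTensorProduct.lift (MultilinearMap.mkPiAlgebraFin k 2 A))

lemma Bar.aug_tprod (g : Fin 2 → A) : Bar.aug k A (Bar.tprod k A g) = g 0 * g 1 := by
  refine (PiTensorProduct.lift.tprod (φ := MultilinearMap.mkPiAlgebraFin k 2 A) g).trans ?_
  simp [MultilinearMap.mkPiAlgebraFin_apply, List.ofFn_succ]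

@[elab_as_elim]
lemma Bar.induction {n : ℕ} {p : Bar k A n → Prop} (w : Bar k A n)
    (htprod : ∀ (c : k) a, p (c • Bar.tprod k A a)) (hadd : ∀ w w', p w → p w' → p (w + w')) :
    p w :=
  PiTensorProduct.induction_on w htprod hadd

lemma Bar.hom_ext {n : ℕ} {X : Type*} [AddCommGroup X] [Module k X] {f g : Bar k A n →ₗ[k] X}
    (h : ∀ a, f (Bar.tprod k A a) = g (Bar.tprod k A a)) : f = g :=
  tensor_hom_ext k A h

lemma Bar.smul_tprod {n : ℕ} (c : k) (g : Fin (n + 2) → A) :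
    c • Bar.tprod k A g = Bar.tprod k A (Function.update g 0 (algebraMap k A c * g 0)) := by
  rw [← Bar.lact_tprod, Bar.lact_eq, AlgHom.commutes]
  rfl

lemma Bar.induction' {n : ℕ} {p : Bar k A n → Prop} (w : Bar k A n)
    (htprod : ∀ a, p (Bar.tprod k A a)) (hadd : ∀ w w', p w → p w' → p (w + w')) :
    p w :=
  Bar.induction k A w (fun c a => by rw [Bar.smul_tprod]; exact htprod _) hadd

lemma Bar.aug_lact (a : A) (w : Bar k A 0) : Bar.aug k A (lact k a w) = a * Bar.aug k A w := by
  induction w using Bar.induction' with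
  | htprod g => rw [Bar.lact_tprod, Bar.aug_tprod, Bar.aug_tprod]; simp [mul_assoc]
  | hadd w w' h h' => rw [map_add, map_add, map_add, h, h', mul_add]

lemma Bar.aug_ract (a : A) (w : Bar k A 0) : Bar.aug k A (ract k a w) = Bar.aug k A w * a := by
  induction w using Bar.induction' with
  | htprod g =>
    rw [Bar.ract_tprod, Bar.aug_tprod, Bar.aug_tprod]
    have : Fin.last 1 = (1 : Fin 2) := rfl
    simp [mul_assoc, this]
  | hadd w w' h h' => rw [map_add, map_add, map_add, h, h', add_mul]

lemma Bar.aug_d (w : Bar k A 1) : Bar.aug k A (Bar.d k A 0 w) = 0 := by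
  induction w using Bar.induction' with
  | htprod g =>
    rw [Bar.d_tprod, Fin.sum_univ_two, Fin.val_zero, Fin.val_one, pow_zero, pow_one, one_smul,
      Bar.smul_tprod, map_add, Bar.aug_tprod, Bar.aug_tprod]
    simp [Fin.contractNth, mul_assoc]
  | hadd w w' h h' => rw [map_add, map_add, h, h', add_zero]

/-! ### Projectivity of the bar resolution -/

instance tensorPower_projective [Module.Projective k A] (n : ℕ) :
    Module.Projective k (⨂[k] (_ : Fin n), A) := by
  classical
  obtain ⟨s, hs⟩ := (inferInstance : Module.Projective k A).out
  let F := ⨂[k] (_ : Fin n), (A →₀ k)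
  have : Module.Free k F :=
    Module.Free.of_equiv (PiTensorProduct.ofFinsuppEquiv' (R := k) (κ := fun _ : Fin n => A)).symm
  refine Module.Projective.of_split (M := F) (PiTensorProduct.map fun _ => s)
    (PiTensorProduct.map fun _ => Finsupp.linearCombination k id) ?_
  rw [← PiTensorProduct.map_comp]
  have : (fun _ : Fin n => Finsupp.linearCombination k id ∘ₗ s) =
      fun _ => (LinearMap.id : A →ₗ[k] A) := by
    ext i x; exact hs x
  rw [this, PiTensorProduct.map_id]

lemma fin_cases_ends {n : ℕ} (s : Fin (n + 2)) :
    s = 0 ∨ s = Fin.last (n + 1) ∨ ∃ i : Fin n, s = i.succ.castSucc := by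
  refine Fin.cases (Or.inl rfl) (fun i => Or.inr ?_) s
  refine Fin.lastCases (Or.inl rfl) (fun i => Or.inr ⟨i, rfl⟩) i

/-- The multilinear map `(a_0, …, a_{n+1}) ↦ (a_0 ⊗ a_{n+1}) ⊗ (a_1 ⊗ ⋯ ⊗ a_n)`. -/
def Bar.splitMultilinear (n : ℕ) : MultilinearMap k (fun _ : Fin (n + 2) => A)
    (Env k A ⊗[k] (⨂[k] (_ : Fin n), A)) :=
  MultilinearMap.mk' (fun g => (g 0 ⊗ₜ[k] MulOpposite.op (g (Fin.last (n + 1)))) ⊗ₜ[k]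
      PiTensorProduct.tprod k (fun i : Fin n => g i.succ.castSucc))
    (fun g s x y => by
      have h0 : (0 : Fin (n + 2)) ≠ Fin.last (n + 1) := by simp [Fin.ext_iff]
      have h1 : ∀ i : Fin n, i.succ.castSucc ≠ 0 := fun i => by simp [Fin.ext_iff]
      have h2 : ∀ i : Fin n, i.succ.castSucc ≠ Fin.last (n + 1) := fun i => by
        have := i.isLt
        simp only [ne_eq, Fin.ext_iff, Fin.val_castSucc, Fin.val_succ, Fin.val_last]
        omega
      have h3 : ∀ (i : Fin n) (x : A), (fun j : Fin n =>
          Function.update g i.succ.castSucc x j.succ.castSucc) =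
            Function.update (fun j : Fin n => g j.succ.castSucc) i x := fun i x => by
        ext j
        by_cases h : j = i
        · subst h; simp
        · have h' : j.succ.castSucc ≠ i.succ.castSucc := fun e => h (by
            simpa [Fin.ext_iff] using e)
          rw [Function.update_of_ne h', Function.update_of_ne h]
      rcases fin_cases_ends s with rfl | rfl | ⟨i, rfl⟩
      · simp only [Function.update_self, Function.update_of_ne h0.symm,
          Function.update_of_ne (h1 _), TensorProduct.add_tmul]
      · simp only [Function.update_self, Function.update_of_ne h0, MulOpposite.op_add,
          Function.update_of_ne (h2 _), TensorProduct.add_tmul, TensorProduct.tmul_add]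
      · rw [h3, h3, h3, Function.update_of_ne (h1 i).symm, Function.update_of_ne (h1 i).symm,
          Function.update_of_ne (h1 i).symm, Function.update_of_ne (h2 i).symm,
          Function.update_of_ne (h2 i).symm, Function.update_of_ne (h2 i).symm,
          MultilinearMap.map_update_add, TensorProduct.tmul_add])
    (fun g s c x => by
      have h0 : (0 : Fin (n + 2)) ≠ Fin.last (n + 1) := by simp [Fin.ext_iff]
      have h1 : ∀ i : Fin n, i.succ.castSucc ≠ 0 := fun i => by simp [Fin.ext_iff]
      have h2 : ∀ i : Fin n, i.succ.castSucc ≠ Fin.last (n + 1) := fun i => by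
        have := i.isLt
        simp only [ne_eq, Fin.ext_iff, Fin.val_castSucc, Fin.val_succ, Fin.val_last]
        omega
      have h3 : ∀ (i : Fin n) (x : A), (fun j : Fin n =>
          Function.update g i.succ.castSucc x j.succ.castSucc) =
            Function.update (fun j : Fin n => g j.succ.castSucc) i x := fun i x => by
        ext j
        by_cases h : j = i
        · subst h; simp
        · have h' : j.succ.castSucc ≠ i.succ.castSucc := fun e => h (by
            simpa [Fin.ext_iff] using e)
          rw [Function.update_of_ne h', Function.update_of_ne h]
      rcases fin_cases_ends s with rfl | rfl | ⟨i, rfl⟩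
      · simp only [Function.update_self, Function.update_of_ne h0.symm,
          Function.update_of_ne (h1 _), TensorProduct.smul_tmul']
      · simp only [Function.update_self, Function.update_of_ne h0, MulOpposite.op_smul,
          Function.update_of_ne (h2 _), TensorProduct.smul_tmul', TensorProduct.tmul_smul]
      · rw [h3, h3, Function.update_of_ne (h1 i).symm, Function.update_of_ne (h1 i).symm,
          Function.update_of_ne (h2 i).symm, Function.update_of_ne (h2 i).symm,
          MultilinearMap.map_update_smul, TensorProduct.tmul_smul])

/-- The map `a_0 ⊗ ⋯ ⊗ a_{n+1} ↦ (a_0 ⊗ a_{n+1}) ⊗ (a_1 ⊗ ⋯ ⊗ a_n)`. -/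
def Bar.splitAdd (n : ℕ) : Bar k A n →+ Env k A ⊗[k] (⨂[k] (_ : Fin n), A) :=
  AddMonoidHomClass.toAddMonoidHom (PiTensorProduct.lift (Bar.splitMultilinear k A n))

lemma Bar.splitAdd_tprod (n : ℕ) (g : Fin (n + 2) → A) :
    Bar.splitAdd k A n (Bar.tprod k A g) =
      (g 0 ⊗ₜ[k] MulOpposite.op (g (Fin.last (n + 1)))) ⊗ₜ[k]
        PiTensorProduct.tprod k (fun i : Fin n => g i.succ.castSucc) :=
  PiTensorProduct.lift.tprod (φ := Bar.splitMultilinear k A n) g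

/-- The same map, which is `A^e`-linear. -/
def Bar.split (n : ℕ) : Bar k A n →ₗ[Env k A] Env k A ⊗[k] (⨂[k] (_ : Fin n), A) :=
  homOfActs k (A := A) (N := Bar k A n) (N' := Env k A ⊗[k] (⨂[k] (_ : Fin n), A))
    (Bar.splitAdd k A n)
    (fun a w => by
      induction w using Bar.induction' with
      | htprod g =>
        have h0 : Fin.last (n + 1) ≠ 0 := by simp [Fin.ext_iff]
        have h1 : ∀ i : Fin n, i.succ.castSucc ≠ 0 := fun i => by simp [Fin.ext_iff]
        rw [Bar.lact_tprod, Bar.splitAdd_tprod, Bar.splitAdd_tprod, lact_apply,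
          TensorProduct.smul_tmul', smul_eq_mul, Algebra.TensorProduct.tmul_mul_tmul, one_mul]
        simp only [Function.update_self, Function.update_of_ne h0, Function.update_of_ne (h1 _)]
      | hadd w w' h h' => rw [map_add, map_add, map_add, map_add, h, h'])
    (fun a w => by
      induction w using Bar.induction' with
      | htprod g =>
        have h0 : 0 ≠ Fin.last (n + 1) := by simp [Fin.ext_iff]
        have h1 : ∀ i : Fin n, i.succ.castSucc ≠ Fin.last (n + 1) := fun i => by
          have := i.isLt
          simp only [ne_eq, Fin.ext_iff, Fin.val_castSucc, Fin.val_succ, Fin.val_last]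
          omega
        rw [Bar.ract_tprod, Bar.splitAdd_tprod, Bar.splitAdd_tprod, ract_apply,
          TensorProduct.smul_tmul', smul_eq_mul, Algebra.TensorProduct.tmul_mul_tmul, one_mul]
        simp only [Function.update_self, Function.update_of_ne h0, Function.update_of_ne (h1 _),
          MulOpposite.op_mul]
      | hadd w w' h h' => rw [map_add, map_add, map_add, map_add, h, h'])

/-- The map `w ↦ 1 ⊗ w ⊗ 1`. -/
def Bar.middle (n : ℕ) : (⨂[k] (_ : Fin n), A) →ₗ[k] ⨂[k] (_ : Fin (n + 2)), A :=
  tensorS k A (n + 1) ∘ₗ PiTensorProduct.lift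
    ((LinearMap.applyₗ (1 : A)).compMultilinearMap
      (PiTensorProduct.tprod k (s := fun _ : Fin (n + 1) => A)).curryRight)

lemma Bar.middle_tprod (n : ℕ) (g : Fin n → A) :
    Bar.middle k A n (PiTensorProduct.tprod k g) =
      PiTensorProduct.tprod k (Fin.cons 1 (Fin.snoc (α := fun _ => A) g 1) : Fin (n + 2) → A) := by
  rw [Bar.middle, LinearMap.comp_apply, PiTensorProduct.lift.tprod]
  exact tensorS_tprod k A (n + 1) _

/-- The map `r ⊗ w ↦ r (1 ⊗ w ⊗ 1)`. -/
def Bar.unsplitAdd (n : ℕ) : Env k A ⊗[k] (⨂[k] (_ : Fin n), A) →+ Bar k A n :=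
  AddMonoidHomClass.toAddMonoidHom
    (TensorProduct.lift ((Bar.action k A n).toLinearMap.flip ∘ₗ Bar.middle k A n).flip)

lemma Bar.unsplitAdd_tmul (n : ℕ) (r : Env k A) (w : ⨂[k] (_ : Fin n), A) :
    Bar.unsplitAdd k A n (r ⊗ₜ[k] w) = r • (show Bar k A n from Bar.middle k A n w) := rfl

/-- The same map, which is `A^e`-linear. -/
def Bar.unsplit (n : ℕ) : Env k A ⊗[k] (⨂[k] (_ : Fin n), A) →ₗ[Env k A] Bar k A n where
  toFun := Bar.unsplitAdd k A n
  map_add' := map_add (Bar.unsplitAdd k A n)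
  map_smul' r z := by
    rw [RingHom.id_apply]
    induction z using TensorProduct.induction_on with
    | zero => rw [smul_zero, map_zero, smul_zero]
    | tmul s w =>
      rw [TensorProduct.smul_tmul', Bar.unsplitAdd_tmul, Bar.unsplitAdd_tmul, smul_eq_mul, mul_smul]
    | add z z' h h' => rw [smul_add, map_add, map_add, h, h', smul_add]

lemma Bar.unsplit_split (n : ℕ) (w : Bar k A n) :
    Bar.unsplit k A n (Bar.split k A n w) = w := by
  induction w using Bar.induction' with
  | htprod g =>
    refine (congrArg (Bar.unsplitAdd k A n) (Bar.splitAdd_tprod k A n g)).trans ?_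
    rw [Bar.unsplitAdd_tmul, Bar.middle_tprod, ← lact_ract]
    refine (congrArg (fun t : Bar k A n => lact k (g 0) t) (Bar.ract_tprod k A _ _)).trans ?_
    refine (Bar.lact_tprod k A _ _).trans ?_
    congr 1
    have h0 : 0 ≠ Fin.last (n + 1) := by simp [Fin.ext_iff]
    ext i
    rcases fin_cases_ends i with rfl | rfl | ⟨i, rfl⟩
    · simp
    · rw [Function.update_of_ne h0.symm, Function.update_self, ← Fin.succ_last, Fin.cons_succ,
        Fin.snoc_last, one_mul]
    · have h1 : i.succ.castSucc ≠ 0 := by simp [Fin.ext_iff]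
      have h2 : i.succ.castSucc ≠ Fin.last (n + 1) := by
        have := i.isLt
        simp only [ne_eq, Fin.ext_iff, Fin.val_castSucc, Fin.val_succ, Fin.val_last]
        omega
      rw [Function.update_of_ne h1, Function.update_of_ne h2, ← Fin.succ_castSucc, Fin.cons_succ,
        Fin.snoc_castSucc, Fin.succ_castSucc]
  | hadd w w' h h' => rw [map_add, map_add, h, h']

instance Bar.projective [Module.Projective k A] (n : ℕ) :
    Module.Projective (Env k A) (Bar k A n) :=
  Module.Projective.of_split (Bar.split k A n) (Bar.unsplit k A n)
    (LinearMap.ext (Bar.unsplit_split k A n))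

end BarResolution

/-! ### Exactness of `- ⊗_{A^e} P` for projective `P` -/

section Exactness

variable (k : Type u) (A : Type v) [CommRing k] [Ring A] [Algebra k A]

/-- The anti-automorphism `a ⊗ b ↦ b ⊗ a` of `A^e`. -/
def envSwap : Env k A →ₗ[k] Env k A :=
  (TensorProduct.map (MulOpposite.opLinearEquiv k).symm.toLinearMap
    (MulOpposite.opLinearEquiv k).toLinearMap) ∘ₗ (TensorProduct.comm k A Aᵐᵒᵖ).toLinearMap

lemma envSwap_tmul (a : A) (b : Aᵐᵒᵖ) :
    envSwap k A (a ⊗ₜ[k] b) = b.unop ⊗ₜ[k] MulOpposite.op a := rfl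

lemma envSwap_mul (r s : Env k A) : envSwap k A (r * s) = envSwap k A s * envSwap k A r := by
  induction r using TensorProduct.induction_on with
  | zero => rw [zero_mul, map_zero, mul_zero]
  | add r r' h h' => rw [add_mul, map_add, map_add, h, h', mul_add]
  | tmul a b =>
    induction s using TensorProduct.induction_on with
    | zero => rw [mul_zero, map_zero, zero_mul]
    | add r r' h h' => rw [mul_add, map_add, map_add, h, h', add_mul]
    | tmul c d =>
      rw [Algebra.TensorProduct.tmul_mul_tmul, envSwap_tmul, envSwap_tmul, envSwap_tmul,
        Algebra.TensorProduct.tmul_mul_tmul]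
      rfl

variable {N P : Type*} [AddCommGroup N] [Module (Env k A) N] [AddCommGroup P] [Module (Env k A) P]
variable {N' N'' : Type*} [AddCommGroup N'] [Module (Env k A) N']
  [AddCommGroup N''] [Module (Env k A) N'']

lemma TAe.mk_zero_left (p : P) : TAe.mk k A (0 : N) p = 0 := by
  simpa using TAe.mk_add_left k A (0 : N) 0 p

lemma TAe.mk_zero_right (x : N) : TAe.mk k A x (0 : P) = 0 := by
  simpa using TAe.mk_add_right k A x (0 : P) 0

lemma TAe.balance_env (r : Env k A) (x : N) (p : P) :
    TAe.mk k A (envSwap k A r • x) p = TAe.mk k A x (r • p) := by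
  induction r using TensorProduct.induction_on with
  | zero =>
    have h1 : (0 : Env k A) • x = 0 := zero_smul (Env k A) x
    have h2 : (0 : Env k A) • p = 0 := zero_smul (Env k A) p
    rw [map_zero]
    exact (congrArg (fun t => TAe.mk k A t p) h1).trans ((TAe.mk_zero_left k A p).trans
      ((congrArg (fun t => TAe.mk k A x t) h2).trans (TAe.mk_zero_right k A x)).symm)
  | tmul a b =>
    rw [envSwap_tmul, ← lact_ract, TAe.balance, lact_ract]
    rfl
  | add r s h h' => rw [map_add, add_smul, add_smul, TAe.mk_add_left, TAe.mk_add_right, h, h']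

/-- For `u ∈ (A^e)^{(P)}`, the family `(x u_q)_q`. -/
def finsuppAct (u : P →₀ Env k A) (x : N) : P →₀ N :=
  u.mapRange (fun r => envSwap k A r • x) (by rw [map_zero]; exact zero_smul (Env k A) x)

set_option linter.unusedSectionVars false in
lemma finsuppAct_apply (u : P →₀ Env k A) (x : N) (q : P) :
    finsuppAct k A u x q = envSwap k A (u q) • x := rfl

lemma finsuppAct_add_left (u v : P →₀ Env k A) (x : N) :
    finsuppAct k A (u + v) x = finsuppAct k A u x + finsuppAct k A v x := by
  ext q
  rw [Finsupp.add_apply, finsuppAct_apply, finsuppAct_apply, finsuppAct_apply, Finsupp.add_apply,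
    map_add, add_smul]

lemma finsuppAct_add_right (u : P →₀ Env k A) (x x' : N) :
    finsuppAct k A u (x + x') = finsuppAct k A u x + finsuppAct k A u x' := by
  ext q
  rw [Finsupp.add_apply, finsuppAct_apply, finsuppAct_apply, finsuppAct_apply, smul_add]

lemma finsuppAct_smul (r : Env k A) (u : P →₀ Env k A) (x : N) :
    finsuppAct k A (r • u) x = finsuppAct k A u (envSwap k A r • x) := by
  ext q
  rw [finsuppAct_apply, finsuppAct_apply, Finsupp.smul_apply, smul_eq_mul, envSwap_mul, mul_smul]

/-- For `s : P → (A^e)^{(P)}`, the map `x ⊗ p ↦ (x s(p)_q)_q`. -/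
def TAe.toFinsupp (s : P →ₗ[Env k A] P →₀ Env k A) : TAe k A N P →+ (P →₀ N) :=
  Balanced.lift
    (AddMonoidHom.mk' (fun x => AddMonoidHom.mk' (fun p => finsuppAct k A (s p) x)
        (fun p p' => by rw [map_add, finsuppAct_add_left]))
      (fun x x' => AddMonoidHom.ext fun p => finsuppAct_add_right k A (s p) x x'))
    (fun i x p => by
      have h : (lact k i.1).comp (ract k i.2) p =
          (i.1 ⊗ₜ[k] MulOpposite.op i.2 : Env k A) • p := lact_ract k _ _ p
      have h' : (lact k i.2).comp (ract k i.1) x =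
          (i.2 ⊗ₜ[k] MulOpposite.op i.1 : Env k A) • x := lact_ract k _ _ x
      rw [h, h']
      change finsuppAct k A (s p) _ = finsuppAct k A (s _) x
      rw [map_smul, finsuppAct_smul, envSwap_tmul]
      rfl)

lemma TAe.toFinsupp_mk' (s : P →ₗ[Env k A] P →₀ Env k A) (x : N) (p : P) :
    TAe.toFinsupp k A s (TAe.mk k A x p) = finsuppAct k A (s p) x := rfl

lemma TAe.toFinsupp_mk (s : P →ₗ[Env k A] P →₀ Env k A) (x : N) (p q : P) :
    TAe.toFinsupp k A s (TAe.mk k A x p) q = envSwap k A (s p q) • x := rfl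

/-- The map `(x_q)_q ↦ ∑ x_q ⊗ q`. -/
def TAe.ofFinsupp : (P →₀ N) →+ TAe k A N P :=
  Finsupp.liftAddHom fun q => AddMonoidHom.mk' (fun x => TAe.mk k A x q)
    (fun x x' => TAe.mk_add_left k A x x' q)

lemma TAe.ofFinsupp_single (q : P) (x : N) :
    TAe.ofFinsupp k A (Finsupp.single q x) = TAe.mk k A x q := by
  refine (Finsupp.liftAddHom_apply_single _ _ _).trans ?_
  rfl

lemma TAe.map_ofFinsupp (f : N →ₗ[Env k A] N') (u : P →₀ N) :
    TAe.map k A f (LinearMap.id : P →ₗ[Env k A] P) (TAe.ofFinsupp k A u) =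
      TAe.ofFinsupp k A (u.mapRange f (map_zero f)) := by
  induction u using Finsupp.induction_linear with
  | zero => simp
  | add u v hu hv => rw [map_add, map_add, hu, hv, Finsupp.mapRange_add (map_add f), map_add]
  | single q x => rw [Finsupp.mapRange_single, TAe.ofFinsupp_single, TAe.ofFinsupp_single,
      TAe.map_mk]; rfl

lemma TAe.toFinsupp_map (s : P →ₗ[Env k A] P →₀ Env k A) (f : N →ₗ[Env k A] N')
    (z : TAe k A N P) :
    TAe.toFinsupp k A s (TAe.map k A f LinearMap.id z) =
      (TAe.toFinsupp k A s z).mapRange f (map_zero f) := by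
  induction z using TAe.induction with
  | h0 => simp
  | hmk x p =>
    ext q
    rw [TAe.map_mk, TAe.toFinsupp_mk, Finsupp.mapRange_apply, TAe.toFinsupp_mk, map_smul]
    rfl
  | hadd z z' h h' => rw [map_add, map_add, map_add, h, h', Finsupp.mapRange_add (map_add f)]

lemma TAe.ofFinsupp_toFinsupp (s : P →ₗ[Env k A] P →₀ Env k A)
    (hs : ∀ p, Finsupp.linearCombination (Env k A) id (s p) = p) (z : TAe k A N P) :
    TAe.ofFinsupp k A (TAe.toFinsupp k A s z) = z := by
  induction z using TAe.induction with
  | h0 => simp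
  | hadd z z' h h' => rw [map_add, map_add, h, h']
  | hmk x p =>
    conv_rhs => rw [← hs p]
    have key : ∀ u : P →₀ Env k A, TAe.ofFinsupp k A (finsuppAct k A u x) =
          TAe.mk k A x (Finsupp.linearCombination (Env k A) id u) := by
      intro u
      induction u using Finsupp.induction_linear with
      | zero =>
        have : finsuppAct k A (0 : P →₀ Env k A) x = 0 := Finsupp.mapRange_zero
        rw [this, map_zero, map_zero, TAe.mk_zero_right]
      | add u v hu hv =>
        rw [map_add, TAe.mk_add_right, ← hu, ← hv, ← map_add, finsuppAct_add_left]
      | single q r =>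
        rw [finsuppAct, Finsupp.mapRange_single, TAe.ofFinsupp_single,
          Finsupp.linearCombination_single, TAe.balance_env]
        rfl
    exact key (s p)

lemma TAe.map_injective [h : Module.Projective (Env k A) P] (f : N →ₗ[Env k A] N')
    (hf : Function.Injective f) :
    Function.Injective (TAe.map k A f (LinearMap.id : P →ₗ[Env k A] P)) := by
  obtain ⟨s, hs⟩ := h.out
  intro z z' e
  rw [← TAe.ofFinsupp_toFinsupp k A s hs z, ← TAe.ofFinsupp_toFinsupp k A s hs z']
  congr 1
  refine Finsupp.mapRange_injective f (map_zero f) hf ?_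
  rw [← TAe.toFinsupp_map, ← TAe.toFinsupp_map, e]

lemma TAe.map_surjective (f : N →ₗ[Env k A] N') (hf : Function.Surjective f) :
    Function.Surjective (TAe.map k A f (LinearMap.id : P →ₗ[Env k A] P)) := by
  intro z
  induction z using TAe.induction with
  | h0 => exact ⟨0, map_zero _⟩
  | hmk x p =>
    obtain ⟨y, rfl⟩ := hf x
    exact ⟨TAe.mk k A y p, rfl⟩
  | hadd z z' h h' =>
    obtain ⟨y, rfl⟩ := h
    obtain ⟨y', rfl⟩ := h'
    exact ⟨y + y', map_add _ _ _⟩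

lemma TAe.map_exact [h : Module.Projective (Env k A) P] (f : N →ₗ[Env k A] N')
    (g : N' →ₗ[Env k A] N'') (hfg : Function.Exact f g) :
    Function.Exact (TAe.map k A f (LinearMap.id : P →ₗ[Env k A] P))
      (TAe.map k A g (LinearMap.id : P →ₗ[Env k A] P)) := by
  obtain ⟨s, hs⟩ := h.out
  intro z
  constructor
  · intro hz
    have h1 : (TAe.toFinsupp k A s z).mapRange g (map_zero g) = 0 := by
      rw [← TAe.toFinsupp_map, hz, map_zero]
    have h2 : ∀ q, ∃ x, f x = TAe.toFinsupp k A s z q := fun q => by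
      refine (hfg _).1 ?_
      have := DFunLike.congr_fun h1 q
      simpa using this
    choose c hc using h2
    classical
    let u : P →₀ N := Finsupp.onFinset (TAe.toFinsupp k A s z).support
      (fun q => if TAe.toFinsupp k A s z q = 0 then 0 else c q) (by
        intro q hq
        rw [Finsupp.mem_support_iff]
        intro h0
        simp [h0] at hq)
    refine ⟨TAe.ofFinsupp k A u, ?_⟩
    rw [TAe.map_ofFinsupp]
    conv_rhs => rw [← TAe.ofFinsupp_toFinsupp k A s hs z]
    congr 1
    ext q
    by_cases h0 : TAe.toFinsupp k A s z q = 0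
    · simp [u, h0]
    · simp [u, h0, hc]
  · rintro ⟨y, rfl⟩
    induction y using TAe.induction with
    | h0 => simp
    | hmk x p =>
      rw [TAe.map_mk, TAe.map_mk, hfg.apply_apply_eq_zero, TAe.mk_zero_left]
    | hadd z z' h h' => rw [map_add, map_add, h, h', add_zero]

end Exactness

/-! ### Subquotients and connecting homomorphisms -/

section Subquotient

variable {X Y Y' W : Type*} [AddCommGroup X] [AddCommGroup Y] [AddCommGroup Y'] [AddCommGroup W]

/-- The quotient `Z / B` of a group of cycles by a group of boundaries. -/
abbrev Subquotient (Z B : AddSubgroup X) : Type _ := Z ⧸ B.addSubgroupOf Z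

/-- The class `[x]` of a cycle `x`. -/
def Subquotient.mk {Z : AddSubgroup X} (B : AddSubgroup X) (x : X) (hx : x ∈ Z) :
    Subquotient Z B := QuotientAddGroup.mk ⟨x, hx⟩

lemma Subquotient.mk_surjective {Z B : AddSubgroup X} (c : Subquotient Z B) :
    ∃ (x : X) (hx : x ∈ Z), Subquotient.mk B x hx = c := by
  obtain ⟨⟨x, hx⟩, rfl⟩ := QuotientAddGroup.mk_surjective c
  exact ⟨x, hx, rfl⟩

lemma Subquotient.mk_eq_mk {Z B : AddSubgroup X} {x x' : X} {hx : x ∈ Z} {hx' : x' ∈ Z} :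
    Subquotient.mk B x hx = Subquotient.mk B x' hx' ↔ x - x' ∈ B :=
  QuotientAddGroup.eq_iff_sub_mem

lemma Subquotient.mk_add {Z B : AddSubgroup X} {x x' : X} (hx : x ∈ Z) (hx' : x' ∈ Z) :
    Subquotient.mk B x hx + Subquotient.mk B x' hx' =
      Subquotient.mk B (x + x') (Z.add_mem hx hx') := rfl

/-- The map `[x] ↦ [f x]`. -/
def Subquotient.map {Z B : AddSubgroup X} {Z' B' : AddSubgroup Y} (f : X →+ Y)
    (hZ : ∀ x ∈ Z, f x ∈ Z') (hB : ∀ x ∈ B, f x ∈ B') : Subquotient Z B →+ Subquotient Z' B' :=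
  QuotientAddGroup.map _ _ ((f.comp Z.subtype).codRestrict Z' fun x => hZ x.1 x.2)
    (fun x hx => hB x.1 hx)

@[simp] lemma Subquotient.map_mk {Z B : AddSubgroup X} {Z' B' : AddSubgroup Y} (f : X →+ Y)
    (hZ : ∀ x ∈ Z, f x ∈ Z') (hB : ∀ x ∈ B, f x ∈ B') (x : X) (hx : x ∈ Z) :
    Subquotient.map f hZ hB (Subquotient.mk B x hx) = Subquotient.mk B' (f x) (hZ x hx) := rfl

/-- The map out of `Z / B` induced by a map which vanishes on `B`. -/
def Subquotient.lift {Z B : AddSubgroup X} (f : Z →+ Y) (hB : ∀ x (hx : x ∈ Z), x ∈ B → f ⟨x, hx⟩ = 0) :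
    Subquotient Z B →+ Y :=
  QuotientAddGroup.lift _ f (fun x hx => hB x.1 x.2 hx)

@[simp] lemma Subquotient.lift_mk {Z B : AddSubgroup X} (f : Z →+ Y)
    (hB : ∀ x (hx : x ∈ Z), x ∈ B → f ⟨x, hx⟩ = 0) (x : X) (hx : x ∈ Z) :
    Subquotient.lift f hB (Subquotient.mk B x hx) = f ⟨x, hx⟩ := rfl

/-- The connecting homomorphism of the snake lemma: `[x] ↦ [z]` if `x = g y` and `f z = d y`. -/
def connecting {Z B : AddSubgroup X} {Z' B' : AddSubgroup W} (g : Y →+ X) (d : Y →+ Y')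
    (f : W →+ Y') (hex : ∀ x ∈ Z, ∃ y, g y = x ∧ ∃ z ∈ Z', f z = d y)
    (hwd : ∀ y z, f z = d y → g y ∈ B → z ∈ B') : Subquotient Z B →+ Subquotient Z' B' :=
  Subquotient.lift
    (AddMonoidHom.mk' (fun x => Subquotient.mk B' (hex x.1 x.2).choose_spec.2.choose
        (hex x.1 x.2).choose_spec.2.choose_spec.1)
      (fun x x' => by
        rw [Subquotient.mk_add, Subquotient.mk_eq_mk]
        refine hwd ((hex (x + x').1 (x + x').2).choose -
          ((hex x.1 x.2).choose + (hex x'.1 x'.2).choose)) _ ?_ ?_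
        · rw [map_sub, map_sub, map_add, map_add,
            (hex (x + x').1 (x + x').2).choose_spec.2.choose_spec.2,
            (hex x.1 x.2).choose_spec.2.choose_spec.2, (hex x'.1 x'.2).choose_spec.2.choose_spec.2]
        · rw [map_sub, map_add, (hex (x + x').1 (x + x').2).choose_spec.1,
            (hex x.1 x.2).choose_spec.1, (hex x'.1 x'.2).choose_spec.1, AddSubgroup.coe_add,
            sub_self]
          exact B.zero_mem))
    (fun x hx hB => by
      have h0 : (0 : Subquotient Z' B') = Subquotient.mk B' 0 Z'.zero_mem := rfl
      rw [h0]
      refine Subquotient.mk_eq_mk.2 ?_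
      rw [sub_zero]
      refine hwd (hex x hx).choose _ (hex x hx).choose_spec.2.choose_spec.2 ?_
      rwa [(hex x hx).choose_spec.1])

lemma connecting_mk {Z B : AddSubgroup X} {Z' B' : AddSubgroup W} (g : Y →+ X) (d : Y →+ Y')
    (f : W →+ Y') (hex : ∀ x ∈ Z, ∃ y, g y = x ∧ ∃ z ∈ Z', f z = d y)
    (hwd : ∀ y z, f z = d y → g y ∈ B → z ∈ B') (x : X) (hx : x ∈ Z) (y : Y) (z : W) (hz : z ∈ Z')
    (hy : g y = x) (hzy : f z = d y) :
    connecting g d f hex hwd (Subquotient.mk B x hx) = Subquotient.mk B' z hz := by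
  refine Subquotient.mk_eq_mk.2 ?_
  refine hwd ((hex x hx).choose - y) _ ?_ ?_
  · rw [map_sub, map_sub, (hex x hx).choose_spec.2.choose_spec.2, hzy]
  · rw [map_sub, (hex x hx).choose_spec.1, hy, sub_self]
    exact B.zero_mem

end Subquotient

/-! ### Hochschild homology and cohomology -/

section Hochschild

variable (k : Type u) (A : Type v) [CommRing k] [Ring A] [Algebra k A]

/-- `0 → N₁ → N₂ → N₃ → 0` is a short exact sequence of bimodules. -/
structure IsShortExact {N₁ N₂ N₃ : Type*} [AddCommGroup N₁] [Module (Env k A) N₁]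
    [AddCommGroup N₂] [Module (Env k A) N₂] [AddCommGroup N₃] [Module (Env k A) N₃]
    (f : N₁ →ₗ[Env k A] N₂) (g : N₂ →ₗ[Env k A] N₃) : Prop where
  injective : Function.Injective f
  exact : Function.Exact f g
  surjective : Function.Surjective g

section Homology

variable (N : Type*) [AddCommGroup N] [Module (Env k A) N]
variable {N₁ N₂ N₃ : Type*} [AddCommGroup N₁] [Module (Env k A) N₁]
    [AddCommGroup N₂] [Module (Env k A) N₂] [AddCommGroup N₃] [Module (Env k A) N₃]

/-- The Hochschild chains `N ⊗_{A^e} Bar(A)_n`. -/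
abbrev Chain (n : ℕ) : Type _ := TAe k A N (Bar k A n)

/-- The differential `id ⊗ d_{n+1}` of the Hochschild chain complex. -/
def chainD (n : ℕ) : Chain k A N (n + 1) →+ Chain k A N n :=
  TAe.map k A LinearMap.id (Bar.d k A n)

/-- The Hochschild cycles. -/
def cycles : (n : ℕ) → AddSubgroup (Chain k A N n)
  | 0 => ⊤
  | n + 1 => (chainD k A N n).ker

/-- The Hochschild boundaries. -/
def boundaries (n : ℕ) : AddSubgroup (Chain k A N n) := (chainD k A N n).range

/-- The Hochschild homology `H_n(A, N)`. -/
def Homology (n : ℕ) : Type _ := Subquotient (cycles k A N n) (boundaries k A N n)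

instance (n : ℕ) : AddCommGroup (Homology k A N n) :=
  inferInstanceAs (AddCommGroup (Subquotient _ _))

variable {N} in
/-- The homology class of a cycle. -/
def Homology.mk {n : ℕ} (x : Chain k A N n) (hx : x ∈ cycles k A N n) : Homology k A N n :=
  Subquotient.mk _ x hx

variable {N} in
lemma Homology.mk_surjective {n : ℕ} (c : Homology k A N n) :
    ∃ (x : Chain k A N n) (hx : x ∈ cycles k A N n), Homology.mk k A x hx = c :=
  Subquotient.mk_surjective c

/-- The map on Hochschild chains induced by a bimodule map. -/
def chainMap (f : N₁ →ₗ[Env k A] N₂) (n : ℕ) : Chain k A N₁ n →+ Chain k A N₂ n :=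
  TAe.map k A f LinearMap.id

lemma chainMap_chainD (f : N₁ →ₗ[Env k A] N₂) (n : ℕ) (x : Chain k A N₁ (n + 1)) :
    chainMap k A f n (chainD k A N₁ n x) = chainD k A N₂ n (chainMap k A f (n + 1) x) := by
  induction x using TAe.induction with
  | h0 => simp only [map_zero]
  | hmk x p => rfl
  | hadd z z' h h' => simp only [map_add, h, h']

variable {N} in
lemma chainD_chainD (n : ℕ) (x : Chain k A N (n + 2)) :
    chainD k A N n (chainD k A N (n + 1) x) = 0 := by
  induction x using TAe.induction with
  | h0 => simp only [map_zero]
  | hmk x p =>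
    rw [chainD, chainD, TAe.map_mk, TAe.map_mk, Bar.d_d, TAe.mk_zero_right]
  | hadd z z' h h' => simp only [map_add, h, h', add_zero]

lemma chainMap_mem_cycles (f : N₁ →ₗ[Env k A] N₂) (n : ℕ) (x : Chain k A N₁ n)
    (hx : x ∈ cycles k A N₁ n) : chainMap k A f n x ∈ cycles k A N₂ n := by
  cases n with
  | zero => trivial
  | succ n =>
    change chainD k A N₂ n _ = 0
    have hx : chainD k A N₁ n x = 0 := hx
    rw [← chainMap_chainD, hx, map_zero]

lemma chainMap_mem_boundaries (f : N₁ →ₗ[Env k A] N₂) (n : ℕ) (x : Chain k A N₁ n)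
    (hx : x ∈ boundaries k A N₁ n) : chainMap k A f n x ∈ boundaries k A N₂ n := by
  obtain ⟨y, rfl⟩ := hx
  exact ⟨chainMap k A f (n + 1) y, (chainMap_chainD k A f n y).symm⟩

/-- The map `H_n(A, N₁) → H_n(A, N₂)` induced by a bimodule map. -/
def Homology.map (f : N₁ →ₗ[Env k A] N₂) (n : ℕ) : Homology k A N₁ n →+ Homology k A N₂ n :=
  Subquotient.map (chainMap k A f n) (chainMap_mem_cycles k A f n)
    (chainMap_mem_boundaries k A f n)

lemma Homology.map_mk (f : N₁ →ₗ[Env k A] N₂) (n : ℕ) (x : Chain k A N₁ n)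
    (hx : x ∈ cycles k A N₁ n) : Homology.map k A f n (Homology.mk k A x hx) =
      Homology.mk k A (chainMap k A f n x) (chainMap_mem_cycles k A f n x hx) := rfl

lemma chainMap_id (n : ℕ) (x : Chain k A N n) :
    chainMap k A (LinearMap.id : N →ₗ[Env k A] N) n x = x := by
  induction x using TAe.induction with
  | h0 => simp only [map_zero]
  | hmk x p => rfl
  | hadd z z' h h' => rw [map_add, h, h']

lemma chainMap_comp (g : N₂ →ₗ[Env k A] N₃) (f : N₁ →ₗ[Env k A] N₂) (n : ℕ)
    (x : Chain k A N₁ n) :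
    chainMap k A (g ∘ₗ f) n x = chainMap k A g n (chainMap k A f n x) := by
  induction x using TAe.induction with
  | h0 => simp only [map_zero]
  | hmk x p => rfl
  | hadd z z' h h' => simp only [map_add, h, h']

lemma chainMap_add (f g : N₁ →ₗ[Env k A] N₂) (n : ℕ) (x : Chain k A N₁ n) :
    chainMap k A (f + g) n x = chainMap k A f n x + chainMap k A g n x := by
  induction x using TAe.induction with
  | h0 => simp only [map_zero, add_zero]
  | hmk x p => exact TAe.mk_add_left k A _ _ _
  | hadd z z' h h' => simp only [map_add, h, h']; abel

lemma Homology.mk_congr {n : ℕ} {x y : Chain k A N n} (h : x = y) (hx : x ∈ cycles k A N n)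
    (hy : y ∈ cycles k A N n) : Homology.mk k A x hx = Homology.mk k A y hy := by
  subst h; rfl

lemma Homology.map_id (n : ℕ) (c : Homology k A N n) :
    Homology.map k A (LinearMap.id : N →ₗ[Env k A] N) n c = c := by
  obtain ⟨x, hx, rfl⟩ := Homology.mk_surjective k A c
  exact Homology.mk_congr k A N (chainMap_id k A N n x) _ _

lemma Homology.map_comp (g : N₂ →ₗ[Env k A] N₃) (f : N₁ →ₗ[Env k A] N₂) (n : ℕ)
    (c : Homology k A N₁ n) :
    Homology.map k A (g ∘ₗ f) n c = Homology.map k A g n (Homology.map k A f n c) := by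
  obtain ⟨x, hx, rfl⟩ := Homology.mk_surjective k A c
  exact Homology.mk_congr k A N₃ (chainMap_comp k A g f n x) _ _

lemma Homology.map_add' (f g : N₁ →ₗ[Env k A] N₂) (n : ℕ) (c : Homology k A N₁ n) :
    Homology.map k A (f + g) n c = Homology.map k A f n c + Homology.map k A g n c := by
  obtain ⟨x, hx, rfl⟩ := Homology.mk_surjective k A c
  exact Homology.mk_congr k A N₂ (chainMap_add k A f g n x) _
    (AddSubgroup.add_mem _ (chainMap_mem_cycles k A f n x hx) (chainMap_mem_cycles k A g n x hx))

/-- The connecting homomorphism `δ : H_{n+1}(A, N₃) → H_n(A, N₁)` of a short exact sequence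
of bimodules. -/
def Homology.δ [Module.Projective k A] {f : N₁ →ₗ[Env k A] N₂} {g : N₂ →ₗ[Env k A] N₃}
    (h : IsShortExact k A f g) (n : ℕ) : Homology k A N₃ (n + 1) →+ Homology k A N₁ n :=
  connecting (chainMap k A g (n + 1)) (chainD k A N₂ n) (chainMap k A f n)
    (fun x hx => by
      have hx : chainD k A N₃ n x = 0 := hx
      obtain ⟨y, hy⟩ := TAe.map_surjective k A g h.surjective x
      refine ⟨y, hy, ?_⟩
      have h1 : chainMap k A g n (chainD k A N₂ n y) = 0 := by
        rw [chainMap_chainD]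
        exact (congrArg _ hy).trans hx
      obtain ⟨z, hz⟩ := (TAe.map_exact k A f g h.exact _).1 h1
      refine ⟨z, ?_, hz⟩
      cases n with
      | zero => trivial
      | succ n =>
        refine TAe.map_injective k A f h.injective ?_
        refine (chainMap_chainD k A f n z).trans ?_
        refine (congrArg (chainD k A N₂ n) hz).trans ?_
        rw [chainD_chainD, map_zero])
    (fun y z hzy hy => by
      obtain ⟨x, hx⟩ := hy
      obtain ⟨y', rfl⟩ := TAe.map_surjective k A g h.surjective x
      have h1 : chainMap k A g (n + 1) (y - chainD k A N₂ (n + 1) y') = 0 := by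
        rw [map_sub, ← hx, chainMap_chainD, sub_eq_zero]
        rfl
      obtain ⟨t, ht⟩ := (TAe.map_exact k A f g h.exact _).1 h1
      refine ⟨t, TAe.map_injective k A f h.injective ?_⟩
      refine (chainMap_chainD k A f n t).trans ?_
      refine (congrArg (chainD k A N₂ n) ht).trans ?_
      rw [map_sub, chainD_chainD, sub_zero]
      exact hzy.symm)

lemma Homology.δ_mk [Module.Projective k A] {f : N₁ →ₗ[Env k A] N₂} {g : N₂ →ₗ[Env k A] N₃}
    (h : IsShortExact k A f g) (n : ℕ) (x : Chain k A N₃ (n + 1)) (hx : x ∈ cycles k A N₃ (n + 1))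
    (y : Chain k A N₂ (n + 1)) (z : Chain k A N₁ n) (hz : z ∈ cycles k A N₁ n)
    (hy : chainMap k A g (n + 1) y = x) (hzy : chainMap k A f n z = chainD k A N₂ n y) :
    Homology.δ k A h n (Homology.mk k A x hx) = Homology.mk k A z hz :=
  connecting_mk _ _ _ _ _ x hx y z hz hy hzy

end Homology

section Cohomology

variable (M : Type*) [AddCommGroup M] [Module (Env k A) M]
variable {M₁ M₂ M₃ : Type*} [AddCommGroup M₁] [Module (Env k A) M₁]
    [AddCommGroup M₂] [Module (Env k A) M₂] [AddCommGroup M₃] [Module (Env k A) M₃]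

/-- The Hochschild cochains `Hom_{A^e}(Bar(A)_m, M)`. -/
abbrev Cochain (m : ℕ) : Type _ := Bar k A m →ₗ[Env k A] M

/-- The differential `t ↦ t ∘ d_{m+1}` of the Hochschild cochain complex. -/
def cochainD (m : ℕ) : Cochain k A M m →+ Cochain k A M (m + 1) where
  toFun t := t ∘ₗ Bar.d k A m
  map_zero' := LinearMap.zero_comp _
  map_add' _ _ := LinearMap.add_comp _ _ _

/-- The Hochschild cocycles. -/
def cocycles (m : ℕ) : AddSubgroup (Cochain k A M m) := (cochainD k A M m).ker

/-- The Hochschild coboundaries. -/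
def coboundaries : (m : ℕ) → AddSubgroup (Cochain k A M m)
  | 0 => ⊥
  | m + 1 => (cochainD k A M m).range

/-- The Hochschild cohomology `H^m(A, M)`. -/
def Cohomology (m : ℕ) : Type _ := Subquotient (cocycles k A M m) (coboundaries k A M m)

instance (m : ℕ) : AddCommGroup (Cohomology k A M m) :=
  inferInstanceAs (AddCommGroup (Subquotient _ _))

variable {M} in
/-- The cohomology class of a cocycle. -/
def Cohomology.mk {m : ℕ} (t : Cochain k A M m) (ht : t ∈ cocycles k A M m) :
    Cohomology k A M m :=
  Subquotient.mk _ t ht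

variable {M} in
lemma Cohomology.mk_surjective {m : ℕ} (c : Cohomology k A M m) :
    ∃ (t : Cochain k A M m) (ht : t ∈ cocycles k A M m), Cohomology.mk k A t ht = c :=
  Subquotient.mk_surjective c

variable {M} in
lemma cochainD_cochainD (m : ℕ) (t : Cochain k A M m) :
    cochainD k A M (m + 1) (cochainD k A M m t) = 0 := by
  ext w
  change t (Bar.d k A m (Bar.d k A (m + 1) w)) = 0
  rw [Bar.d_d, map_zero]

/-- The map `t ↦ f ∘ t` on Hochschild cochains induced by a bimodule map. -/
def cochainMap (f : M₁ →ₗ[Env k A] M₂) (m : ℕ) : Cochain k A M₁ m →+ Cochain k A M₂ m where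
  toFun t := f ∘ₗ t
  map_zero' := LinearMap.comp_zero _
  map_add' _ _ := LinearMap.comp_add _ _ _

lemma cochainMap_cochainD (f : M₁ →ₗ[Env k A] M₂) (m : ℕ) (t : Cochain k A M₁ m) :
    cochainMap k A f (m + 1) (cochainD k A M₁ m t) = cochainD k A M₂ m (cochainMap k A f m t) :=
  rfl

lemma cochainMap_mem_cocycles (f : M₁ →ₗ[Env k A] M₂) (m : ℕ) (t : Cochain k A M₁ m)
    (ht : t ∈ cocycles k A M₁ m) : cochainMap k A f m t ∈ cocycles k A M₂ m := by
  change cochainD k A M₂ m _ = 0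
  have ht : cochainD k A M₁ m t = 0 := ht
  rw [← cochainMap_cochainD, ht, map_zero]

lemma cochainMap_mem_coboundaries (f : M₁ →ₗ[Env k A] M₂) (m : ℕ) (t : Cochain k A M₁ m)
    (ht : t ∈ coboundaries k A M₁ m) : cochainMap k A f m t ∈ coboundaries k A M₂ m := by
  cases m with
  | zero =>
    have ht : t = 0 := ht
    rw [ht, map_zero]
    exact AddSubgroup.zero_mem _
  | succ m =>
    obtain ⟨s, rfl⟩ := ht
    exact ⟨cochainMap k A f m s, rfl⟩

/-- The map `H^m(A, M₁) → H^m(A, M₂)` induced by a bimodule map. -/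
def Cohomology.map (f : M₁ →ₗ[Env k A] M₂) (m : ℕ) :
    Cohomology k A M₁ m →+ Cohomology k A M₂ m :=
  Subquotient.map (cochainMap k A f m) (cochainMap_mem_cocycles k A f m)
    (cochainMap_mem_coboundaries k A f m)

lemma Cohomology.map_mk (f : M₁ →ₗ[Env k A] M₂) (m : ℕ) (t : Cochain k A M₁ m)
    (ht : t ∈ cocycles k A M₁ m) : Cohomology.map k A f m (Cohomology.mk k A t ht) =
      Cohomology.mk k A (cochainMap k A f m t) (cochainMap_mem_cocycles k A f m t ht) := rfl

lemma cochainMap_injective {f : M₁ →ₗ[Env k A] M₂} (hf : Function.Injective f) (m : ℕ) :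
    Function.Injective (cochainMap k A f m) := fun _ _ e =>
  LinearMap.ext fun w => hf (LinearMap.congr_fun e w)

lemma cochainMap_lift {f : M₁ →ₗ[Env k A] M₂} {g : M₂ →ₗ[Env k A] M₃}
    (h : IsShortExact k A f g) (m : ℕ) (t : Cochain k A M₂ m) (ht : cochainMap k A g m t = 0) :
    ∃ s, cochainMap k A f m s = t := by
  have h1 : ∀ w, ∃ x, f x = t w := fun w => (h.exact _).1 (LinearMap.congr_fun ht w)
  choose s hs using h1
  refine ⟨{ toFun := s, map_add' := fun w w' => ?_, map_smul' := fun r w => ?_ }, ?_⟩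
  · refine h.injective ?_
    rw [hs, map_add, map_add, hs, hs]
  · refine h.injective ?_
    rw [hs, map_smul, map_smul, hs, RingHom.id_apply]
  · ext w
    exact hs w

lemma Cohomology.map_id (m : ℕ) (c : Cohomology k A M m) :
    Cohomology.map k A (LinearMap.id : M →ₗ[Env k A] M) m c = c := by
  obtain ⟨x, hx, rfl⟩ := Cohomology.mk_surjective k A c
  rfl

lemma Cohomology.map_comp (g : M₂ →ₗ[Env k A] M₃) (f : M₁ →ₗ[Env k A] M₂) (m : ℕ)
    (c : Cohomology k A M₁ m) :
    Cohomology.map k A (g ∘ₗ f) m c = Cohomology.map k A g m (Cohomology.map k A f m c) := by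
  obtain ⟨x, hx, rfl⟩ := Cohomology.mk_surjective k A c
  rfl

lemma Cohomology.map_add' (f g : M₁ →ₗ[Env k A] M₂) (m : ℕ) (c : Cohomology k A M₁ m) :
    Cohomology.map k A (f + g) m c = Cohomology.map k A f m c + Cohomology.map k A g m c := by
  obtain ⟨x, hx, rfl⟩ := Cohomology.mk_surjective k A c
  rfl

/-- The connecting homomorphism `∂ : H^m(A, M₃) → H^{m+1}(A, M₁)` of a short exact sequence
of bimodules. -/
def Cohomology.δ [Module.Projective k A] {f : M₁ →ₗ[Env k A] M₂} {g : M₂ →ₗ[Env k A] M₃}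
    (h : IsShortExact k A f g) (m : ℕ) : Cohomology k A M₃ m →+ Cohomology k A M₁ (m + 1) :=
  connecting (cochainMap k A g m) (cochainD k A M₂ m) (cochainMap k A f (m + 1))
    (fun x hx => by
      have hx : cochainD k A M₃ m x = 0 := hx
      obtain ⟨y, hy⟩ := Module.projective_lifting_property g x h.surjective
      refine ⟨y, hy, ?_⟩
      have h1 : cochainMap k A g (m + 1) (cochainD k A M₂ m y) = 0 := by
        rw [cochainMap_cochainD]
        exact (congrArg _ hy).trans hx
      obtain ⟨z, hz⟩ := cochainMap_lift k A h _ _ h1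
      refine ⟨z, ?_, hz⟩
      refine cochainMap_injective k A h.injective _ ?_
      rw [cochainMap_cochainD, hz, cochainD_cochainD, map_zero])
    (fun y z hzy hy => by
      cases m with
      | zero =>
        have hy : cochainMap k A g 0 y = 0 := hy
        obtain ⟨t, rfl⟩ := cochainMap_lift k A h _ _ hy
        refine ⟨t, cochainMap_injective k A h.injective _ ?_⟩
        rw [hzy, cochainMap_cochainD]
      | succ m =>
        obtain ⟨x, hx⟩ := hy
        obtain ⟨y', rfl⟩ := Module.projective_lifting_property g x h.surjective
        have h1 : cochainMap k A g (m + 1) (y - cochainD k A M₂ m y') = 0 := by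
          rw [map_sub, ← hx, sub_eq_zero]
          rfl
        obtain ⟨t, ht⟩ := cochainMap_lift k A h _ _ h1
        refine ⟨t, cochainMap_injective k A h.injective _ ?_⟩
        rw [cochainMap_cochainD, ht, map_sub, cochainD_cochainD, sub_zero, hzy])

lemma Cohomology.δ_mk [Module.Projective k A] {f : M₁ →ₗ[Env k A] M₂} {g : M₂ →ₗ[Env k A] M₃}
    (h : IsShortExact k A f g) (m : ℕ) (x : Cochain k A M₃ m) (hx : x ∈ cocycles k A M₃ m)
    (y : Cochain k A M₂ m) (z : Cochain k A M₁ (m + 1)) (hz : z ∈ cocycles k A M₁ (m + 1))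
    (hy : cochainMap k A g m y = x) (hzy : cochainMap k A f (m + 1) z = cochainD k A M₂ m y) :
    Cohomology.δ k A h m (Cohomology.mk k A x hx) = Cohomology.mk k A z hz :=
  connecting_mk _ _ _ _ _ x hx y z hz hy hzy

end Cohomology

/-! ### The action of the center -/

section Center

variable {N : Type*} [AddCommGroup N] [Module (Env k A) N]

variable (N) in
/-- The center `Z = Z(A)` acts on a bimodule `N` by the bimodule endomorphisms `x ↦ z x`. -/
def centerHom (z : Subalgebra.center k A) : N →ₗ[Env k A] N :=
  homOfActs k (lact k (z : A))
    (fun a x => by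
      rw [← lact_mul, ← lact_mul, (Subalgebra.mem_center_iff.1 z.2 a)])
    (fun a x => by rw [lact_ract, ract_lact])

lemma centerHom_apply (z : Subalgebra.center k A) (x : N) :
    centerHom k A N z x = lact k (z : A) x := rfl

lemma centerHom_add (z z' : Subalgebra.center k A) :
    centerHom k A N (z + z') = centerHom k A N z + centerHom k A N z' :=
  LinearMap.ext fun x => lact_add k (z : A) (z' : A) x

lemma centerHom_mul (z z' : Subalgebra.center k A) :
    centerHom k A N (z * z') = centerHom k A N z ∘ₗ centerHom k A N z' :=
  LinearMap.ext fun x => lact_mul k (z : A) (z' : A) x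

lemma centerHom_one : centerHom k A N 1 = LinearMap.id :=
  LinearMap.ext fun x => lact_one k x

/-- `Z` acts on `H_n(A, N)` through its action on `N`. -/
instance (n : ℕ) : SMul (Subalgebra.center k A) (Homology k A N n) :=
  ⟨fun z c => Homology.map k A (centerHom k A N z) n c⟩

lemma Homology.center_smul_def {n : ℕ} (z : Subalgebra.center k A) (c : Homology k A N n) :
    z • c = Homology.map k A (centerHom k A N z) n c := rfl

instance (n : ℕ) : Module (Subalgebra.center k A) (Homology k A N n) :=
  Module.ofMinimalAxioms (fun z c c' => map_add (Homology.map k A (centerHom k A N z) n) c c')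
    (fun z z' c => by
      rw [Homology.center_smul_def, centerHom_add, Homology.map_add']; rfl)
    (fun z z' c => by
      rw [Homology.center_smul_def, centerHom_mul, Homology.map_comp]; rfl)
    (fun c => by
      rw [Homology.center_smul_def, centerHom_one, Homology.map_id])

/-- `k` acts on `H_n(A, N)` through `k → Z`. -/
instance (n : ℕ) : Module k (Homology k A N n) :=
  Module.compHom _ (algebraMap k (Subalgebra.center k A))

/-- `Z` acts on `H^m(A, M)` through its action on `M`. -/
instance (m : ℕ) : SMul (Subalgebra.center k A) (Cohomology k A N m) :=
  ⟨fun z c => Cohomology.map k A (centerHom k A N z) m c⟩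

lemma Cohomology.center_smul_def {m : ℕ} (z : Subalgebra.center k A) (c : Cohomology k A N m) :
    z • c = Cohomology.map k A (centerHom k A N z) m c := rfl

instance (m : ℕ) : Module (Subalgebra.center k A) (Cohomology k A N m) :=
  Module.ofMinimalAxioms (fun z c c' => map_add (Cohomology.map k A (centerHom k A N z) m) c c')
    (fun z z' c => by
      rw [Cohomology.center_smul_def, centerHom_add, Cohomology.map_add']; rfl)
    (fun z z' c => by
      rw [Cohomology.center_smul_def, centerHom_mul, Cohomology.map_comp]; rfl)
    (fun c => by
      rw [Cohomology.center_smul_def, centerHom_one, Cohomology.map_id])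

/-- `k` acts on `H^m(A, M)` through `k → Z`. -/
instance (m : ℕ) : Module k (Cohomology k A N m) :=
  Module.compHom _ (algebraMap k (Subalgebra.center k A))

end Center

/-! ### Degree zero -/

section DegreeZero

variable (N : Type*) [AddCommGroup N] [Module (Env k A) N]
variable (M : Type*) [AddCommGroup M] [Module (Env k A) M]

/-- The subgroup `[N, A]` generated by the elements `a x - x a`. -/
def commutators : AddSubgroup N :=
  AddSubgroup.closure {y | ∃ (a : A) (x : N), y = lact k a x - ract k a x}

/-- The subgroup `M^A` of the elements `y` with `a y = y a` for all `a`. -/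
def invariants : AddSubgroup M where
  carrier := {y | ∀ a : A, lact k a y = ract k a y}
  zero_mem' a := by rw [map_zero, map_zero]
  add_mem' {y y'} h h' a := by rw [map_add, map_add, h, h']
  neg_mem' {y} h a := by rw [map_neg, map_neg, h]

lemma mk_lact_eq_mk_ract (a : A) (x : N) :
    (QuotientAddGroup.mk (lact k a x) : N ⧸ commutators k A N) =
      QuotientAddGroup.mk (ract k a x) :=
  QuotientAddGroup.eq_iff_sub_mem.2 (AddSubgroup.subset_closure ⟨a, x, rfl⟩)

/-- The map `N ⊗_{A^e} Bar(A)_0 → N / [N, A]`, `x ⊗ p ↦ [x d_0(p)]`. -/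
def psiChain : Chain k A N 0 →+ N ⧸ commutators k A N :=
  Balanced.lift
    (AddMonoidHom.mk' (fun x => AddMonoidHom.mk'
        (fun p => QuotientAddGroup.mk (ract k (Bar.aug k A p) x))
        (fun p p' => by rw [map_add, ract_add]; rfl))
      (fun x x' => AddMonoidHom.ext fun p => by
        simp only [AddMonoidHom.mk'_apply, AddMonoidHom.add_apply, map_add]; rfl))
    (fun i x p => by
      change QuotientAddGroup.mk (ract k (Bar.aug k A p) (lact k i.2 (ract k i.1 x))) =
        QuotientAddGroup.mk (ract k (Bar.aug k A (lact k i.1 (ract k i.2 p))) x)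
      rw [Bar.aug_lact, Bar.aug_ract, ← mul_assoc, ract_mul, ract_mul, ract_lact, ← lact_ract,
        mk_lact_eq_mk_ract])

lemma psiChain_mk (x : N) (p : Bar k A 0) :
    psiChain k A N (TAe.mk k A x p) = QuotientAddGroup.mk (ract k (Bar.aug k A p) x) := rfl

lemma psiChain_chainD (z : Chain k A N 1) : psiChain k A N (chainD k A N 0 z) = 0 := by
  induction z using TAe.induction with
  | h0 => simp only [map_zero]
  | hmk x p =>
    rw [chainD, TAe.map_mk, psiChain_mk, Bar.aug_d, ract_zero]; rfl
  | hadd z z' h h' => simp only [map_add, h, h', add_zero]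

/-- The map `ψ : H_0(A, N) → N / [N, A]`, `[x ⊗ p] ↦ [x d_0(p)]`. -/
def psi : Homology k A N 0 →+ N ⧸ commutators k A N :=
  Subquotient.lift ((psiChain k A N).comp (cycles k A N 0).subtype) (fun x hx hB => by
    obtain ⟨y, rfl⟩ := hB
    exact psiChain_chainD k A N y)

lemma psi_mk (z : Chain k A N 0) (hz : z ∈ cycles k A N 0) :
    psi k A N (Homology.mk k A z hz) = psiChain k A N z := rfl

variable {M} in
/-- A cocycle `t` of degree zero is of the form `t̃ ∘ d_0`, where `t̃ a = a t(1 ⊗ 1)`. -/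
lemma cocycle_zero_apply (t : Cochain k A M 0) (w : Bar k A 0) (ht : t ∈ cocycles k A M 0) :
    t w = lact k (Bar.aug k A w) (t (Bar.tprod k A 1)) ∧
      t w = ract k (Bar.aug k A w) (t (Bar.tprod k A 1)) := by
  have hd : ∀ w, t (Bar.d k A 0 w) = 0 := fun w => LinearMap.congr_fun
    (show cochainD k A M 0 t = 0 from ht) w
  have h1 : ∀ g : Fin 2 → A,
      Bar.tprod k A g = lact k (g 0) (ract k (g 1) (Bar.tprod k A 1)) := fun g => by
    rw [Bar.ract_tprod, Bar.lact_tprod]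
    congr 1
    ext i
    fin_cases i <;> simp [Fin.last, Function.update]
  have h2 : ∀ a : A, lact k a (t (Bar.tprod k A 1)) = ract k a (t (Bar.tprod k A 1)) := fun a => by
    have h3 := hd (Bar.tprod k A ![1, a, 1])
    have e0 : Fin.contractNth (Fin.castSucc (0 : Fin 2)) (· * ·) ![1, a, 1] = ![a, 1] := by
      ext i
      fin_cases i <;> simp [Fin.contractNth]
    have e1 : Fin.contractNth (Fin.castSucc (1 : Fin 2)) (· * ·) ![1, a, 1] = ![1, a] := by
      ext i
      fin_cases i <;> simp [Fin.contractNth]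
    have e2 : (-1 : k) • Bar.tprod k A ![1, a] = -Bar.tprod k A ![1, a] := by
      rw [neg_smul, one_smul]
    rw [Bar.d_tprod, Fin.sum_univ_two, Fin.val_zero, Fin.val_one, pow_zero, pow_one, one_smul,
      e0, e1, e2, map_add, map_neg, ← sub_eq_add_neg, sub_eq_zero, h1 ![a, 1], h1 ![1, a]] at h3
    simpa [ract_one, lact_one] using h3
  have h4 : t w = lact k (Bar.aug k A w) (t (Bar.tprod k A 1)) := by
    induction w using Bar.induction' with
    | htprod g =>
      rw [h1, Bar.aug_lact, Bar.aug_ract, Bar.aug_tprod, map_lact, map_ract, ← h2, lact_mul]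
      simp
    | hadd w w' h h' => rw [map_add, map_add, lact_add, h, h']
  exact ⟨h4, h4.trans (h2 _)⟩

/-- The map `φ : H^0(A, M) → M^A`, `[t] ↦ t̃(1)` where `t = t̃ ∘ d_0`, that is,
`t̃(1) = t(1 ⊗ 1)`. -/
def phi : Cohomology k A M 0 →+ invariants k A M :=
  Subquotient.lift
    (AddMonoidHom.mk' (fun t => ⟨t.1 (Bar.tprod k A 1), fun a => by
        obtain ⟨t, ht⟩ := t
        have h := cocycle_zero_apply k A t (Bar.tprod k A ![a, 1]) ht
        rw [h.1, Bar.aug_tprod] at h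
        simpa using h.2⟩)
      (fun t t' => rfl))
    (fun t ht hB => by
      have h0 : t = 0 := hB
      subst h0
      rfl)

lemma phi_mk (t : Cochain k A M 0) (ht : t ∈ cocycles k A M 0) :
    (phi k A M (Cohomology.mk k A t ht) : M) = t (Bar.tprod k A 1) := rfl

/-- The map `N / [N, A] × M^A → (N ⊗_A M) / [N ⊗_A M, A]`, `([x], y) ↦ [x ⊗ y]`. -/
def bottom : N ⧸ commutators k A N →+ invariants k A M →+
    TA k A N M ⧸ commutators k A (TA k A N M) :=
  QuotientAddGroup.lift _
    (AddMonoidHom.mk' (fun x => AddMonoidHom.mk'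
        (fun y => QuotientAddGroup.mk (TA.mk k A x (y : M)))
        (fun y y' => by rw [AddSubgroup.coe_add, TA.mk_add_right]; rfl))
      (fun x x' => AddMonoidHom.ext fun y => by
        simp only [AddMonoidHom.mk'_apply, AddMonoidHom.add_apply, TA.mk_add_left]; rfl))
    (by
      rw [commutators, AddSubgroup.closure_le]
      rintro _ ⟨a, x, rfl⟩
      refine AddMonoidHom.ext fun y => ?_
      rw [map_sub, AddMonoidHom.sub_apply, AddMonoidHom.zero_apply, sub_eq_zero]
      change QuotientAddGroup.mk (TA.mk k A (lact k a x) (y : M)) =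
        QuotientAddGroup.mk (TA.mk k A (ract k a x) (y : M))
      rw [TA.mk_balance, y.2 a, ← TA.lact_mk, ← TA.ract_mk, mk_lact_eq_mk_ract])

lemma bottom_mk (x : N) (y : invariants k A M) :
    bottom k A N M (QuotientAddGroup.mk x) y = QuotientAddGroup.mk (TA.mk k A x (y : M)) := rfl

end DegreeZero

/-! ### Cap products -/

/-- A family of maps `∩ : H_n(A, N) ⊗_k H^m(A, M) → H_p(A, N ⊗_A M)` for all `m ≤ n`, `p = n - m`,
and all bimodules `N` and `M`, given as `k`-bilinear maps. -/
def CapFamily : Type _ :=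
  ∀ (n m p : ℕ), n = p + m → ∀ (N M : ModuleCat.{max v w} (Env k A)),
    Homology k A N n →ₗ[k] Cohomology k A M m →ₗ[k] Homology k A (TA k A N M) p

/-- The axioms of a cap product. -/
structure IsCapProduct [Module.Projective k A] (cap : CapFamily.{u, v, w} k A) : Prop where
  /-- The maps are bilinear over the center `Z` of `A`. -/
  center_bilinear : ∀ (n m p : ℕ) (h : n = p + m) (N M : ModuleCat.{max v w} (Env k A))
    (z : Subalgebra.center k A) (γ : Homology k A N n) (ε : Cohomology k A M m),
    cap n m p h N M (z • γ) ε = z • cap n m p h N M γ ε ∧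
      cap n m p h N M γ (z • ε) = z • cap n m p h N M γ ε
  /-- If `0 → N₁ → N₂ → N₃ → 0` is exact and stays exact under `- ⊗_A M`, then
  `δ(γ ∩ ε) = (-1)^m δ(γ) ∩ ε`. -/
  connecting_left : ∀ (n m p : ℕ) (h : n = p + m) (N₁ N₂ N₃ M : ModuleCat.{max v w} (Env k A))
    (f : N₁ →ₗ[Env k A] N₂) (g : N₂ →ₗ[Env k A] N₃) (hfg : IsShortExact k A f g)
    (hfgM : IsShortExact k A (TA.map k A f (LinearMap.id : M →ₗ[Env k A] M))
      (TA.map k A g (LinearMap.id : M →ₗ[Env k A] M)))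
    (γ : Homology k A N₃ (n + 1)) (ε : Cohomology k A M m),
    Homology.δ k A hfgM p (cap (n + 1) m (p + 1) (by omega) N₃ M γ ε) =
      (-1 : ℤ) ^ m • cap n m p h N₁ M (Homology.δ k A hfg n γ) ε
  /-- If `0 → M₁ → M₂ → M₃ → 0` is exact and stays exact under `N ⊗_A -`, then
  `δ(γ ∩ ε) = (-1)^(m+1) γ ∩ ∂(ε)`. -/
  connecting_right : ∀ (n m p : ℕ) (h : n = p + (m + 1))
    (N M₁ M₂ M₃ : ModuleCat.{max v w} (Env k A))
    (f : M₁ →ₗ[Env k A] M₂) (g : M₂ →ₗ[Env k A] M₃) (hfg : IsShortExact k A f g)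
    (hNfg : IsShortExact k A (TA.map k A (LinearMap.id : N →ₗ[Env k A] N) f)
      (TA.map k A (LinearMap.id : N →ₗ[Env k A] N) g))
    (γ : Homology k A N n) (ε : Cohomology k A M₃ m),
    Homology.δ k A hNfg p (cap n m (p + 1) (by omega) N M₃ γ ε) =
      (-1 : ℤ) ^ (m + 1) • cap n (m + 1) p h N M₁ γ (Cohomology.δ k A hfg m ε)
  /-- In degree `(0, 0)` the product is `([x], y) ↦ [x ⊗ y]` under the identifications
  `H_0(A, N) ≅ N / [N, A]` and `H^0(A, M) ≅ M^A`. -/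
  degree_zero : ∀ (N M : ModuleCat.{max v w} (Env k A)) (γ : Homology k A N 0)
    (ε : Cohomology k A M 0),
    psi k A (TA k A N M) (cap 0 0 0 rfl N M γ ε) = bottom k A N M (psi k A N γ) (phi k A M ε)

end Hochschild

end

end HochschildCap

/-! Existence. Cut a bar after its entry a_m, put a 1 on each side of the cut and apply a degree m
cochain `t` to the front half. This is an A^e-linear map Bar(A)_n → M ⊗_A Bar(A)_{n-m} (`capBar`);
tensoring with N and reassociating gives the cap product on chains (`capChain`). Everything rests on
the Leibniz formula `capBar_d`, (dw) ∩ t = w ∩ (t d) + (-1)^m d(w ∩ t). Faces away from the cut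
occur on both sides. The last face of the front half and the first face of the back half are left
over, and they cancel because an element of A may cross ⊗_A.

By Leibniz, capping with a cocycle preserves cycles and boundaries, and capping a cycle with a
coboundary gives a boundary. The chain formula is strictly natural in N and M, so a lift for the
snake lemma on the target is the cap product of the given lifts, and Leibniz then produces the signs
(`δ_capAdd_left`, `δ_capAdd_right`). Degree (0,0) is a direct computation (`psi_capAdd`). Linearity
over Z in γ is naturality. In ε, a central z acting on M crosses ⊗_A and becomes right
multiplication by z on N; on H_n(A, N), though not on chains, this agrees with left multiplication
(`Homology.map_centerHom`).

Uniqueness is dimension shifting in both variables (`IsCapProduct.unique`). For m = 0, use induction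
on n with the cover A^e ⊗_A N → N. It has a right A-linear section, so its kernel sequence stays
exact under - ⊗_A M, and H_{n+1}(A, (A^e ⊗_A N) ⊗_A M) = 0 makes δ injective; (QII₁) thus reduces
degree n + 1 to degree n. In degree 0, (QIII) and the injectivity of ψ decide. For larger m, embed M
in the coinduced bimodule Hom_k(A, M). Evaluation at 1 is a left A-linear retraction, so the
sequence stays exact under N ⊗_A -, and the vanishing of H^{m+1}(A, Hom_k(A, M)) makes ∂ surjective;
(QII₂) then determines γ ∩ ∂ε from γ ∩ ε.

Both vanishing statements come from one contraction of the bar resolution, w ↦ w ⊗ 1, which is left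
A-linear (`Bar.d_T`, `Bar.T_lact`). Projectivity of A over k makes the bar terms projective over
A^e, so that N ⊗_{A^e} Bar(A)_n and Hom_{A^e}(Bar(A)_m, M) are exact in the coefficients, as the
snake lemma needs. -/

namespace HochschildCap

noncomputable section

/-! ### Cutting a bar into two -/

section Cut

variable (k : Type u) (A : Type v) [CommRing k] [Ring A] [Algebra k A]

/-- The map `w ↦ w ⊗ 1`. -/
def tensorT (n : ℕ) : (⨂[k] (_ : Fin n), A) →ₗ[k] ⨂[k] (_ : Fin (n + 1)), A :=
  PiTensorProduct.lift ((LinearMap.applyₗ (1 : A)).compMultilinearMap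
    (PiTensorProduct.tprod k (s := fun _ : Fin (n + 1) => A)).curryRight)

lemma tensorT_tprod (n : ℕ) (g : Fin n → A) :
    tensorT k A n (PiTensorProduct.tprod k g) =
      PiTensorProduct.tprod k (Fin.snoc (α := fun _ => A) g 1) :=
  PiTensorProduct.lift.tprod _

variable {A}

/-- The sequence `(a_0, …, a_m, 1)`. -/
def front {n m p : ℕ} (h : n = p + m) (g : Fin (n + 2) → A) : Fin (m + 2) → A :=
  fun i => if hi : (i : ℕ) < m + 1 then g ⟨i, by omega⟩ else 1

/-- The sequence `(1, a_{m+1}, …, a_{n+1})`. -/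
def back {n m p : ℕ} (h : n = p + m) (g : Fin (n + 2) → A) : Fin (p + 2) → A :=
  fun i => if (i : ℕ) = 0 then 1 else g ⟨m + i, by omega⟩

variable (A)

/-- The equivalence which cuts `n + 2` places into the first `m + 1` and the last `p + 1`. -/
def cutEquiv {n m p : ℕ} (h : n = p + m) : Fin (n + 2) ≃ Fin (m + 1) ⊕ Fin (p + 1) :=
  (finCongr (by omega)).trans finSumFinEquiv.symm

/-- The map `a_0 ⊗ ⋯ ⊗ a_{n+1} ↦ (a_0 ⊗ ⋯ ⊗ a_m ⊗ 1) ⊗ (1 ⊗ a_{m+1} ⊗ ⋯ ⊗ a_{n+1})`. -/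
def cut {n m p : ℕ} (h : n = p + m) :
    (⨂[k] (_ : Fin (n + 2)), A) →ₗ[k]
      (⨂[k] (_ : Fin (m + 2)), A) ⊗[k] (⨂[k] (_ : Fin (p + 2)), A) :=
  TensorProduct.map (tensorT k A (m + 1)) (tensorS k A (p + 1)) ∘ₗ
    (PiTensorProduct.tmulEquiv k A).symm.toLinearMap ∘ₗ
    (PiTensorProduct.reindex k (fun _ => A) (cutEquiv h)).toLinearMap

lemma cut_tprod {n m p : ℕ} (h : n = p + m) (g : Fin (n + 2) → A) :
    cut k A h (PiTensorProduct.tprod k g) =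
      PiTensorProduct.tprod k (front h g) ⊗ₜ[k] PiTensorProduct.tprod k (back h g) := by
  rw [cut, LinearMap.comp_apply, LinearMap.comp_apply, LinearEquiv.coe_coe, LinearEquiv.coe_coe,
    PiTensorProduct.reindex_tprod, PiTensorProduct.tmulEquiv_symm_apply, TensorProduct.map_tmul,
    tensorT_tprod, tensorS_tprod]
  congr 2
  ext i
  refine Fin.cases ?_ (fun i => ?_) i
  · simp [back]
  · rw [Fin.cons_succ]
    simp only [back, Fin.val_succ, Nat.add_one_ne_zero, if_false]
    congr 1
    ext
    simp [cutEquiv]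
    omega

/-- The left action touches only the front half of a cut bar and the right action only the back
half, since the inserted 1's shield the other ends. This and the next three lemmas give the
A^e-linearity of `capBar`. -/
lemma front_update_zero {n m p : ℕ} (h : n = p + m) (g : Fin (n + 2) → A) (a : A) :
    front h (Function.update g 0 (a * g 0)) =
      Function.update (front h g) 0 (a * front h g 0) := by
  ext i
  simp only [front, Function.update_apply, Fin.ext_iff, Fin.val_zero]
  by_cases hi : (i : ℕ) = 0
  · simp [hi]
  · simp [hi]

lemma back_update_zero {n m p : ℕ} (h : n = p + m) (g : Fin (n + 2) → A) (a : A) :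
    back h (Function.update g 0 a) = back h g := by
  ext i
  simp only [back, Function.update_apply, Fin.ext_iff, Fin.val_zero]
  by_cases hi : (i : ℕ) = 0
  · simp [hi]
  · simp [hi]

lemma front_update_last {n m p : ℕ} (h : n = p + m) (g : Fin (n + 2) → A) (a : A) :
    front h (Function.update g (Fin.last (n + 1)) a) = front h g := by
  ext i
  simp only [front, Function.update_apply, Fin.ext_iff, Fin.val_last]
  split_ifs <;> first | rfl | omega

lemma back_update_last {n m p : ℕ} (h : n = p + m) (g : Fin (n + 2) → A) (a : A) :
    back h (Function.update g (Fin.last (n + 1)) (g (Fin.last (n + 1)) * a)) =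
      Function.update (back h g) (Fin.last (p + 1)) (back h g (Fin.last (p + 1)) * a) := by
  have hl : ∀ hh, (⟨m + (p + 1), hh⟩ : Fin (n + 2)) = Fin.last (n + 1) := fun hh =>
    Fin.ext (by simp; omega)
  ext i
  simp only [back, Function.update_apply, Fin.ext_iff, Fin.val_last]
  by_cases hi : (i : ℕ) = p + 1
  · have : i = Fin.last (p + 1) := Fin.ext hi
    subst this
    simp [hl]
    omega
  · have : ¬ (m + (i : ℕ) = n + 1) := by omega
    simp [hi, this]

/-- Faces and cutting: a contraction at j ≤ m takes place in the front half of the cut with m + 1,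
and one at j > m takes place at position j - m ≥ 1 in the back half of the cut with p + 1. The other
half is unaffected. These four lemmas account for every face of the long bar. -/
lemma front_contractNth_of_le {n m p : ℕ} (h : n = p + m) (g : Fin (n + 3) → A)
    (j : Fin (n + 2)) (i : Fin (m + 2)) (hj : (j : ℕ) = i) (hi : (i : ℕ) ≤ m) :
    front h (Fin.contractNth j.castSucc (· * ·) g) =
      Fin.contractNth i.castSucc (· * ·) (front (p := p) (m := m + 1) (by omega) g) := by
  ext s
  simp only [front, Fin.contractNth, Fin.val_castSucc, Fin.val_succ, hj, Fin.castSucc_mk, Fin.succ_mk]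
  grind

lemma back_contractNth_of_le {n m p : ℕ} (h : n = p + m) (g : Fin (n + 3) → A)
    (j : Fin (n + 2)) (hj : (j : ℕ) ≤ m) :
    back h (Fin.contractNth j.castSucc (· * ·) g) =
      back (p := p) (m := m + 1) (by omega) g := by
  ext s
  simp only [back, Fin.contractNth, Fin.val_castSucc, Fin.castSucc_mk, Fin.succ_mk]
  have e : ∀ h1 h2, g ⟨m + 1 + s, h1⟩ = g ⟨m + s + 1, h2⟩ := fun _ _ => by
    congr 2; omega
  grind

lemma front_contractNth_of_lt {n m p : ℕ} (h : n = p + m) (g : Fin (n + 3) → A)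
    (j : Fin (n + 2)) (hj : m < (j : ℕ)) :
    front h (Fin.contractNth j.castSucc (· * ·) g) =
      front (p := p + 1) (m := m) (by omega) g := by
  ext s
  simp only [front, Fin.contractNth, Fin.val_castSucc, Fin.castSucc_mk, Fin.succ_mk]
  grind

lemma back_contractNth_of_lt {n m p : ℕ} (h : n = p + m) (g : Fin (n + 3) → A)
    (j : Fin (n + 2)) (i : Fin (p + 2)) (hj : (j : ℕ) = m + i) (hi : (i : ℕ) ≠ 0) :
    back h (Fin.contractNth j.castSucc (· * ·) g) =
      Fin.contractNth i.castSucc (· * ·) (back (p := p + 1) (m := m) (by omega) g) := by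
  ext s
  simp only [back, Fin.contractNth, Fin.val_castSucc, Fin.val_succ, hj, Fin.castSucc_mk, Fin.succ_mk]
  have e : ∀ h1 h2, g ⟨m + (s + 1), h1⟩ = g ⟨m + s + 1, h2⟩ := fun _ _ => rfl
  grind

/-- The last face of the front half and the zeroth face of the back half involve an inserted 1, so
they come from no face of the long bar. Each amounts to multiplying by a_{m+1} at the cut, from the
right here and from the left in the next lemma. -/
lemma contractNth_front_last {n m p : ℕ} (h : n = p + m) (g : Fin (n + 3) → A) :
    Fin.contractNth (Fin.last (m + 1)).castSucc (· * ·)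
        (front (p := p) (m := m + 1) (n := n + 1) (by omega) g) =
      Function.update (front (p := p + 1) (m := m) (n := n + 1) (by omega) g) (Fin.last (m + 1))
        (front (p := p + 1) (m := m) (n := n + 1) (by omega) g (Fin.last (m + 1)) *
          g ⟨m + 1, by omega⟩) := by
  ext s
  simp only [front, Fin.contractNth, Fin.val_castSucc, Fin.val_succ, Function.update_apply,
    Fin.ext_iff, Fin.val_last]
  have e : ∀ h1 h2, (s : ℕ) = m + 1 → g ⟨s, h1⟩ = g ⟨m + 1, h2⟩ := fun _ _ hs => by
    congr 2
  grind

lemma contractNth_back_zero {n m p : ℕ} (h : n = p + m) (g : Fin (n + 3) → A) :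
    Fin.contractNth (0 : Fin (p + 2)).castSucc (· * ·)
        (back (p := p + 1) (m := m) (n := n + 1) (by omega) g) =
      Function.update (back (p := p) (m := m + 1) (n := n + 1) (by omega) g) 0
        (g ⟨m + 1, by omega⟩ * back (p := p) (m := m + 1) (n := n + 1) (by omega) g 0) := by
  ext s
  simp only [back, Fin.contractNth, Fin.val_castSucc, Fin.val_succ, Function.update_apply,
    Fin.ext_iff, Fin.val_zero]
  have e : ∀ h1 h2, (s : ℕ) = 0 → g ⟨m + (s + 1), h1⟩ = g ⟨m + 1, h2⟩ := fun _ _ hs => by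
    congr 2; omega
  have e' : ∀ h1 h2, g ⟨m + (s + 1), h1⟩ = g ⟨m + 1 + s, h2⟩ := fun _ _ => by
    congr 2; omega
  grind

lemma neg_one_pow_smul_eq {X : Type*} [AddCommGroup X] [Module k X] (j : ℕ) (x : X) :
    ((-1 : k) ^ j) • x = ((-1 : ℤ) ^ j) • x := by
  rw [← Int.cast_smul_eq_zsmul k]; simp

/-- Integer signs pass through every additive map, and the tensor products `TA` and `TAe` are
handled as additive groups only. -/
lemma Bar.d_tprod_int (n : ℕ) (g : Fin (n + 3) → A) :
    Bar.d k A n (Bar.tprod k A g) = ∑ j : Fin (n + 2), ((-1 : ℤ) ^ (j : ℕ)) •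
      Bar.tprod k A (Fin.contractNth j.castSucc (· * ·) g) := by
  rw [Bar.d_tprod]
  exact Finset.sum_congr rfl fun j _ => neg_one_pow_smul_eq k _ _

variable {A} {M : Type*} [AddCommGroup M] [Module (Env k A) M]

/-- The map `Bar(A)_m ⊗_k Bar(A)_p → M ⊗_A Bar(A)_p`, `w ⊗ w' ↦ t w ⊗ w'`. -/
def cochainTensor {m p : ℕ} (t : Cochain k A M m) :
    (⨂[k] (_ : Fin (m + 2)), A) ⊗[k] (⨂[k] (_ : Fin (p + 2)), A) →+ TA k A M (Bar k A p) :=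
  TensorProduct.liftAddHom
    (show Bar k A m →+ Bar k A p →+ TA k A M (Bar k A p) from
      AddMonoidHom.mk' (fun w => AddMonoidHom.mk'
        (fun w' => TA.mk k A (t w) w') (TA.mk_add_right k A _))
      (fun w w' => AddMonoidHom.ext fun x => by
        simp only [AddMonoidHom.mk'_apply, AddMonoidHom.add_apply, map_add, TA.mk_add_left]))
    (fun c w w' => by
      -- Scalars act through k → A, so moving one across the tensor product over k is an instance of
      -- balancing over A.
      have hw : ∀ (q : ℕ) (w : Bar k A q), c • w = lact k (algebraMap k A c) w := fun q w => by
        rw [Bar.lact_eq, AlgHom.commutes]; rfl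
      change TA.mk k A (t (c • (show Bar k A m from w))) (show Bar k A p from w') =
        TA.mk k A (t w) (c • (show Bar k A p from w'))
      rw [hw, hw, lact_algebraMap, map_ract, TA.mk_balance])

/-- The map `Bar(A)_n → M ⊗_A Bar(A)_p`,
`a_0 ⊗ ⋯ ⊗ a_{n+1} ↦ t(a_0 ⊗ ⋯ ⊗ a_m ⊗ 1) ⊗ (1 ⊗ a_{m+1} ⊗ ⋯ ⊗ a_{n+1})`. -/
def capBarAdd {n m p : ℕ} (h : n = p + m) (t : Cochain k A M m) :
    Bar k A n →+ TA k A M (Bar k A p) :=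
  (cochainTensor k t).comp (AddMonoidHomClass.toAddMonoidHom (cut k A h))

lemma capBarAdd_tprod {n m p : ℕ} (h : n = p + m) (t : Cochain k A M m) (g : Fin (n + 2) → A) :
    capBarAdd k h t (Bar.tprod k A g) =
      TA.mk k A (t (Bar.tprod k A (front h g))) (Bar.tprod k A (back h g)) :=
  (congrArg (cochainTensor k t) (cut_tprod k A h g)).trans rfl

/-- The same map, which is `A^e`-linear. -/
def capBar {n m p : ℕ} (h : n = p + m) (t : Cochain k A M m) :
    Bar k A n →ₗ[Env k A] TA k A M (Bar k A p) :=
  homOfActs k (capBarAdd k h t)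
    (fun a w => by
      induction w using Bar.induction' with
      | htprod g =>
        rw [Bar.lact_tprod, capBarAdd_tprod, capBarAdd_tprod, front_update_zero, back_update_zero,
          ← Bar.lact_tprod, map_lact, TA.lact_mk]
      | hadd w w' h h' => simp only [map_add, h, h'])
    (fun a w => by
      induction w using Bar.induction' with
      | htprod g =>
        rw [Bar.ract_tprod, capBarAdd_tprod, capBarAdd_tprod, front_update_last, back_update_last,
          ← Bar.ract_tprod, TA.ract_mk]
      | hadd w w' h h' => simp only [map_add, h, h'])

lemma capBar_tprod {n m p : ℕ} (h : n = p + m) (t : Cochain k A M m) (g : Fin (n + 2) → A) :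
    capBar k h t (Bar.tprod k A g) =
      TA.mk k A (t (Bar.tprod k A (front h g))) (Bar.tprod k A (back h g)) :=
  capBarAdd_tprod k h t g

lemma TA.mk_zsmul_left {N : Type*} [AddCommGroup N] [Module (Env k A) N] (c : ℤ) (x : N) (y : M) :
    TA.mk k A (c • x) y = c • TA.mk k A x y :=
  map_zsmul (AddMonoidHom.mk' (fun x : N => TA.mk k A x y)
    fun x x' => TA.mk_add_left k A x x' y) c x

lemma TA.mk_zsmul_right {N : Type*} [AddCommGroup N] [Module (Env k A) N] (c : ℤ) (x : N) (y : M) :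
    TA.mk k A x (c • y) = c • TA.mk k A x y :=
  map_zsmul (AddMonoidHom.mk' (fun y : M => TA.mk k A x y) (TA.mk_add_right k A x)) c y

lemma TA.mk_sum_left {ι N : Type*} [AddCommGroup N] [Module (Env k A) N] (s : Finset ι)
    (x : ι → N) (y : M) : TA.mk k A (∑ i ∈ s, x i) y = ∑ i ∈ s, TA.mk k A (x i) y :=
  map_sum (AddMonoidHom.mk' (fun x : N => TA.mk k A x y)
    fun x x' => TA.mk_add_left k A x x' y) x s

lemma TA.mk_sum_right {ι N : Type*} [AddCommGroup N] [Module (Env k A) N] (s : Finset ι)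
    (x : N) (y : ι → M) : TA.mk k A x (∑ i ∈ s, y i) = ∑ i ∈ s, TA.mk k A x (y i) :=
  map_sum (AddMonoidHom.mk' (fun y : M => TA.mk k A x y) (TA.mk_add_right k A x)) y s

/-- The Leibniz formula behind all properties of the cap product. The faces of the long bar are
distributed over the two halves, and the two extra faces at the cut cancel. -/
lemma capBar_d {n m p : ℕ} (h : n = p + m) (t : Cochain k A M m) (w : Bar k A (n + 1)) :
    capBar k h t (Bar.d k A n w) =
      capBar k (p := p) (by omega) (cochainD k A M m t) w +
        (-1 : ℤ) ^ m • TA.map k A LinearMap.id (Bar.d k A p)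
          (capBar k (p := p + 1) (by omega) t w) := by
  induction w using Bar.induction' with
  | hadd w w' h h' => simp only [map_add, h, h', smul_add]; abel
  | htprod g =>
    rw [capBar_tprod, capBar_tprod, TA.map_mk, Bar.d_tprod_int, Bar.d_tprod_int]
    change _ = TA.mk k A (t (Bar.d k A m _)) _ + _
    rw [Bar.d_tprod_int]
    simp only [map_sum, map_zsmul, capBar_tprod, TA.mk_sum_left, TA.mk_sum_right,
      TA.mk_zsmul_left, TA.mk_zsmul_right, LinearMap.id_apply]
    subst h
    -- The n + 2 faces on the left are grouped as m + 1 before the cut and p + 1 after it. On the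
    -- right, the front half has one further face at its end and the back half one further face at
    -- its start; these are split off.
    have hc : m + 1 + (p + 1) = p + m + 2 := by omega
    rw [← (finCongr hc).sum_comp, Fin.sum_univ_add, Fin.sum_univ_castSucc (n := m + 1),
      Fin.sum_univ_succ (n := p + 1), smul_add, Finset.smul_sum]
    -- The extra faces agree: a_{m+1} acts on the value of `t` from the right in one and on the back
    -- half from the left in the other, and it may cross ⊗_A.
    have hmid : TA.mk k A (t (Bar.tprod k A (Fin.contractNth (Fin.last (m + 1)).castSucc
          (· * ·) (front (p := p) (m := m + 1) (n := p + m + 1) (by omega) g))))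
          (Bar.tprod k A (back (p := p) (m := m + 1) (n := p + m + 1) (by omega) g)) =
        TA.mk k A (t (Bar.tprod k A (front (p := p + 1) (m := m) (n := p + m + 1) (by omega) g)))
          (Bar.tprod k A (Fin.contractNth (0 : Fin (p + 2)).castSucc (· * ·)
            (back (p := p + 1) (m := m) (n := p + m + 1) (by omega) g))) := by
      rw [contractNth_front_last A rfl, contractNth_back_zero A rfl, ← Bar.lact_tprod,
        ← Bar.ract_tprod, map_ract, TA.mk_balance]
    rw [hmid]
    -- The sums a and b match e and f term by term, and the extra faces c and c' carry the opposite
    -- signs (-1)^{m+1} and (-1)^m.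
    have hsum : ∀ a b c c' e f : TA k A M (Bar k A p), a = e → b = f → c = -c' →
        a + b = e + c + (c' + f) := fun a b c c' e f h1 h2 h3 => by
      rw [h1, h2, h3]; abel
    refine hsum _ _ _ _ _ _ (Finset.sum_congr rfl fun j _ => ?_)
      (Finset.sum_congr rfl fun j _ => ?_) ?_
    · have hj : (j : ℕ) ≤ m := by omega
      rw [back_contractNth_of_le A rfl g _ (by simpa using hj),
        front_contractNth_of_le A rfl g _ j.castSucc (by simp) (by simpa using hj)]
      simp
    -- Face m + 1 + j of the long bar is face j + 1 of the back half; the missing (-1)^m is the sign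
    -- in front of the differential.
    · rw [back_contractNth_of_lt A rfl g _ j.succ (by simp; omega) (by simp),
        front_contractNth_of_lt A rfl g _ (by simp; omega), smul_smul, ← pow_add]
      congr 2
      simp
      omega
    · rw [Fin.val_last, Fin.val_zero, pow_zero, one_smul, pow_succ, mul_neg_one, neg_smul]

end Cut

/-! ### The cap product on chains -/

section CapChain

variable (k : Type u) {A : Type v} [CommRing k] [Ring A] [Algebra k A]
variable {N M P : Type*} [AddCommGroup N] [Module (Env k A) N] [AddCommGroup M] [Module (Env k A) M]
  [AddCommGroup P] [Module (Env k A) P]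
variable {N' M' P' : Type*} [AddCommGroup N'] [Module (Env k A) N'] [AddCommGroup M']
  [Module (Env k A) M'] [AddCommGroup P'] [Module (Env k A) P']

lemma TAe.hom_ext {X : Type*} [AddCommGroup X] {f g : TAe k A N P →+ X}
    (h : ∀ x p, f (TAe.mk k A x p) = g (TAe.mk k A x p)) : f = g := Balanced.hom_ext h

/-- The map `y ⊗ p ↦ (x ⊗ y) ⊗ p`. -/
def TAe.assocAux (x : N) : TA k A M P →+ TAe k A (TA k A N M) P :=
  Balanced.lift
    (AddMonoidHom.mk' (fun y => AddMonoidHom.mk' (fun p => TAe.mk k A (TA.mk k A x y) p)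
        (fun p p' => TAe.mk_add_right k A _ _ _))
      (fun y y' => AddMonoidHom.ext fun p => by
        simp only [AddMonoidHom.mk'_apply, AddMonoidHom.add_apply, TA.mk_add_right,
          TAe.mk_add_left]))
    (fun a y p => by
      have h := TAe.balance k A a 1 (TA.mk k A x y) p
      rw [lact_one, ract_one, TA.ract_mk] at h
      exact h)

lemma TAe.assocAux_mk (x : N) (y : M) (p : P) :
    TAe.assocAux k x (TA.mk k A y p) = TAe.mk k A (TA.mk k A x y) p := rfl

/-- The map `N ⊗_{A^e} (M ⊗_A P) → (N ⊗_A M) ⊗_{A^e} P`, `x ⊗ (y ⊗ p) ↦ (x ⊗ y) ⊗ p`. -/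
def TAe.assoc : TAe k A N (TA k A M P) →+ TAe k A (TA k A N M) P :=
  Balanced.lift
    (AddMonoidHom.mk' (fun x => TAe.assocAux k x) (fun x x' => TA.hom_ext k A fun y p => by
      rw [AddMonoidHom.add_apply, TAe.assocAux_mk, TAe.assocAux_mk, TAe.assocAux_mk,
        TA.mk_add_left, TAe.mk_add_left]))
    (fun i x z => by
      change TAe.assocAux k (lact k i.2 (ract k i.1 x)) z =
        TAe.assocAux k x (lact k i.1 (ract k i.2 z))
      induction z using TA.induction with
      | h0 => simp only [map_zero]
      | hmk y p =>
        -- The two actions cross different tensor signs: `i.1` moves from x to y over A, while `i.2`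
        -- goes around the outer tensor product from p to x.
        have h := TAe.balance k A 1 i.2 (TA.mk k A x (lact k i.1 y)) p
        rw [lact_one, ract_one] at h
        rw [TA.ract_mk, TA.lact_mk, TAe.assocAux_mk, TAe.assocAux_mk, ← h, TA.lact_mk,
          ← TA.mk_balance, lact_ract, ract_lact]
      | hadd z z' h h' => simp only [map_add, h, h'])

lemma TAe.assoc_mk (x : N) (y : M) (p : P) :
    TAe.assoc k (TAe.mk k A x (TA.mk k A y p)) = TAe.mk k A (TA.mk k A x y) p := rfl

lemma TAe.map_assoc (f : N →ₗ[Env k A] N') (g : M →ₗ[Env k A] M') (r : P →ₗ[Env k A] P')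
    (z : TAe k A N (TA k A M P)) :
    TAe.map k A (TA.map k A f g) r (TAe.assoc k z) =
      TAe.assoc k (TAe.map k A f (TA.map k A g r) z) := by
  induction z using TAe.induction with
  | h0 => simp only [map_zero]
  | hadd z z' h h' => simp only [map_add, h, h']
  | hmk x z =>
    induction z using TA.induction with
    | h0 => simp only [TAe.mk_zero_right, map_zero]
    | hadd z z' h h' => simp only [TAe.mk_add_right, map_add, h, h']
    | hmk y p => rfl

/-- The cap product of a chain with the cochain `t`:
`x ⊗ (a_0 ⊗ ⋯ ⊗ a_{n+1}) ↦
  (x ⊗ t(a_0 ⊗ ⋯ ⊗ a_m ⊗ 1)) ⊗ (1 ⊗ a_{m+1} ⊗ ⋯ ⊗ a_{n+1})`. -/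
def capChain {n m p : ℕ} (h : n = p + m) (t : Cochain k A M m) :
    Chain k A N n →+ Chain k A (TA k A N M) p :=
  (TAe.assoc k).comp (TAe.map k A LinearMap.id (capBar k h t))

lemma capChain_mk {n m p : ℕ} (h : n = p + m) (t : Cochain k A M m) (x : N) (w : Bar k A n) :
    capChain k h t (TAe.mk k A x w) = TAe.assoc k (TAe.mk k A x (capBar k h t w)) := rfl

lemma capChain_tprod {n m p : ℕ} (h : n = p + m) (t : Cochain k A M m) (x : N)
    (g : Fin (n + 2) → A) :
    capChain k h t (TAe.mk k A x (Bar.tprod k A g)) =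
      TAe.mk k A (TA.mk k A x (t (Bar.tprod k A (front h g)))) (Bar.tprod k A (back h g)) := by
  rw [capChain_mk, capBar_tprod, TAe.assoc_mk]

variable {k} in
@[elab_as_elim]
lemma Chain.induction {n : ℕ} {q : Chain k A N n → Prop} (z : Chain k A N n) (h0 : q 0)
    (htprod : ∀ x g, q (TAe.mk k A x (Bar.tprod k A g)))
    (hadd : ∀ z z', q z → q z' → q (z + z')) : q z := by
  induction z using TAe.induction with
  | h0 => exact h0
  | hadd z z' h h' => exact hadd z z' h h'
  | hmk x w =>
    induction w using Bar.induction' with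
    | htprod g => exact htprod x g
    | hadd w w' h h' => rw [TAe.mk_add_right]; exact hadd _ _ h h'

lemma TAe.mk_zsmul_right (c : ℤ) (x : N) (y : P) :
    TAe.mk k A x (c • y) = c • TAe.mk k A x y :=
  map_zsmul (AddMonoidHom.mk' (fun y : P => TAe.mk k A x y) (TAe.mk_add_right k A x)) c y

/-- The Leibniz formula `capBar_d`, carried through N ⊗_{A^e} - and the associativity map. -/
lemma capChain_chainD {n m p : ℕ} (h : n = p + m) (t : Cochain k A M m)
    (z : Chain k A N (n + 1)) :
    capChain k h t (chainD k A N n z) =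
      capChain k (p := p) (by omega) (cochainD k A M m t) z +
        (-1 : ℤ) ^ m • chainD k A (TA k A N M) p (capChain k (p := p + 1) (by omega) t z) := by
  induction z using TAe.induction with
  | h0 => simp only [map_zero, smul_zero, add_zero]
  | hadd z z' h h' => simp only [map_add, h, h', smul_add]; abel
  | hmk x w =>
    -- Writing the identity of N ⊗_A M as id ⊗ id brings the differential into the form to which the
    -- naturality of the associativity map applies.
    have h1 : chainD k A (TA k A N M) p =
        TAe.map k A (TA.map k A LinearMap.id LinearMap.id) (Bar.d k A p) := by
      refine TAe.hom_ext k fun z q => ?_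
      induction z using TA.induction with
      | h0 => simp only [TAe.mk_zero_left, map_zero]
      | hadd z z' h h' => simp only [TAe.mk_add_left, map_add, h, h']
      | hmk y p => rfl
    rw [h1, chainD, TAe.map_mk, capChain_mk, capChain_mk, capChain_mk, TAe.map_assoc, TAe.map_mk,
      capBar_d, TAe.mk_add_right, TAe.mk_zsmul_right, map_add, map_zsmul]
    rfl

lemma capChain_add {n m p : ℕ} (h : n = p + m) (t t' : Cochain k A M m) (z : Chain k A N n) :
    capChain k h (t + t') z = capChain k h t z + capChain k h t' z := by
  induction z using Chain.induction with
  | h0 => simp only [map_zero, add_zero]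
  | hadd z z' h h' => simp only [map_add, h, h']; abel
  | htprod x g =>
    rw [capChain_tprod, capChain_tprod, capChain_tprod, LinearMap.add_apply, TA.mk_add_right,
      TAe.mk_add_left]

/-- Naturality holds strictly on chains, here in N and next in M. Hence the cap product of a lift is
a lift of the cap product, which is what the connecting homomorphisms require. -/
lemma capChain_chainMap {n m p : ℕ} (h : n = p + m) (t : Cochain k A M m) (f : N →ₗ[Env k A] N')
    (z : Chain k A N n) :
    capChain k h t (chainMap k A f n z) =
      chainMap k A (TA.map k A f (LinearMap.id : M →ₗ[Env k A] M)) p (capChain k h t z) := by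
  induction z using Chain.induction with
  | h0 => simp only [map_zero]
  | hadd z z' h h' => simp only [map_add, h, h']
  | htprod x g =>
    rw [chainMap, chainMap, TAe.map_mk, LinearMap.id_apply, capChain_tprod, capChain_tprod,
      TAe.map_mk, TA.map_mk]
    rfl

lemma capChain_cochainMap {n m p : ℕ} (h : n = p + m) (t : Cochain k A M m)
    (f : M →ₗ[Env k A] M') (z : Chain k A N n) :
    capChain k h (cochainMap k A f m t) z =
      chainMap k A (TA.map k A (LinearMap.id : N →ₗ[Env k A] N) f) p (capChain k h t z) := by
  induction z using Chain.induction with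
  | h0 => simp only [map_zero]
  | hadd z z' h h' => simp only [map_add, h, h']
  | htprod x g =>
    rw [chainMap, capChain_tprod, capChain_tprod, TAe.map_mk, TA.map_mk]
    rfl

end CapChain

/-! ### The cap product on homology -/

section CapHomology

variable (k : Type u) {A : Type v} [CommRing k] [Ring A] [Algebra k A]
variable {N M : Type*} [AddCommGroup N] [Module (Env k A) N] [AddCommGroup M] [Module (Env k A) M]
variable {N' M' : Type*} [AddCommGroup N'] [Module (Env k A) N'] [AddCommGroup M']
  [Module (Env k A) M']

/-- Lets the Leibniz sign be ignored when only membership in the boundaries matters. -/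
lemma neg_one_pow_smul_mem {X : Type*} [AddCommGroup X] {B : AddSubgroup X} (m : ℕ) {x : X} :
    (-1 : ℤ) ^ m • x ∈ B ↔ x ∈ B := by
  rcases neg_one_pow_eq_or ℤ m with h | h <;> simp [h]

lemma chainD_capChain {n m p : ℕ} (h : n = p + m) (t : Cochain k A M m)
    (ht : t ∈ cocycles k A M m) (z : Chain k A N (n + 1)) :
    chainD k A (TA k A N M) p (capChain k (p := p + 1) (by omega) t z) =
      (-1 : ℤ) ^ m • capChain k h t (chainD k A N n z) := by
  have ht : cochainD k A M m t = 0 := ht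
  have h0 : capChain k (N := N) (n := n + 1) (p := p) (by omega) (0 : Cochain k A M (m + 1)) z =
      0 := by
    simpa using capChain_add k (N := N) (n := n + 1) (p := p) (by omega)
      (0 : Cochain k A M (m + 1)) 0 z
  rw [capChain_chainD, ht, h0, zero_add, smul_smul, ← mul_pow]
  simp

lemma capChain_mem_cycles {n m p : ℕ} (h : n = p + m) (t : Cochain k A M m)
    (ht : t ∈ cocycles k A M m) (z : Chain k A N n) (hz : z ∈ cycles k A N n) :
    capChain k h t z ∈ cycles k A (TA k A N M) p := by
  cases p with
  | zero => trivial
  | succ p =>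
    obtain ⟨n, rfl⟩ : ∃ n', n = n' + 1 := ⟨p + m, by omega⟩
    have hz : chainD k A N n z = 0 := hz
    change chainD k A (TA k A N M) p _ = 0
    rw [chainD_capChain k (by omega) t ht, hz, map_zero, smul_zero]

lemma capChain_mem_boundaries {n m p : ℕ} (h : n = p + m) (t : Cochain k A M m)
    (ht : t ∈ cocycles k A M m) (z : Chain k A N n) (hz : z ∈ boundaries k A N n) :
    capChain k h t z ∈ boundaries k A (TA k A N M) p := by
  obtain ⟨y, rfl⟩ := hz
  rw [← neg_one_pow_smul_mem m, ← chainD_capChain k h t ht]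
  exact ⟨_, rfl⟩

/-- For t = s d and a cycle z, the left side of the Leibniz formula for s vanishes, so z ∩ t is up
to sign the boundary of z ∩ s. -/
lemma capChain_coboundary_mem {n m p : ℕ} (h : n = p + m) (t : Cochain k A M m)
    (ht : t ∈ coboundaries k A M m) (z : Chain k A N n) (hz : z ∈ cycles k A N n) :
    capChain k h t z ∈ boundaries k A (TA k A N M) p := by
  cases m with
  | zero =>
    have ht : t = 0 := ht
    have h0 : capChain k h (0 : Cochain k A M 0) z = 0 := by
      simpa using capChain_add k h (0 : Cochain k A M 0) 0 z
    rw [ht, h0]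
    exact AddSubgroup.zero_mem _
  | succ m =>
    obtain ⟨s, rfl⟩ := ht
    obtain ⟨n, rfl⟩ : ∃ n', n = n' + 1 := ⟨p + m, by omega⟩
    have hz : chainD k A N n z = 0 := hz
    have h1 := capChain_chainD k (by omega : n = p + m) s z
    rw [hz, map_zero] at h1
    rw [eq_neg_of_add_eq_zero_left h1.symm]
    exact AddSubgroup.neg_mem _ ((neg_one_pow_smul_mem m).2 ⟨_, rfl⟩)

/-- The cap product with the class of a cocycle. -/
def capCocycle {n m p : ℕ} (h : n = p + m) (t : cocycles k A M m) :
    Homology k A N n →+ Homology k A (TA k A N M) p :=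
  Subquotient.map (capChain k h t.1) (capChain_mem_cycles k h t.1 t.2)
    (capChain_mem_boundaries k h t.1 t.2)

lemma Homology.hom_ext {X : Type*} [AddCommGroup X] {n : ℕ} {f g : Homology k A N n →+ X}
    (h : ∀ x hx, f (Homology.mk k A x hx) = g (Homology.mk k A x hx)) : f = g :=
  AddMonoidHom.ext fun c => by
    obtain ⟨x, hx, rfl⟩ := Homology.mk_surjective k A c
    exact h x hx

/-- The cap product as a biadditive map. -/
def capAdd {n m p : ℕ} (h : n = p + m) :
    Cohomology k A M m →+ Homology k A N n →+ Homology k A (TA k A N M) p :=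
  Subquotient.lift
    (AddMonoidHom.mk' (capCocycle k h) (fun t t' => Homology.hom_ext k fun x hx =>
      Homology.mk_congr k A _ (capChain_add k h t.1 t'.1 x) _
        (AddSubgroup.add_mem _ (capChain_mem_cycles k h t.1 t.2 x hx)
          (capChain_mem_cycles k h t'.1 t'.2 x hx))))
    (fun t ht hB => Homology.hom_ext k fun x hx => by
      refine Subquotient.mk_eq_mk (hx' := AddSubgroup.zero_mem _) |>.2 ?_
      rw [sub_zero]
      exact capChain_coboundary_mem k h t hB x hx)

lemma capAdd_mk {n m p : ℕ} (h : n = p + m) (t : Cochain k A M m) (ht : t ∈ cocycles k A M m)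
    (x : Chain k A N n) (hx : x ∈ cycles k A N n) :
    capAdd k h (Cohomology.mk k A t ht) (Homology.mk k A x hx) =
      Homology.mk k A (capChain k h t x) (capChain_mem_cycles k h t ht x hx) := rfl

lemma capAdd_map_left {n m p : ℕ} (h : n = p + m) (f : N →ₗ[Env k A] N') (γ : Homology k A N n)
    (ε : Cohomology k A M m) :
    capAdd k h ε (Homology.map k A f n γ) =
      Homology.map k A (TA.map k A f (LinearMap.id : M →ₗ[Env k A] M)) p (capAdd k h ε γ) := by
  obtain ⟨x, hx, rfl⟩ := Homology.mk_surjective k A γ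
  obtain ⟨t, ht, rfl⟩ := Cohomology.mk_surjective k A ε
  exact Homology.mk_congr k A _ (capChain_chainMap k h t f x) _ _

lemma capAdd_map_right {n m p : ℕ} (h : n = p + m) (f : M →ₗ[Env k A] M') (γ : Homology k A N n)
    (ε : Cohomology k A M m) :
    capAdd k h (Cohomology.map k A f m ε) γ =
      Homology.map k A (TA.map k A (LinearMap.id : N →ₗ[Env k A] N) f) p (capAdd k h ε γ) := by
  obtain ⟨x, hx, rfl⟩ := Homology.mk_surjective k A γ
  obtain ⟨t, ht, rfl⟩ := Cohomology.mk_surjective k A ε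
  exact Homology.mk_congr k A _ (capChain_cochainMap k h t f x) _ _

lemma Homology.zsmul_mk {n : ℕ} (c : ℤ) (x : Chain k A N n) (hx : x ∈ cycles k A N n) :
    c • Homology.mk k A x hx = Homology.mk k A (c • x) (AddSubgroup.zsmul_mem _ hx c) := rfl

/-- With y = t(1 ⊗ 1), a cocycle satisfies t(a_0 ⊗ 1) = a_0 y, so x ⊗ (a_0 ⊗ a_1) leads to the class
of x ⊗ a_0 y a_1 on one side and of x ⊗ a_0 a_1 y on the other. These agree as y is invariant. -/
lemma psi_capAdd (γ : Homology k A N 0) (ε : Cohomology k A M 0) :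
    psi k A (TA k A N M) (capAdd k rfl ε γ) = bottom k A N M (psi k A N γ) (phi k A M ε) := by
  obtain ⟨x, hx, rfl⟩ := Homology.mk_surjective k A γ
  obtain ⟨t, ht, rfl⟩ := Cohomology.mk_surjective k A ε
  rw [capAdd_mk, psi_mk, psi_mk]
  -- The identity holds for all 0-chains, so the induction need not carry the cycle condition.
  clear hx
  induction x using Chain.induction with
  | h0 => simp only [map_zero, AddMonoidHom.zero_apply]
  | hadd z z' h h' => simp only [map_add, AddMonoidHom.add_apply, h, h']
  | htprod x g =>
    rw [capChain_tprod, psiChain_mk, psiChain_mk, bottom_mk, phi_mk, TA.mk_balance, TA.ract_mk,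
      (cocycle_zero_apply k A t _ ht).1, Bar.aug_tprod, Bar.aug_tprod, Bar.aug_tprod]
    have e0 : front (n := 0) (m := 0) (p := 0) rfl g 0 = g 0 := rfl
    have e1 : front (n := 0) (m := 0) (p := 0) rfl g 1 = 1 := rfl
    have e2 : back (n := 0) (m := 0) (p := 0) rfl g 0 = 1 := rfl
    have e3 : back (n := 0) (m := 0) (p := 0) rfl g 1 = g 1 := rfl
    have h1 := (phi k A M (Cohomology.mk k A t ht)).2 (g 1)
    rw [phi_mk] at h1
    rw [e0, e1, e2, e3, mul_one, one_mul, lact_mul, h1, ract_lact, lact_ract]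

/-! ### Compatibility of the cap product with the connecting homomorphisms -/

variable [Module.Projective k A]
variable {N₁ N₂ N₃ : Type*} [AddCommGroup N₁] [Module (Env k A) N₁]
    [AddCommGroup N₂] [Module (Env k A) N₂] [AddCommGroup N₃] [Module (Env k A) N₃]
variable {M₁ M₂ M₃ : Type*} [AddCommGroup M₁] [Module (Env k A) M₁]
    [AddCommGroup M₂] [Module (Env k A) M₂] [AddCommGroup M₃] [Module (Env k A) M₃]

/-- `Homology.δ_mk` evaluates δ once a lift is at hand; this supplies a lift y and the resulting
cycle z, which can then be capped with a cochain. -/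
lemma Homology.δ_eq {f : N₁ →ₗ[Env k A] N₂} {g : N₂ →ₗ[Env k A] N₃}
    (h : IsShortExact k A f g) (n : ℕ) (x : Chain k A N₃ (n + 1))
    (hx : x ∈ cycles k A N₃ (n + 1)) :
    ∃ (y : Chain k A N₂ (n + 1)) (z : Chain k A N₁ n) (hz : z ∈ cycles k A N₁ n),
      chainMap k A g (n + 1) y = x ∧ chainMap k A f n z = chainD k A N₂ n y ∧
        Homology.δ k A h n (Homology.mk k A x hx) = Homology.mk k A z hz := by
  have hx' : chainD k A N₃ n x = 0 := hx
  obtain ⟨y, hy⟩ := TAe.map_surjective k A (P := Bar k A (n + 1)) g h.surjective x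
  have hy : chainMap k A g (n + 1) y = x := hy
  obtain ⟨z, hz⟩ := (TAe.map_exact k A (P := Bar k A n) f g h.exact (chainD k A N₂ n y)).1
    ((chainMap_chainD k A g n y).trans (by rw [hy, hx']))
  have hz : chainMap k A f n z = chainD k A N₂ n y := hz
  have hzc : z ∈ cycles k A N₁ n := by
    cases n with
    | zero => trivial
    | succ n =>
      refine TAe.map_injective k A (P := Bar k A n) f h.injective ?_
      refine (chainMap_chainD k A f n z).trans ?_
      rw [hz, chainD_chainD, map_zero]
  exact ⟨y, z, hzc, hy, hz, Homology.δ_mk k A h n x hx y z hzc hy hz⟩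

lemma Cohomology.δ_eq {f : M₁ →ₗ[Env k A] M₂} {g : M₂ →ₗ[Env k A] M₃}
    (h : IsShortExact k A f g) (m : ℕ) (x : Cochain k A M₃ m) (hx : x ∈ cocycles k A M₃ m) :
    ∃ (y : Cochain k A M₂ m) (z : Cochain k A M₁ (m + 1)) (hz : z ∈ cocycles k A M₁ (m + 1)),
      cochainMap k A g m y = x ∧ cochainMap k A f (m + 1) z = cochainD k A M₂ m y ∧
        Cohomology.δ k A h m (Cohomology.mk k A x hx) = Cohomology.mk k A z hz := by
  have hx' : cochainD k A M₃ m x = 0 := hx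
  obtain ⟨y, hy⟩ := Module.projective_lifting_property g x h.surjective
  have hy : cochainMap k A g m y = x := hy
  obtain ⟨z, hz⟩ := cochainMap_lift k A h (m + 1) (cochainD k A M₂ m y)
    (by rw [cochainMap_cochainD, hy, hx'])
  have hzc : z ∈ cocycles k A M₁ (m + 1) := by
    refine cochainMap_injective k A h.injective _ ?_
    rw [cochainMap_cochainD, hz, cochainD_cochainD, map_zero]
  exact ⟨y, z, hzc, hy, hz, Cohomology.δ_mk k A h m x hx y z hzc hy hz⟩

/-- If y lifts x, then y ∩ t lifts x ∩ t. Since t is a cocycle, d(y ∩ t) = (-1)^m (dy) ∩ t. -/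
lemma δ_capAdd_left {n m p : ℕ} (h : n = p + m) {f : N₁ →ₗ[Env k A] N₂}
    {g : N₂ →ₗ[Env k A] N₃} (hfg : IsShortExact k A f g)
    (hfgM : IsShortExact k A (TA.map k A f (LinearMap.id : M →ₗ[Env k A] M))
      (TA.map k A g (LinearMap.id : M →ₗ[Env k A] M)))
    (γ : Homology k A N₃ (n + 1)) (ε : Cohomology k A M m) :
    Homology.δ k A hfgM p (capAdd k (by omega) ε γ) =
      (-1 : ℤ) ^ m • capAdd k h ε (Homology.δ k A hfg n γ) := by
  obtain ⟨x, hx, rfl⟩ := Homology.mk_surjective k A γ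
  obtain ⟨t, ht, rfl⟩ := Cohomology.mk_surjective k A ε
  obtain ⟨y, z, hz, rfl, hzy, e⟩ := Homology.δ_eq k hfg n x hx
  rw [e, capAdd_mk, capAdd_mk, Homology.zsmul_mk]
  refine Homology.δ_mk k A hfgM p _ _ (capChain k (by omega) t y) _ _
    (capChain_chainMap k (by omega) t g y).symm ?_
  rw [map_zsmul, ← capChain_chainMap, hzy, chainD_capChain k h t ht]

/-- If y is a cochain lifting t, then x ∩ y lifts x ∩ t. Here y need not be a cocycle, but dx = 0,
so the other two terms of the Leibniz formula give d(x ∩ y) = (-1)^{m+1} x ∩ (y d). -/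
lemma δ_capAdd_right {n m p : ℕ} (h : n = p + (m + 1)) {f : M₁ →ₗ[Env k A] M₂}
    {g : M₂ →ₗ[Env k A] M₃} (hfg : IsShortExact k A f g)
    (hNfg : IsShortExact k A (TA.map k A (LinearMap.id : N →ₗ[Env k A] N) f)
      (TA.map k A (LinearMap.id : N →ₗ[Env k A] N) g))
    (γ : Homology k A N n) (ε : Cohomology k A M₃ m) :
    Homology.δ k A hNfg p (capAdd k (by omega) ε γ) =
      (-1 : ℤ) ^ (m + 1) • capAdd k h (Cohomology.δ k A hfg m ε) γ := by
  obtain ⟨x, hx, rfl⟩ := Homology.mk_surjective k A γ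
  obtain ⟨t, ht, rfl⟩ := Cohomology.mk_surjective k A ε
  obtain ⟨y, z, hz, rfl, hzy, e⟩ := Cohomology.δ_eq k hfg m t ht
  rw [e, capAdd_mk, capAdd_mk, Homology.zsmul_mk]
  refine Homology.δ_mk k A hNfg p _ _ (capChain k (by omega) y x) _ _
    (capChain_cochainMap k (by omega) y g x).symm ?_
  obtain ⟨n, rfl⟩ : ∃ n', n = n' + 1 := ⟨p + m, by omega⟩
  have hx : chainD k A N n x = 0 := hx
  have h1 := capChain_chainD k (by omega : n = p + m) y x
  rw [hx, map_zero] at h1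
  rw [map_zsmul, ← capChain_cochainMap, hzy, eq_neg_of_add_eq_zero_left h1.symm, pow_succ,
    mul_neg_one, neg_smul, smul_neg, neg_neg, smul_smul, ← mul_pow]
  simp

end CapHomology

/-! ### Associativity of `⊗_A` and split short exact sequences -/

section TASplit

variable (k : Type u) {A : Type v} [CommRing k] [Ring A] [Algebra k A]
variable {N M P : Type*} [AddCommGroup N] [Module (Env k A) N] [AddCommGroup M] [Module (Env k A) M]
  [AddCommGroup P] [Module (Env k A) P]

/-- The map `y ↦ p ↦ x ⊗ (y ⊗ p)`, as a map of `x ⊗ y`. -/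
def TA.assocAux : TA k A N M →+ P →+ TA k A N (TA k A M P) :=
  Balanced.lift
    (AddMonoidHom.mk' (fun x => AddMonoidHom.mk' (fun y => AddMonoidHom.mk'
          (fun p => TA.mk k A x (TA.mk k A y p))
          (fun p p' => by rw [TA.mk_add_right, TA.mk_add_right]))
        (fun y y' => AddMonoidHom.ext fun p => by
          simp only [AddMonoidHom.mk'_apply, AddMonoidHom.add_apply, TA.mk_add_right,
            TA.mk_add_left]))
      (fun x x' => AddMonoidHom.ext fun y => AddMonoidHom.ext fun p => by
        simp only [AddMonoidHom.mk'_apply, AddMonoidHom.add_apply, TA.mk_add_left]))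
    (fun a x y => AddMonoidHom.ext fun p => by
      simp only [AddMonoidHom.mk'_apply]
      rw [TA.mk_balance, TA.lact_mk])

/-- The additive map `(x ⊗ y) ⊗ p ↦ x ⊗ (y ⊗ p)`. -/
def TA.assocAdd : TA k A (TA k A N M) P →+ TA k A N (TA k A M P) :=
  Balanced.lift (TA.assocAux k) (fun a z p => by
    induction z using TA.induction with
    | h0 => simp only [map_zero, AddMonoidHom.zero_apply]
    | hadd z z' h h' => simp only [map_add, AddMonoidHom.add_apply, h, h']
    | hmk x y =>
      rw [TA.ract_mk]
      change TA.mk k A x (TA.mk k A _ _) = TA.mk k A x (TA.mk k A _ _)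
      rw [TA.mk_balance])

lemma TA.assocAdd_mk (x : N) (y : M) (p : P) :
    TA.assocAdd k (TA.mk k A (TA.mk k A x y) p) = TA.mk k A x (TA.mk k A y p) := rfl

@[elab_as_elim]
lemma TA.induction_left {q : TA k A (TA k A N M) P → Prop} (z : TA k A (TA k A N M) P) (h0 : q 0)
    (hmk : ∀ x y p, q (TA.mk k A (TA.mk k A x y) p)) (hadd : ∀ z z', q z → q z' → q (z + z')) :
    q z := by
  induction z using TA.induction with
  | h0 => exact h0
  | hadd z z' h h' => exact hadd z z' h h'
  | hmk z p =>
    induction z using TA.induction with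
    | h0 => rwa [TA.mk_zero_left]
    | hadd z z' h h' => rw [TA.mk_add_left]; exact hadd _ _ h h'
    | hmk x y => exact hmk x y p

@[elab_as_elim]
lemma TA.induction_right {q : TA k A N (TA k A M P) → Prop} (z : TA k A N (TA k A M P))
    (h0 : q 0) (hmk : ∀ x y p, q (TA.mk k A x (TA.mk k A y p)))
    (hadd : ∀ z z', q z → q z' → q (z + z')) : q z := by
  induction z using TA.induction with
  | h0 => exact h0
  | hadd z z' h h' => exact hadd z z' h h'
  | hmk x z =>
    induction z using TA.induction with
    | h0 => rwa [TA.mk_zero_right]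
    | hadd z z' h h' => rw [TA.mk_add_right]; exact hadd _ _ h h'
    | hmk y p => exact hmk x y p

/-- The bimodule map `(N ⊗_A M) ⊗_A P → N ⊗_A (M ⊗_A P)`. -/
def TA.assoc : TA k A (TA k A N M) P →ₗ[Env k A] TA k A N (TA k A M P) :=
  homOfActs k (TA.assocAdd k)
    (fun a z => by
      induction z using TA.induction_left with
      | h0 => simp only [map_zero]
      | hadd z z' h h' => simp only [map_add, h, h']
      | hmk x y p =>
        rw [TA.lact_mk, TA.lact_mk, TA.assocAdd_mk, TA.assocAdd_mk, TA.lact_mk])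
    (fun a z => by
      induction z using TA.induction_left with
      | h0 => simp only [map_zero]
      | hadd z z' h h' => simp only [map_add, h, h']
      | hmk x y p =>
        rw [TA.ract_mk, TA.assocAdd_mk, TA.assocAdd_mk, TA.ract_mk, TA.ract_mk])

/-- The map `y ⊗ p ↦ (x ⊗ y) ⊗ p`. -/
def TA.assocSymmAux (x : N) : TA k A M P →+ TA k A (TA k A N M) P :=
  Balanced.lift
    (AddMonoidHom.mk' (fun y => AddMonoidHom.mk' (fun p => TA.mk k A (TA.mk k A x y) p)
        (fun p p' => TA.mk_add_right k A _ _ _))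
      (fun y y' => AddMonoidHom.ext fun p => by
        simp only [AddMonoidHom.mk'_apply, AddMonoidHom.add_apply, TA.mk_add_right,
          TA.mk_add_left]))
    (fun a y p => by
      simp only [AddMonoidHom.mk'_apply]
      rw [← TA.mk_balance, TA.ract_mk])

lemma TA.assocSymmAux_mk (x : N) (y : M) (p : P) :
    TA.assocSymmAux k x (TA.mk k A y p) = TA.mk k A (TA.mk k A x y) p := rfl

/-- The additive map `x ⊗ (y ⊗ p) ↦ (x ⊗ y) ⊗ p`. -/
def TA.assocSymmAdd : TA k A N (TA k A M P) →+ TA k A (TA k A N M) P :=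
  Balanced.lift
    (AddMonoidHom.mk' (TA.assocSymmAux k) (fun x x' => TA.hom_ext k A fun y p => by
      rw [AddMonoidHom.add_apply, TA.assocSymmAux_mk, TA.assocSymmAux_mk, TA.assocSymmAux_mk,
        TA.mk_add_left, TA.mk_add_left]))
    (fun a x z => by
      change TA.assocSymmAux k (ract k a x) z = TA.assocSymmAux k x (lact k a z)
      induction z using TA.induction with
      | h0 => simp only [map_zero]
      | hadd z z' h h' => simp only [map_add, h, h']
      | hmk y p => rw [TA.lact_mk, TA.assocSymmAux_mk, TA.assocSymmAux_mk, TA.mk_balance])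

lemma TA.assocSymmAdd_mk (x : N) (y : M) (p : P) :
    TA.assocSymmAdd k (TA.mk k A x (TA.mk k A y p)) = TA.mk k A (TA.mk k A x y) p := rfl

/-- The bimodule map `N ⊗_A (M ⊗_A P) → (N ⊗_A M) ⊗_A P`. -/
def TA.assocSymm : TA k A N (TA k A M P) →ₗ[Env k A] TA k A (TA k A N M) P :=
  homOfActs k (TA.assocSymmAdd k)
    (fun a z => by
      induction z using TA.induction_right with
      | h0 => simp only [map_zero]
      | hadd z z' h h' => simp only [map_add, h, h']
      | hmk x y p =>
        rw [TA.lact_mk, TA.assocSymmAdd_mk, TA.assocSymmAdd_mk, TA.lact_mk, TA.lact_mk])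
    (fun a z => by
      induction z using TA.induction_right with
      | h0 => simp only [map_zero]
      | hadd z z' h h' => simp only [map_add, h, h']
      | hmk x y p =>
        rw [TA.ract_mk, TA.ract_mk, TA.assocSymmAdd_mk, TA.assocSymmAdd_mk, TA.ract_mk])

/-- One composite suffices: it exhibits the homology with coefficients (N ⊗ M) ⊗ P as a retract of
that with coefficients N ⊗ (M ⊗ P), so vanishing passes over. -/
lemma TA.assocSymm_comp_assoc :
    TA.assocSymm k ∘ₗ TA.assoc k = (LinearMap.id : TA k A (TA k A N M) P →ₗ[Env k A] _) :=
  LinearMap.ext fun z => by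
    induction z using TA.induction_left with
    | h0 => simp only [map_zero]
    | hadd z z' h h' => simp only [map_add, h, h']
    | hmk x y p => rfl

variable {N₁ N₂ N₃ : Type*} [AddCommGroup N₁] [Module (Env k A) N₁]
    [AddCommGroup N₂] [Module (Env k A) N₂] [AddCommGroup N₃] [Module (Env k A) N₃]

variable (M) in
/-- A short exact sequence of bimodules which splits as a sequence of right modules stays exact
under `- ⊗_A M`. -/
lemma IsShortExact.map_left_of_section {f : N₁ →ₗ[Env k A] N₂} {g : N₂ →ₗ[Env k A] N₃}
    (h : IsShortExact k A f g) (s : N₃ →+ N₂) (hs : ∀ x, g (s x) = x)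
    (hsr : ∀ (a : A) x, s (ract k a x) = ract k a (s x)) :
    IsShortExact k A (TA.map k A f (LinearMap.id : M →ₗ[Env k A] M))
      (TA.map k A g (LinearMap.id : M →ₗ[Env k A] M)) := by
  -- The section yields the complementary retraction: y - s(g y) lies in the image of f. Since f is
  -- injective, the retraction inherits additivity and right linearity from s.
  have hr : ∀ y, ∃ x, f x = y - s (g y) := fun y => (h.exact _).1 (by rw [map_sub, hs, sub_self])
  choose r hr using hr
  have hgf : ∀ x, g (f x) = 0 := fun x => (h.exact _).2 ⟨x, rfl⟩
  let r' : N₂ →+ N₁ := AddMonoidHom.mk' r fun y y' => h.injective (by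
    rw [map_add, hr, hr, hr, map_add, map_add]; abel)
  have hrr : ∀ (a : A) x, r' (ract k a x) = ract k a (r' x) := fun a x => h.injective (by
    change f (r _) = f (ract k a (r x))
    rw [hr, map_ract, hsr, map_ract, hr, map_sub])
  have hrf : ∀ x, r' (f x) = x := fun x => h.injective (by
    change f (r _) = _
    rw [hr, hgf, map_zero, sub_zero])
  let R : TA k A N₂ M →+ TA k A N₁ M :=
    Balanced.map r' (AddMonoidHom.id M) hrr (fun _ _ => rfl)
  let S : TA k A N₃ M →+ TA k A N₂ M :=
    Balanced.map s (AddMonoidHom.id M) hsr (fun _ _ => rfl)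
  have hR : ∀ x y, R (TA.mk k A x y) = TA.mk k A (r' x) y := fun _ _ => rfl
  have hS : ∀ x y, S (TA.mk k A x y) = TA.mk k A (s x) y := fun _ _ => rfl
  refine ⟨Function.LeftInverse.injective (g := R) fun z => ?_, fun z => ⟨fun hz => ⟨R z, ?_⟩, ?_⟩,
    Function.RightInverse.surjective (g := S) fun z => ?_⟩
  · induction z using TA.induction with
    | h0 => simp only [map_zero]
    | hadd z z' h h' => simp only [map_add, h, h']
    | hmk x y => rw [TA.map_mk, hR, hrf, LinearMap.id_apply]
  -- The splitting f r + s g = id survives the tensor product, and it gives exactness in the middle.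
  · have key : ∀ z, TA.map k A f (LinearMap.id : M →ₗ[Env k A] M) (R z) =
        z - S (TA.map k A g (LinearMap.id : M →ₗ[Env k A] M) z) := fun z => by
      induction z using TA.induction with
      | h0 => simp only [map_zero, sub_zero]
      | hadd z z' h h' => simp only [map_add, h, h']; abel
      | hmk x y =>
        rw [TA.map_mk, hR, TA.map_mk, hS, eq_sub_iff_add_eq, LinearMap.id_apply, ← TA.mk_add_left]
        change TA.mk k A (f (r x) + _) y = _
        rw [hr, sub_add_cancel]
    rw [key, hz, map_zero, sub_zero]
  · rintro ⟨y, rfl⟩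
    induction y using TA.induction with
    | h0 => simp only [map_zero]
    | hadd z z' h h' => rw [map_add, map_add, h, h', add_zero]
    | hmk x y => rw [TA.map_mk, TA.map_mk, hgf, TA.mk_zero_left]
  · induction z using TA.induction with
    | h0 => simp only [map_zero]
    | hadd z z' h h' => simp only [map_add, h, h']
    | hmk x y => rw [hS, TA.map_mk, hs, LinearMap.id_apply]

variable (M) in
/-- A short exact sequence of bimodules which splits as a sequence of left modules stays exact
under `M ⊗_A -`. -/
lemma IsShortExact.map_right_of_retraction {f : N₁ →ₗ[Env k A] N₂} {g : N₂ →ₗ[Env k A] N₃}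
    (h : IsShortExact k A f g) (r : N₂ →+ N₁) (hr : ∀ x, r (f x) = x)
    (hrl : ∀ (a : A) x, r (lact k a x) = lact k a (r x)) :
    IsShortExact k A (TA.map k A (LinearMap.id : M →ₗ[Env k A] M) f)
      (TA.map k A (LinearMap.id : M →ₗ[Env k A] M) g) := by
  have hgf : ∀ x, g (f x) = 0 := fun x => (h.exact _).2 ⟨x, rfl⟩
  -- The section is defined by the preimage that r kills. By `huniq` an element is determined by its
  -- images under g and r, so the section is additive and left linear.
  have hs : ∀ x, ∃ y, g y = x ∧ r y = 0 := fun x => by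
    obtain ⟨y, rfl⟩ := h.surjective x
    exact ⟨y - f (r y), by rw [map_sub, hgf, sub_zero], by rw [map_sub, hr, sub_self]⟩
  choose s hs hrs using hs
  have huniq : ∀ y y', g y = g y' → r y = r y' → y = y' := fun y y' h1 h2 => by
    obtain ⟨x, hx⟩ := (h.exact (y - y')).1 (by rw [map_sub, h1, sub_self])
    have h3 : x = 0 := by rw [← hr x, hx, map_sub, h2, sub_self]
    rw [h3, map_zero] at hx
    exact sub_eq_zero.1 hx.symm
  let s' : N₃ →+ N₂ := AddMonoidHom.mk' s fun x x' => huniq _ _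
    (by rw [map_add, hs, hs, hs]) (by rw [map_add, hrs, hrs, hrs, add_zero])
  have hsl : ∀ (a : A) x, s' (lact k a x) = lact k a (s' x) := fun a x => huniq _ _
    (by change g (s _) = g (lact k a (s x)); rw [map_lact, hs, hs])
    (by change r (s _) = r (lact k a (s x)); rw [hrl, hrs, hrs, map_zero])
  have hdec : ∀ y, f (r y) + s' (g y) = y := fun y => huniq _ _
    (by rw [map_add, hgf, zero_add]; exact hs _)
    (by rw [map_add, hr, add_eq_left]; exact hrs _)
  let R : TA k A M N₂ →+ TA k A M N₁ :=
    Balanced.map (AddMonoidHom.id M) r (fun _ _ => rfl) hrl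
  let S : TA k A M N₃ →+ TA k A M N₂ :=
    Balanced.map (AddMonoidHom.id M) s' (fun _ _ => rfl) hsl
  have hR : ∀ x y, R (TA.mk k A x y) = TA.mk k A x (r y) := fun _ _ => rfl
  have hS : ∀ x y, S (TA.mk k A x y) = TA.mk k A x (s' y) := fun _ _ => rfl
  refine ⟨Function.LeftInverse.injective (g := R) fun z => ?_, fun z => ⟨fun hz => ⟨R z, ?_⟩, ?_⟩,
    Function.RightInverse.surjective (g := S) fun z => ?_⟩
  · induction z using TA.induction with
    | h0 => simp only [map_zero]
    | hadd z z' h h' => simp only [map_add, h, h']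
    | hmk x y => rw [TA.map_mk, hR, hr, LinearMap.id_apply]
  · have key : ∀ z, TA.map k A (LinearMap.id : M →ₗ[Env k A] M) f (R z) =
        z - S (TA.map k A (LinearMap.id : M →ₗ[Env k A] M) g z) := fun z => by
      induction z using TA.induction with
      | h0 => simp only [map_zero, sub_zero]
      | hadd z z' h h' => simp only [map_add, h, h']; abel
      | hmk x y =>
        rw [TA.map_mk, hR, TA.map_mk, hS, eq_sub_iff_add_eq, LinearMap.id_apply,
          ← TA.mk_add_right, hdec]
    rw [key, hz, map_zero, sub_zero]
  · rintro ⟨y, rfl⟩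
    induction y using TA.induction with
    | h0 => simp only [map_zero]
    | hadd z z' h h' => rw [map_add, map_add, h, h', add_zero]
    | hmk x y => rw [TA.map_mk, TA.map_mk, hgf, TA.mk_zero_right]
  · induction z using TA.induction with
    | h0 => simp only [map_zero]
    | hadd z z' h h' => simp only [map_add, h, h']
    | hmk x y =>
      rw [hS, TA.map_mk, LinearMap.id_apply]
      exact congrArg _ (hs y)

end TASplit

/-! ### The left linear contraction of the bar resolution -/

section Contraction

variable (k : Type u) (A : Type v) [CommRing k] [Ring A] [Algebra k A]

/-- All faces but the last leave the appended 1 alone; the last one absorbs it and returns w. -/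
lemma tensorD_tensorT (n : ℕ) (w : ⨂[k] (_ : Fin (n + 2)), A) :
    tensorD k A (n + 1) (tensorT k A (n + 2) w) =
      tensorT k A (n + 1) (tensorD k A n w) + (-1 : k) ^ (n + 1) • w := by
  refine LinearMap.congr_fun (f := tensorD k A (n + 1) ∘ₗ tensorT k A (n + 2))
    (g := tensorT k A (n + 1) ∘ₗ tensorD k A n + (-1 : k) ^ (n + 1) • LinearMap.id)
    (tensor_hom_ext k A fun g => ?_) w
  simp only [LinearMap.comp_apply, LinearMap.add_apply, LinearMap.smul_apply, LinearMap.id_apply,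
    tensorT_tprod, tensorD_tprod, map_sum, map_smul]
  rw [Fin.sum_univ_castSucc]
  congr 1
  · refine Finset.sum_congr rfl fun j _ => ?_
    rw [Fin.val_castSucc]
    congr 2
    ext i
    simp only [Fin.contractNth, Fin.snoc, Fin.val_castSucc, Fin.val_succ, cast_eq, Fin.castLT,
      Fin.castSucc_mk, Fin.succ_mk]
    grind
  · rw [Fin.val_last]
    congr 2
    ext i
    simp only [Fin.contractNth, Fin.snoc, Fin.val_castSucc, Fin.val_succ, cast_eq, Fin.castLT,
      Fin.val_last]
    grind

/-- The map `w ↦ w ⊗ 1` on the bar resolution. -/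
def Bar.T (n : ℕ) : Bar k A n →+ Bar k A (n + 1) :=
  AddMonoidHomClass.toAddMonoidHom (tensorT k A (n + 2))

lemma Bar.T_tprod (n : ℕ) (g : Fin (n + 2) → A) :
    Bar.T k A n (Bar.tprod k A g) = Bar.tprod k A (Fin.snoc (α := fun _ => A) g 1) :=
  tensorT_tprod k A (n + 2) g

/-- Appending a 1 on the right does not disturb the left action. Hence the contraction induces maps
on X ⊗_A Bar(A), and on left linear maps out of Bar(A). -/
lemma Bar.T_lact {n : ℕ} (a : A) (w : Bar k A n) :
    Bar.T k A n (lact k a w) = lact k a (Bar.T k A n w) := by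
  induction w using Bar.induction' with
  | hadd w w' h h' => simp only [map_add, h, h']
  | htprod g =>
    rw [Bar.lact_tprod, Bar.T_tprod, Bar.T_tprod, Bar.lact_tprod]
    congr 1
    ext i
    simp only [Fin.snoc, Function.update_apply, Fin.ext_iff, Fin.val_zero, cast_eq, Fin.castLT]
    grind

lemma Bar.d_T (n : ℕ) (w : Bar k A (n + 1)) :
    Bar.d k A (n + 1) (Bar.T k A (n + 1) w) =
      Bar.T k A n (Bar.d k A n w) + (-1 : ℤ) ^ (n + 2) • w := by
  rw [← neg_one_pow_smul_eq k]
  exact tensorD_tensorT k A (n + 1) w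

end Contraction

/-! ### Acyclicity of `A^e ⊗_A X` -/

section Acyclic

variable (k : Type u) {A : Type v} [CommRing k] [Ring A] [Algebra k A]
variable {X P P' : Type*} [AddCommGroup X] [Module (Env k A) X] [AddCommGroup P]
  [Module (Env k A) P] [AddCommGroup P'] [Module (Env k A) P']

lemma lact_env (a b : A) (c : Aᵐᵒᵖ) :
    lact k a (b ⊗ₜ[k] c : Env k A) = (a * b) ⊗ₜ[k] c := by
  rw [lact_apply, smul_eq_mul, Algebra.TensorProduct.tmul_mul_tmul, one_mul]

lemma ract_env (a b : A) (c : Aᵐᵒᵖ) :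
    ract k a (b ⊗ₜ[k] c : Env k A) = b ⊗ₜ[k] (MulOpposite.op a * c) := by
  rw [ract_apply, smul_eq_mul, Algebra.TensorProduct.tmul_mul_tmul, one_mul]

/-- The map `x ⊗ p ↦ ((1 ⊗ 1) ⊗ x) ⊗ p`. -/
def freeTAe : TA k A X P →+ TAe k A (TA k A (Env k A) X) P :=
  Balanced.lift
    (AddMonoidHom.mk' (fun x => AddMonoidHom.mk' (fun p => TAe.mk k A (TA.mk k A 1 x) p)
        (fun p p' => TAe.mk_add_right k A _ _ _))
      (fun y y' => AddMonoidHom.ext fun p => by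
        simp only [AddMonoidHom.mk'_apply, AddMonoidHom.add_apply, TA.mk_add_right,
          TAe.mk_add_left]))
    (fun a x p => by
      have h := TAe.balance k A a 1 (TA.mk k A (1 : Env k A) x) p
      rw [lact_one, ract_one, TA.ract_mk] at h
      exact h)

lemma freeTAe_mk (x : X) (p : P) :
    freeTAe k (TA.mk k A x p) = TAe.mk k A (TA.mk k A 1 x) p := rfl

/-- In ((a ⊗ b) ⊗ x) ⊗ p the factor b crosses ⊗_A to act on x from the left, and a goes around
⊗_{A^e} to act on p from the right, which leaves ((1 ⊗ 1) ⊗ bx) ⊗ pa. -/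
lemma freeTAe_surjective : Function.Surjective (freeTAe k : TA k A X P →+ _) := by
  intro z
  induction z using TAe.induction with
  | h0 => exact ⟨0, map_zero _⟩
  | hadd z z' h h' =>
    obtain ⟨y, rfl⟩ := h
    obtain ⟨y', rfl⟩ := h'
    exact ⟨y + y', map_add _ _ _⟩
  | hmk z p =>
    induction z using TA.induction with
    | h0 => exact ⟨0, by rw [map_zero, TAe.mk_zero_left]⟩
    | hadd z z' h h' =>
      obtain ⟨y, hy⟩ := h
      obtain ⟨y', hy'⟩ := h'
      exact ⟨y + y', by rw [map_add, hy, hy', TAe.mk_add_left]⟩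
    | hmk e x =>
      induction e using TensorProduct.induction_on with
      | zero => exact ⟨0, by rw [map_zero, TA.mk_zero_left, TAe.mk_zero_left]⟩
      | add e e' h h' =>
        obtain ⟨y, hy⟩ := h
        obtain ⟨y', hy'⟩ := h'
        exact ⟨y + y', by rw [map_add, hy, hy', TA.mk_add_left, TAe.mk_add_left]⟩
      | tmul a b =>
        refine ⟨TA.mk k A (lact k b.unop x) (ract k a p), ?_⟩
        have h1 := TAe.balance k A 1 a (TA.mk k A (ract k b.unop (1 : Env k A)) x) p
        rw [lact_one, ract_one] at h1
        rw [freeTAe_mk, ← TA.mk_balance, ← h1, TA.lact_mk, Algebra.TensorProduct.one_def,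
          ract_env, lact_env, mul_one, mul_one, MulOpposite.op_unop]

lemma envSwap_one : envSwap k A 1 = 1 := rfl

/-- The map `e ⊗ x ↦ p ↦ e (x ⊗ p)`, where `e = a ⊗ b` acts by `x ⊗ p ↦ b x ⊗ p a`. -/
def freeTAeInvAux : TA k A (Env k A) X →+ P →+ TA k A X P :=
  Balanced.lift
    (AddMonoidHom.mk' (fun e => AddMonoidHom.mk' (fun x => AddMonoidHom.mk'
          (fun p => envSwap k A e • TA.mk k A x p)
          (fun p p' => by rw [TA.mk_add_right, smul_add]))
        (fun y y' => AddMonoidHom.ext fun p => by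
          simp only [AddMonoidHom.mk'_apply, AddMonoidHom.add_apply, TA.mk_add_left, smul_add]))
      (fun x x' => AddMonoidHom.ext fun y => AddMonoidHom.ext fun p => by
        simp only [AddMonoidHom.mk'_apply, AddMonoidHom.add_apply, map_add, add_smul]))
    (fun a e x => AddMonoidHom.ext fun p => by
      change envSwap k A (ract k a e) • TA.mk k A x p = envSwap k A e • TA.mk k A (lact k a x) p
      rw [ract_apply, smul_eq_mul, envSwap_mul, mul_smul, envSwap_tmul, ← TA.lact_mk]
      rfl)

lemma freeTAeInvAux_mk (e : Env k A) (x : X) (p : P) :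
    freeTAeInvAux k (TA.mk k A e x) p = envSwap k A e • TA.mk k A x p := rfl

/-- The inverse of `freeTAe`. -/
def freeTAeInv : TAe k A (TA k A (Env k A) X) P →+ TA k A X P :=
  Balanced.lift (freeTAeInvAux k) (fun i z p => by
    change freeTAeInvAux k (lact k i.2 (ract k i.1 z)) p =
      freeTAeInvAux k z (lact k i.1 (ract k i.2 p))
    induction z using TA.induction with
    | h0 => simp only [map_zero, AddMonoidHom.zero_apply]
    | hadd z z' h h' => simp only [map_add, AddMonoidHom.add_apply, h, h']
    | hmk e x =>
      rw [TA.ract_mk, TA.lact_mk, freeTAeInvAux_mk, freeTAeInvAux_mk, lact_apply, smul_eq_mul,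
        envSwap_mul, mul_smul, envSwap_tmul, ← TA.mk_balance, ← TA.ract_mk]
      rfl)

/-- Together with surjectivity and `map_freeTAe` this identifies the Hochschild complex of A^e ⊗_A X
with X ⊗_A Bar(A). -/
lemma freeTAeInv_freeTAe (z : TA k A X P) : freeTAeInv k (freeTAe k z) = z := by
  induction z using TA.induction with
  | h0 => simp only [map_zero]
  | hadd z z' h h' => simp only [map_add, h, h']
  | hmk x p =>
    change envSwap k A 1 • TA.mk k A x p = _
    rw [envSwap_one, one_smul]

lemma map_freeTAe (f : P →ₗ[Env k A] P') (z : TA k A X P) :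
    TAe.map k A LinearMap.id f (freeTAe k z) = freeTAe k (TA.map k A LinearMap.id f z) := by
  induction z using TA.induction with
  | h0 => simp only [map_zero]
  | hadd z z' h h' => simp only [map_add, h, h']
  | hmk x p => rfl

/-- The complex is X ⊗_A Bar(A), and id ⊗ (w ↦ w ⊗ 1) contracts it in positive degrees. -/
lemma Homology.eq_zero_of_env {n : ℕ} (c : Homology k A (TA k A (Env k A) X) (n + 1)) : c = 0 := by
  obtain ⟨x, hx, rfl⟩ := Homology.mk_surjective k A c
  refine Subquotient.mk_eq_mk (hx' := AddSubgroup.zero_mem _) |>.2 ?_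
  rw [sub_zero]
  obtain ⟨y, rfl⟩ := freeTAe_surjective k x
  have hx : TAe.map k A LinearMap.id (Bar.d k A n) (freeTAe k y) = 0 := hx
  rw [map_freeTAe] at hx
  have hy : TA.map k A (LinearMap.id : X →ₗ[Env k A] X) (Bar.d k A n) y = 0 := by
    rw [← freeTAeInv_freeTAe k (TA.map k A _ _ y), hx, map_zero]
  -- Well defined on X ⊗_A Bar(A) because w ↦ w ⊗ 1 is left linear.
  let T : ∀ q, TA k A X (Bar k A q) →+ TA k A X (Bar k A (q + 1)) := fun q =>
    Balanced.map (AddMonoidHom.id X) (Bar.T k A q) (fun _ _ => rfl) (fun a w => Bar.T_lact k A a w)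
  have hT : ∀ q x w, T q (TA.mk k A x w) = TA.mk k A x (Bar.T k A q w) := fun _ _ _ => rfl
  have key : ∀ y, TA.map k A (LinearMap.id : X →ₗ[Env k A] X) (Bar.d k A (n + 1)) (T (n + 1) y) =
      T n (TA.map k A (LinearMap.id : X →ₗ[Env k A] X) (Bar.d k A n) y) +
        (-1 : ℤ) ^ (n + 2) • y := fun y => by
    induction y using TA.induction with
    | h0 => simp only [map_zero, smul_zero, add_zero]
    | hadd z z' h h' => simp only [map_add, h, h', smul_add]; abel
    | hmk x w =>
      rw [TA.map_mk, hT, TA.map_mk, hT, Bar.d_T, TA.mk_add_right, TA.mk_zsmul_right]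
      rfl
  rw [← neg_one_pow_smul_mem (n + 2)]
  refine ⟨freeTAe k (T (n + 1) y), ?_⟩
  rw [chainD, map_freeTAe, key, hy, map_zero, zero_add, map_zsmul]

/-- The free cover of N is tensored with M before its homology is taken; by associativity the result
is again of the form A^e ⊗_A X, with X = N ⊗_A M. -/
lemma Homology.eq_zero_of_env_tensor {N M : Type*} [AddCommGroup N] [Module (Env k A) N]
    [AddCommGroup M] [Module (Env k A) M] {n : ℕ}
    (c : Homology k A (TA k A (TA k A (Env k A) N) M) (n + 1)) : c = 0 := by
  rw [← Homology.map_id k A _ (n + 1) c, ← TA.assocSymm_comp_assoc, Homology.map_comp,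
    Homology.eq_zero_of_env k (Homology.map k A (TA.assoc k) (n + 1) c), map_zero]

end Acyclic

/-! ### Dimension shifting for homology -/

section ShiftHomology

variable (k : Type u) {A : Type v} [CommRing k] [Ring A] [Algebra k A]
variable (N : Type*) [AddCommGroup N] [Module (Env k A) N]

variable (A) in
/-- The map `a ⊗ b ↦ a b`. -/
def envMul : Env k A →ₗ[k] A :=
  TensorProduct.lift ((LinearMap.mul k A).compl₂ (MulOpposite.opLinearEquiv k).symm.toLinearMap)

lemma envMul_tmul (a : A) (b : Aᵐᵒᵖ) : envMul k A (a ⊗ₜ[k] b) = a * b.unop := rfl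

lemma envMul_lact (a : A) (e : Env k A) : envMul k A (lact k a e) = a * envMul k A e := by
  induction e using TensorProduct.induction_on with
  | zero => simp only [map_zero, mul_zero]
  | add e e' h h' => simp only [map_add, h, h', mul_add]
  | tmul b c => rw [lact_env, envMul_tmul, envMul_tmul, mul_assoc]

lemma envMul_ract (a : A) (e : Env k A) : envMul k A (ract k a e) = envMul k A e * a := by
  induction e using TensorProduct.induction_on with
  | zero => simp only [map_zero, zero_mul]
  | add e e' h h' => simp only [map_add, h, h', add_mul]
  | tmul b c =>
    rw [ract_env, envMul_tmul, envMul_tmul, mul_assoc, MulOpposite.unop_mul, MulOpposite.unop_op]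

variable (A)

/-- The additive map `(a ⊗ b) ⊗ x ↦ a b x`. -/
def freeCoverAdd : TA k A (Env k A) N →+ N :=
  Balanced.lift
    (AddMonoidHom.mk' (fun e => lact k (envMul k A e)) (fun e e' => AddMonoidHom.ext fun x => by
      rw [map_add, lact_add]; rfl))
    (fun a e x => by
      change lact k (envMul k A (ract k a e)) x = lact k (envMul k A e) (lact k a x)
      rw [envMul_ract, lact_mul])

lemma freeCoverAdd_mk (e : Env k A) (x : N) :
    freeCoverAdd k A N (TA.mk k A e x) = lact k (envMul k A e) x := rfl

/-- The bimodule map `A^e ⊗_A N → N`, `(a ⊗ b) ⊗ x ↦ a b x`. -/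
def freeCover : TA k A (Env k A) N →ₗ[Env k A] N :=
  homOfActs k (freeCoverAdd k A N)
    (fun a z => by
      induction z using TA.induction with
      | h0 => simp only [map_zero]
      | hadd z z' h h' => simp only [map_add, h, h']
      | hmk e x => rw [TA.lact_mk, freeCoverAdd_mk, freeCoverAdd_mk, envMul_lact, lact_mul])
    (fun a z => by
      induction z using TA.induction with
      | h0 => simp only [map_zero]
      | hadd z z' h h' => simp only [map_add, h, h']
      | hmk e x => rw [TA.ract_mk, freeCoverAdd_mk, freeCoverAdd_mk, lact_ract, ract_lact])

/-- The additive map `x ↦ (1 ⊗ 1) ⊗ x`. -/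
def freeCoverSection : N →+ TA k A (Env k A) N :=
  AddMonoidHom.mk' (fun x => TA.mk k A 1 x) (TA.mk_add_right k A _)

lemma freeCover_section (x : N) : freeCover k A N (freeCoverSection k A N x) = x := by
  change lact k ((1 : A) * 1) x = x
  rw [mul_one, lact_one]

/-- Right linearity of the section keeps the sequence of `isShortExact_freeCover` exact under - ⊗_A
M, as required for (QII₁). -/
lemma freeCoverSection_ract (a : A) (x : N) :
    freeCoverSection k A N (ract k a x) = ract k a (freeCoverSection k A N x) :=
  (TA.ract_mk k A a _ x).symm

/-- The kernel of `freeCover`. -/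
def Syzygy : Type _ := LinearMap.ker (freeCover k A N)

instance : AddCommGroup (Syzygy k A N) :=
  inferInstanceAs (AddCommGroup (LinearMap.ker (freeCover k A N)))

instance : Module (Env k A) (Syzygy k A N) :=
  inferInstanceAs (Module (Env k A) (LinearMap.ker (freeCover k A N)))

/-- The inclusion of the kernel of `freeCover`. -/
def Syzygy.incl : Syzygy k A N →ₗ[Env k A] TA k A (Env k A) N :=
  (LinearMap.ker (freeCover k A N)).subtype

lemma isShortExact_freeCover :
    IsShortExact k A (Syzygy.incl k A N) (freeCover k A N) where
  injective := Submodule.subtype_injective _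
  exact := LinearMap.exact_subtype_ker_map _
  surjective x := ⟨_, freeCover_section k A N x⟩

variable {A}

variable [Module.Projective k A]
variable {N₁ N₂ N₃ : Type*} [AddCommGroup N₁] [Module (Env k A) N₁]
    [AddCommGroup N₂] [Module (Env k A) N₂] [AddCommGroup N₃] [Module (Env k A) N₃]
variable {N₁' N₂' N₃' : Type*} [AddCommGroup N₁'] [Module (Env k A) N₁']
    [AddCommGroup N₂'] [Module (Env k A) N₂'] [AddCommGroup N₃'] [Module (Env k A) N₃']

/-- If `H_{n+1}(A, N₂) = 0`, then the connecting homomorphism is injective. -/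
lemma Homology.δ_injective {f : N₁ →ₗ[Env k A] N₂} {g : N₂ →ₗ[Env k A] N₃}
    (h : IsShortExact k A f g) {n : ℕ} (h0 : ∀ c : Homology k A N₂ (n + 1), c = 0) :
    Function.Injective (Homology.δ k A h n) := by
  rw [injective_iff_map_eq_zero]
  intro c hc
  obtain ⟨x, hx, rfl⟩ := Homology.mk_surjective k A c
  obtain ⟨y, z, hz, rfl, hzy, e⟩ := Homology.δ_eq k h n x hx
  rw [e] at hc
  have hzB := (Subquotient.mk_eq_mk (hx' := AddSubgroup.zero_mem _)).1 hc
  rw [sub_zero] at hzB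
  obtain ⟨z', rfl⟩ := hzB
  have hgf : chainMap k A g (n + 1) (chainMap k A f (n + 1) z') = 0 :=
    (TAe.map_exact k A (P := Bar k A (n + 1)) f g h.exact _).2 ⟨z', rfl⟩
  -- As z = dz', subtracting f z' turns the lift y into a cycle over N₂ with the same image under g.
  have hcyc : y - chainMap k A f (n + 1) z' ∈ cycles k A N₂ (n + 1) := by
    change chainD k A N₂ n _ = 0
    rw [map_sub, ← hzy, chainMap_chainD, sub_self]
  have h1 : Homology.map k A g (n + 1) (Homology.mk k A _ hcyc) =
      Homology.mk k A (chainMap k A g (n + 1) y) hx :=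
    Homology.mk_congr k A _ (by
      change chainMap k A g (n + 1) (y - chainMap k A f (n + 1) z') = _
      rw [map_sub, hgf, sub_zero]) _ _
  rw [← h1, h0 (Homology.mk k A _ hcyc), map_zero]

lemma Homology.δ_map {f : N₁ →ₗ[Env k A] N₂} {g : N₂ →ₗ[Env k A] N₃}
    (h : IsShortExact k A f g) {f' : N₁' →ₗ[Env k A] N₂'} {g' : N₂' →ₗ[Env k A] N₃'}
    (h' : IsShortExact k A f' g') (r₁ : N₁ →ₗ[Env k A] N₁') (r₂ : N₂ →ₗ[Env k A] N₂')
    (r₃ : N₃ →ₗ[Env k A] N₃') (hf : r₂ ∘ₗ f = f' ∘ₗ r₁) (hg : r₃ ∘ₗ g = g' ∘ₗ r₂) (n : ℕ)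
    (c : Homology k A N₃ (n + 1)) :
    Homology.δ k A h' n (Homology.map k A r₃ (n + 1) c) =
      Homology.map k A r₁ n (Homology.δ k A h n c) := by
  obtain ⟨x, hx, rfl⟩ := Homology.mk_surjective k A c
  obtain ⟨y, z, hz, rfl, hzy, e⟩ := Homology.δ_eq k h n x hx
  rw [e, Homology.map_mk, Homology.map_mk]
  refine Homology.δ_mk k A h' n _ _ (chainMap k A r₂ (n + 1) y) _ _ ?_ ?_
  · rw [← chainMap_comp, ← chainMap_comp, hg]
  · rw [← chainMap_comp, ← hf, chainMap_comp, hzy, chainMap_chainD]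

end ShiftHomology

/-! ### The left and the right action of the center on homology -/

section CenterRight

variable (k : Type u) {A : Type v} [CommRing k] [Ring A] [Algebra k A]

/-- The bimodule endomorphism `x ↦ x z`, where `z` is central. -/
def centerHomRight (N : Type*) [AddCommGroup N] [Module (Env k A) N] (z : Subalgebra.center k A) :
    N →ₗ[Env k A] N :=
  homOfActs k (ract k (z : A))
    (fun a x => by rw [lact_ract, ract_lact])
    (fun a x => by rw [← ract_mul, ← ract_mul, (Subalgebra.mem_center_iff.1 z.2 a)])

variable {N N' : Type*} [AddCommGroup N] [Module (Env k A) N] [AddCommGroup N'] [Module (Env k A) N']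

lemma centerHom_comp (f : N →ₗ[Env k A] N') (z : Subalgebra.center k A) :
    centerHom k A N' z ∘ₗ f = f ∘ₗ centerHom k A N z :=
  LinearMap.ext fun x => (map_lact k f (z : A) x).symm

lemma centerHomRight_comp (f : N →ₗ[Env k A] N') (z : Subalgebra.center k A) :
    centerHomRight k N' z ∘ₗ f = f ∘ₗ centerHomRight k N z :=
  LinearMap.ext fun x => (map_ract k f (z : A) x).symm

/-- The center acts in the same way through the left and the right action on the coefficients. -/
lemma Homology.map_centerHom [Module.Projective k A] (n : ℕ) (N : Type (max v w)) [AddCommGroup N]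
    [Module (Env k A) N] (z : Subalgebra.center k A) (c : Homology k A N n) :
    Homology.map k A (centerHom k A N z) n c = Homology.map k A (centerHomRight k N z) n c := by
  -- The coefficients vary along the induction; the universe `max v w` contains the syzygy of N
  -- together with N.
  induction n generalizing N with
  | succ n ih =>
    -- Both multiplications by z commute with all bimodule maps, hence with the injective connecting
    -- map to the syzygy, one degree lower.
    refine Homology.δ_injective k (isShortExact_freeCover k A N) (Homology.eq_zero_of_env k) ?_
    rw [Homology.δ_map k (isShortExact_freeCover k A N) (isShortExact_freeCover k A N) _ _ _
        (centerHom_comp k _ z) (centerHom_comp k _ z),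
      Homology.δ_map k (isShortExact_freeCover k A N) (isShortExact_freeCover k A N) _ _ _
        (centerHomRight_comp k _ z) (centerHomRight_comp k _ z)]
    exact ih _ _
  | zero =>
    obtain ⟨x, hx, rfl⟩ := Homology.mk_surjective k A c
    rw [Homology.map_mk, Homology.map_mk]
    refine Subquotient.mk_eq_mk.2 ?_
    clear hx
    induction x using Chain.induction with
    | h0 => simp only [map_zero, sub_zero]; exact AddSubgroup.zero_mem _
    | hadd x y hx hy =>
      rw [map_add, map_add, add_sub_add_comm]
      exact AddSubgroup.add_mem _ hx hy
    | htprod x g =>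
      -- Inserting z in the middle gives d(a_0 ⊗ z ⊗ a_1) = z a_0 ⊗ a_1 - a_0 ⊗ a_1 z. In N ⊗_{A^e}
      -- Bar(A)_0 these two terms represent xz and zx, so the difference is a boundary.
      refine ⟨-TAe.mk k A x (Bar.tprod k A ![g 0, z, g 1]), ?_⟩
      have h1 : chainMap k A (centerHom k A N z) 0 (TAe.mk k A x (Bar.tprod k A g)) =
          TAe.mk k A x (Bar.tprod k A ![g 0, g 1 * z]) := by
        have h := TAe.balance k A 1 (z : A) x (Bar.tprod k A g)
        rw [lact_one, ract_one, Bar.ract_tprod] at h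
        refine h.trans ?_
        congr 2
        ext i
        fin_cases i <;> simp [Fin.last, Function.update]
      have h2 : chainMap k A (centerHomRight k N z) 0 (TAe.mk k A x (Bar.tprod k A g)) =
          TAe.mk k A x (Bar.tprod k A ![z * g 0, g 1]) := by
        have h := TAe.balance k A (z : A) 1 x (Bar.tprod k A g)
        rw [lact_one, ract_one, Bar.lact_tprod] at h
        refine h.trans ?_
        congr 2
        ext i
        fin_cases i <;> simp [Function.update]
      have e0 : Fin.contractNth (Fin.castSucc (0 : Fin 2)) (· * ·) ![g 0, (z : A), g 1] =
          ![z * g 0, g 1] := by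
        ext i
        fin_cases i <;> simp [Fin.contractNth, Subalgebra.mem_center_iff.1 z.2 (g 0)]
      have e1 : Fin.contractNth (Fin.castSucc (1 : Fin 2)) (· * ·) ![g 0, (z : A), g 1] =
          ![g 0, g 1 * z] := by
        ext i
        fin_cases i <;> simp [Fin.contractNth, Subalgebra.mem_center_iff.1 z.2 (g 1)]
      rw [h1, h2, map_neg, chainD, TAe.map_mk, Bar.d_tprod_int, Fin.sum_univ_two, e0, e1,
        TAe.mk_add_right, TAe.mk_zsmul_right, TAe.mk_zsmul_right, LinearMap.id_apply]
      simp [sub_eq_add_neg]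

end CenterRight

/-! ### Coinduced bimodules -/

section Coinduced

variable (k : Type u) (A : Type v) [CommRing k] [Ring A] [Algebra k A]
variable (M : Type*) [AddCommGroup M] [Module (Env k A) M]

/-- The `k`-linear maps `A → M`. -/
def Coind : AddSubgroup (A →+ M) where
  carrier := {f | ∀ (c : k) (b : A), f (algebraMap k A c * b) = lact k (algebraMap k A c) (f b)}
  zero_mem' c b := by simp only [AddMonoidHom.zero_apply, map_zero]
  add_mem' {f g} hf hg c b := by simp only [AddMonoidHom.add_apply, hf c b, hg c b, map_add]
  neg_mem' {f} hf c b := by simp only [AddMonoidHom.neg_apply, hf c b, map_neg]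

variable {k A M} in
@[ext]
lemma Coind.ext {f g : Coind k A M} (h : ∀ b, f.1 b = g.1 b) : f = g :=
  Subtype.ext (AddMonoidHom.ext h)

/-- The action `(a f)(b) = a f(b)`. -/
def Coind.leftHom : A →+* AddMonoid.End (Coind k A M) where
  toFun a := AddMonoidHom.mk' (fun f => ⟨(lact k a).comp f.1, fun c b => by
      rw [AddMonoidHom.comp_apply, AddMonoidHom.comp_apply, f.2 c b, ← lact_mul, ← lact_mul,
        Algebra.commutes]⟩)
    (fun f g => Coind.ext fun b => map_add (lact k a) (f.1 b) (g.1 b))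
  map_one' := AddMonoidHom.ext fun f => Coind.ext fun b => lact_one k (f.1 b)
  map_mul' a a' := AddMonoidHom.ext fun f => Coind.ext fun b => lact_mul k a a' (f.1 b)
  map_zero' := AddMonoidHom.ext fun f => Coind.ext fun b => lact_zero k (f.1 b)
  map_add' a a' := AddMonoidHom.ext fun f => Coind.ext fun b => lact_add k a a' (f.1 b)

/-- The action `(f a)(b) = f(a b)`. -/
def Coind.rightHom : Aᵐᵒᵖ →+* AddMonoid.End (Coind k A M) where
  toFun a := AddMonoidHom.mk' (fun f => ⟨f.1.comp (AddMonoidHom.mulLeft a.unop), fun c b => by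
      simp only [AddMonoidHom.comp_apply, AddMonoidHom.coe_mulLeft]
      rw [← f.2 c, ← mul_assoc, ← mul_assoc, Algebra.commutes]⟩)
    (fun f g => rfl)
  map_one' := AddMonoidHom.ext fun f => Coind.ext fun b => congrArg f.1 (one_mul b)
  map_mul' a a' := AddMonoidHom.ext fun f => Coind.ext fun b =>
    congrArg f.1 (mul_assoc a'.unop a.unop b)
  map_zero' := AddMonoidHom.ext fun f => Coind.ext fun b =>
    (congrArg f.1 (zero_mul b)).trans (map_zero f.1)
  map_add' a a' := AddMonoidHom.ext fun f => Coind.ext fun b =>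
    (congrArg f.1 (add_mul a.unop a'.unop b)).trans (map_add f.1 _ _)

instance : Module (Env k A) (Coind k A M) :=
  envModule k (Coind k A M) (Coind.leftHom k A M) (Coind.rightHom k A M)
    (fun _ _ _ => rfl) (fun c f => Coind.ext fun b => (f.2 c b).symm)

lemma Coind.smul_apply (a : A) (b : Aᵐᵒᵖ) (f : Coind k A M) (x : A) :
    ((a ⊗ₜ[k] b : Env k A) • f).1 x = lact k a (f.1 (b.unop * x)) :=
  congrArg (fun f : Coind k A M => f.1 x) <| envModule_smul k (Coind k A M) (Coind.leftHom k A M)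
    (Coind.rightHom k A M) (fun _ _ _ => rfl) (fun c f => Coind.ext fun b => (f.2 c b).symm) a b f

variable {A M} in
lemma Coind.lact_apply (a : A) (f : Coind k A M) (x : A) :
    (lact k a f).1 x = lact k a (f.1 x) := by
  rw [HochschildCap.lact_apply, Coind.smul_apply, MulOpposite.unop_one, one_mul]

variable {A M} in
lemma Coind.ract_apply (a : A) (f : Coind k A M) (x : A) :
    (ract k a f).1 x = f.1 (a * x) := by
  rw [HochschildCap.ract_apply, Coind.smul_apply, MulOpposite.unop_op, lact_one]

/-- The bimodule map `y ↦ (b ↦ y b)`. -/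
def toCoind : M →ₗ[Env k A] Coind k A M :=
  homOfActs k
    (AddMonoidHom.mk' (fun y => (⟨AddMonoidHom.mk' (fun b => ract k b y)
          (fun b b' => ract_add k b b' y), fun c b => by
        change ract k _ y = lact k _ (ract k b y)
        rw [ract_mul, ← lact_algebraMap, lact_ract, ract_lact]⟩ : Coind k A M))
      (fun y y' => Coind.ext fun b => map_add (ract k b) y y'))
    (fun a y => Coind.ext fun b => by
      rw [Coind.lact_apply]
      change ract k b (lact k a y) = lact k a (ract k b y)
      rw [lact_ract, ract_lact])
    (fun a y => Coind.ext fun b => by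
      rw [Coind.ract_apply]
      exact (ract_mul k a b y).symm)

/-- The map `f ↦ f(1)`. -/
def Coind.eval : Coind k A M →+ M := AddMonoidHom.mk' (fun f => f.1 1) (fun _ _ => rfl)

lemma Coind.eval_toCoind (y : M) : Coind.eval k A M (toCoind k A M y) = y := ract_one k y

/-- Left linearity of this retraction keeps the sequence of `isShortExact_toCoind` exact under N ⊗_A
-, as required for (QII₂). -/
lemma Coind.eval_lact (a : A) (f : Coind k A M) :
    Coind.eval k A M (lact k a f) = lact k a (Coind.eval k A M f) := Coind.lact_apply k a f 1

/-- The cokernel of `toCoind`. -/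
def Cosyzygy : Type _ := Coind k A M ⧸ LinearMap.range (toCoind k A M)

instance : AddCommGroup (Cosyzygy k A M) :=
  inferInstanceAs (AddCommGroup (Coind k A M ⧸ LinearMap.range (toCoind k A M)))

instance : Module (Env k A) (Cosyzygy k A M) :=
  inferInstanceAs (Module (Env k A) (Coind k A M ⧸ LinearMap.range (toCoind k A M)))

/-- The projection to the cokernel of `toCoind`. -/
def Cosyzygy.proj : Coind k A M →ₗ[Env k A] Cosyzygy k A M :=
  (LinearMap.range (toCoind k A M)).mkQ

lemma isShortExact_toCoind :
    IsShortExact k A (toCoind k A M) (Cosyzygy.proj k A M) where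
  injective := Function.LeftInverse.injective (Coind.eval_toCoind k A M)
  exact := LinearMap.exact_map_mkQ_range _
  surjective := Submodule.mkQ_surjective _

variable {k A M} in
-- An A^e-linear map into Hom_k(A, M) amounts to a left A-linear map into M, by evaluation at 1.
-- Composing with the left linear contraction w ↦ w ⊗ 1 therefore provides a primitive of a cocycle.
lemma Cohomology.eq_zero_of_coind {m : ℕ} (c : Cohomology k A (Coind k A M) (m + 1)) : c = 0 := by
  obtain ⟨t, ht, rfl⟩ := Cohomology.mk_surjective k A c
  refine Subquotient.mk_eq_mk (hx' := AddSubgroup.zero_mem _) |>.2 ?_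
  rw [sub_zero, ← neg_one_pow_smul_mem (m + 2 + 1)]
  have ht' : ∀ w, t (Bar.d k A (m + 1) w) = 0 := fun w => LinearMap.congr_fun
    (show cochainD k A (Coind k A M) (m + 1) t = 0 from ht) w
  -- The left linear map w ↦ t(w ⊗ 1)(1), rewritten as a map into Hom_k(A, M): its value at b is
  -- taken at wb.
  let s : Bar k A m →+ Coind k A M := AddMonoidHom.mk'
    (fun w => ⟨AddMonoidHom.mk' (fun b => Coind.eval k A M (t (Bar.T k A m (ract k b w))))
        (fun b b' => by simp only [ract_add, map_add]), fun c b => by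
      change Coind.eval k A M (t (Bar.T k A m (ract k _ w))) =
        lact k _ (Coind.eval k A M (t (Bar.T k A m (ract k b w))))
      rw [ract_mul, ← lact_algebraMap, ract_lact, ← lact_ract, Bar.T_lact, map_lact,
        Coind.eval_lact]⟩)
    (fun w w' => Coind.ext fun b => by
      change Coind.eval k A M (t (Bar.T k A m (ract k b _))) =
        Coind.eval k A M (t (Bar.T k A m (ract k b w))) +
          Coind.eval k A M (t (Bar.T k A m (ract k b w')))
      simp only [map_add])
  have hs : ∀ w b, (s w).1 b = Coind.eval k A M (t (Bar.T k A m (ract k b w))) := fun _ _ => rfl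
  refine ⟨homOfActs k s (fun a w => Coind.ext fun b => ?_) (fun a w => Coind.ext fun b => ?_),
    LinearMap.ext fun w => Coind.ext fun b => ?_⟩
  · rw [Coind.lact_apply, hs, hs, ract_lact, ← lact_ract, Bar.T_lact, map_lact, Coind.eval_lact]
  · rw [Coind.ract_apply, hs, hs, ract_mul]
  · change (s (Bar.d k A m w)).1 b = _
    -- Apply the cocycle to the contraction identity at wb: the term t(d(-)) drops out, and
    -- t((d(wb)) ⊗ 1) is t(wb) up to sign.
    have h1 := congrArg t (Bar.d_T k A m (ract k b w))
    rw [ht', map_add, map_zsmul, map_ract, eq_comm, ← eq_neg_iff_add_eq_zero, ← neg_smul] at h1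
    -- (t(w) b)(1) = t(w)(b) recovers the value of t(w) at b.
    have h2 : ∀ q : ℤ, q • Coind.eval k A M (ract k b (t w)) = ((q • t) w).1 b := fun q => by
      change q • (ract k b (t w)).1 1 = q • (t w).1 b
      rw [Coind.ract_apply, mul_one]
    have h3 : -(-1 : ℤ) ^ (m + 2) = (-1) ^ (m + 2 + 1) := by rw [pow_succ _ (m + 2), mul_neg_one]
    rw [hs, h1, map_zsmul, map_ract, h3]
    exact h2 _

end Coinduced

/-! ### Dimension shifting for cohomology -/

section ShiftCohomology

variable (k : Type u) {A : Type v} [CommRing k] [Ring A] [Algebra k A] [Module.Projective k A]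
variable {M₁ M₂ M₃ : Type*} [AddCommGroup M₁] [Module (Env k A) M₁]
    [AddCommGroup M₂] [Module (Env k A) M₂] [AddCommGroup M₃] [Module (Env k A) M₃]

/-- If `H^{m+1}(A, M₂) = 0`, then the connecting homomorphism is surjective. -/
lemma Cohomology.δ_surjective {f : M₁ →ₗ[Env k A] M₂} {g : M₂ →ₗ[Env k A] M₃}
    (h : IsShortExact k A f g) {m : ℕ} (h0 : ∀ c : Cohomology k A M₂ (m + 1), c = 0) :
    Function.Surjective (Cohomology.δ k A h m) := by
  intro c
  obtain ⟨t, ht, rfl⟩ := Cohomology.mk_surjective k A c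
  have h1 := (Subquotient.mk_eq_mk (hx' := AddSubgroup.zero_mem _)).1
    (h0 (Cohomology.mk k A (cochainMap k A f (m + 1) t) (cochainMap_mem_cocycles k A f _ t ht)))
  rw [sub_zero] at h1
  obtain ⟨y, hy⟩ := h1
  -- A primitive y of f t maps under g to a cocycle because g f = 0, and by construction ∂ sends its
  -- class to that of t.
  refine ⟨Cohomology.mk k A (cochainMap k A g m y) ?_,
    Cohomology.δ_mk k A h m _ _ y t ht rfl hy.symm⟩
  change cochainD k A M₃ m _ = 0
  rw [← cochainMap_cochainD, hy]
  exact LinearMap.ext fun w => (h.exact _).2 ⟨t w, rfl⟩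

end ShiftCohomology

/-! ### Degree zero homology -/

section PsiInjective

variable (k : Type u) {A : Type v} [CommRing k] [Ring A] [Algebra k A]
variable (N : Type*) [AddCommGroup N] [Module (Env k A) N]

/-- The inverse of `ψ`, which maps `[x]` to `[x ⊗ (1 ⊗ 1)]`. -/
def psiInv : N ⧸ commutators k A N →+ Homology k A N 0 :=
  QuotientAddGroup.lift _
    (AddMonoidHom.mk' (fun x => Homology.mk k A (TAe.mk k A x (Bar.tprod k A 1)) (by trivial))
      (fun x x' => Homology.mk_congr k A N (TAe.mk_add_left k A x x' _) _ (by trivial)))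
    (by
      rw [commutators, AddSubgroup.closure_le]
      rintro _ ⟨a, x, rfl⟩
      rw [SetLike.mem_coe, AddMonoidHom.mem_ker, map_sub, sub_eq_zero]
      -- d(1 ⊗ a ⊗ 1) = a ⊗ 1 - 1 ⊗ a, and tensored with x these terms represent xa and ax.
      refine Subquotient.mk_eq_mk.2 ⟨-TAe.mk k A x (Bar.tprod k A ![1, a, 1]), ?_⟩
      have h1 : TAe.mk k A (lact k a x) (Bar.tprod k A (1 : Fin 2 → A)) =
          TAe.mk k A x (Bar.tprod k A ![1, a]) := by
        have h := TAe.balance k A 1 a x (Bar.tprod k A (1 : Fin 2 → A))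
        rw [lact_one, ract_one, Bar.ract_tprod] at h
        refine h.trans ?_
        congr 2
        ext i
        fin_cases i <;> simp [Fin.last, Function.update]
      have h2 : TAe.mk k A (ract k a x) (Bar.tprod k A (1 : Fin 2 → A)) =
          TAe.mk k A x (Bar.tprod k A ![a, 1]) := by
        have h := TAe.balance k A a 1 x (Bar.tprod k A (1 : Fin 2 → A))
        rw [lact_one, ract_one, Bar.lact_tprod] at h
        refine h.trans ?_
        congr 2
        ext i
        fin_cases i <;> simp [Function.update]
      have e0 : Fin.contractNth (Fin.castSucc (0 : Fin 2)) (· * ·) ![1, a, 1] = ![a, 1] := by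
        ext i
        fin_cases i <;> simp [Fin.contractNth]
      have e1 : Fin.contractNth (Fin.castSucc (1 : Fin 2)) (· * ·) ![1, a, 1] = ![1, a] := by
        ext i
        fin_cases i <;> simp [Fin.contractNth]
      rw [h1, h2, map_neg, chainD, TAe.map_mk, Bar.d_tprod_int, Fin.sum_univ_two, e0, e1,
        TAe.mk_add_right, TAe.mk_zsmul_right, TAe.mk_zsmul_right, LinearMap.id_apply]
      simp [sub_eq_add_neg])

lemma psiInv_mk (x : N) : psiInv k N (QuotientAddGroup.mk x) =
    Homology.mk k A (TAe.mk k A x (Bar.tprod k A 1)) (by trivial) := rfl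

lemma psiInv_psi (c : Homology k A N 0) : psiInv k N (psi k A N c) = c := by
  obtain ⟨x, hx, rfl⟩ := Homology.mk_surjective k A c
  rw [psi_mk]
  induction x using Chain.induction with
  | h0 => simp only [map_zero]; rfl
  | hadd x y h h' =>
    rw [map_add, map_add, h (by trivial), h' (by trivial)]
    rfl
  | htprod x g =>
    have h1 : Bar.tprod k A g = lact k (g 0) (ract k (g 1) (Bar.tprod k A 1)) := by
      rw [Bar.ract_tprod, Bar.lact_tprod]
      congr 1
      ext i
      fin_cases i <;> simp [Fin.last, Function.update]
    -- Both ends of the bar are moved onto x, so every 0-chain is a sum of chains x ⊗ (1 ⊗ 1).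
    have h2 : TAe.mk k A x (Bar.tprod k A g) =
        TAe.mk k A (lact k (g 1) (ract k (g 0) x)) (Bar.tprod k A 1) := by
      rw [h1, TAe.balance]
    rw [psiChain_mk, Bar.aug_tprod, ract_mul, ← mk_lact_eq_mk_ract, psiInv_mk]
    exact Homology.mk_congr k A N h2.symm _ _

lemma psi_injective : Function.Injective (psi k A N) :=
  Function.LeftInverse.injective (psiInv_psi k N)

end PsiInjective

/-! ### Existence and uniqueness of the cap product -/

section Main

variable (k : Type u) (A : Type v) [CommRing k] [Ring A] [Algebra k A]

lemma TA.map_centerHom_id {N M : Type*} [AddCommGroup N] [Module (Env k A) N] [AddCommGroup M]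
    [Module (Env k A) M] (z : Subalgebra.center k A) :
    TA.map k A (centerHom k A N z) (LinearMap.id : M →ₗ[Env k A] M) =
      centerHom k A (TA k A N M) z :=
  LinearMap.ext fun x => DFunLike.congr_fun (f := (TA.map k A (centerHom k A N z)
      (LinearMap.id : M →ₗ[Env k A] M)).toAddMonoidHom)
    (g := lact k (z : A)) (TA.hom_ext k A fun x y => (TA.lact_mk k A (z : A) x y).symm) x

/-- As x ⊗ zy = xz ⊗ y, the action of the center on M turns into its right action on N. -/
lemma TA.map_id_centerHom {N M : Type*} [AddCommGroup N] [Module (Env k A) N] [AddCommGroup M]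
    [Module (Env k A) M] (z : Subalgebra.center k A) :
    TA.map k A (LinearMap.id : N →ₗ[Env k A] N) (centerHom k A M z) =
      TA.map k A (centerHomRight k N z) (LinearMap.id : M →ₗ[Env k A] M) :=
  LinearMap.ext fun x => DFunLike.congr_fun (f := (TA.map k A (LinearMap.id : N →ₗ[Env k A] N)
      (centerHom k A M z)).toAddMonoidHom)
    (g := (TA.map k A (centerHomRight k N z) (LinearMap.id : M →ₗ[Env k A] M)).toAddMonoidHom)
    (TA.hom_ext k A fun x y => (TA.mk_balance k A (z : A) x y).symm) x

variable {k A} in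
lemma capAdd_center_left {n m p : ℕ} (h : n = p + m) {N M : Type*} [AddCommGroup N]
    [Module (Env k A) N] [AddCommGroup M] [Module (Env k A) M] (z : Subalgebra.center k A)
    (γ : Homology k A N n) (ε : Cohomology k A M m) :
    capAdd k h ε (z • γ) = z • capAdd k h ε γ := by
  rw [Homology.center_smul_def, capAdd_map_left, TA.map_centerHom_id, Homology.center_smul_def]

variable {k A} in
-- The action on ε is traded for the right action on the coefficients of γ, and on homology that is
-- the left action. Unlike linearity in γ, this does not come from an identity of chains.
lemma capAdd_center_right [Module.Projective k A] {n m p : ℕ} (h : n = p + m) {N : Type (max v w)}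
    {M : Type*} [AddCommGroup N] [Module (Env k A) N] [AddCommGroup M] [Module (Env k A) M]
    (z : Subalgebra.center k A) (γ : Homology k A N n) (ε : Cohomology k A M m) :
    capAdd k h (z • ε) γ = z • capAdd k h ε γ := by
  rw [← capAdd_center_left, Cohomology.center_smul_def, capAdd_map_right, TA.map_id_centerHom,
    ← capAdd_map_left, ← Homology.map_centerHom.{u, v, w}, Homology.center_smul_def]

/-- The cap product. -/
def cap [Module.Projective k A] : CapFamily.{u, v, w} k A := fun _ _ _ h _ _ =>
  LinearMap.mk₂ k (fun γ ε => capAdd k h ε γ)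
    (fun γ γ' ε => map_add (capAdd k h ε) γ γ')
    (fun c γ ε => capAdd_center_left h (algebraMap k _ c) γ ε)
    (fun γ ε ε' => by rw [map_add]; rfl)
    (fun c γ ε => capAdd_center_right.{u, v, w} h (algebraMap k _ c) γ ε)

lemma isCapProduct_cap [Module.Projective k A] : IsCapProduct k A (cap.{u, v, w} k A) where
  center_bilinear _ _ _ h _ _ z γ ε :=
    ⟨capAdd_center_left h z γ ε, capAdd_center_right.{u, v, w} h z γ ε⟩
  connecting_left _ _ _ h _ _ _ _ _ _ hfg hfgM γ ε := δ_capAdd_left k h hfg hfgM γ ε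
  connecting_right _ _ _ h _ _ _ _ _ _ hfg hNfg γ ε := δ_capAdd_right k h hfg hNfg γ ε
  degree_zero _ _ γ ε := psi_capAdd k γ ε

variable {k A} in
-- Dimension shifting in N settles m = 0, and dimension shifting in M then raises m. Both inductions
-- run over all bimodules at once, since each step replaces the coefficients.
lemma IsCapProduct.unique [Module.Projective k A] {c c' : CapFamily.{u, v, w} k A}
    (hc : IsCapProduct k A c) (hc' : IsCapProduct k A c') : c = c' := by
  have hzero : ∀ (n : ℕ) (N M : ModuleCat.{max v w} (Env k A)) (γ : Homology k A N n)
      (ε : Cohomology k A M 0), c n 0 n rfl N M γ ε = c' n 0 n rfl N M γ ε := by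
    intro n
    induction n with
    | zero =>
      intro N M γ ε
      refine psi_injective k _ ?_
      rw [hc.degree_zero, hc'.degree_zero]
    | succ n ih =>
      intro N M γ ε
      have hS := isShortExact_freeCover k A N
      have hSM := hS.map_left_of_section k M (freeCoverSection k A N) (freeCover_section k A N)
        (freeCoverSection_ract k A N)
      -- Injectivity of δ after tensoring with M allows the two products to be compared one degree
      -- lower, with the syzygy in place of N.
      refine Homology.δ_injective k hSM (Homology.eq_zero_of_env_tensor k) ?_
      have h1 := hc.connecting_left n 0 n rfl (ModuleCat.of _ (Syzygy k A N))
        (ModuleCat.of _ (TA k A (Env k A) N)) N M _ _ hS hSM γ ε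
      have h2 := hc'.connecting_left n 0 n rfl (ModuleCat.of _ (Syzygy k A N))
        (ModuleCat.of _ (TA k A (Env k A) N)) N M _ _ hS hSM γ ε
      rw [ih] at h1
      exact h1.trans h2.symm
  have hall : ∀ (m n p : ℕ) (h : n = p + m) (N M : ModuleCat.{max v w} (Env k A))
      (γ : Homology k A N n) (ε : Cohomology k A M m), c n m p h N M γ ε = c' n m p h N M γ ε := by
    intro m
    induction m with
    | zero =>
      intro n p h N M γ ε
      obtain rfl : n = p := h
      exact hzero n N M γ ε
    | succ m ih =>
      intro n p h N M γ ε
      have hS := isShortExact_toCoind k A M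
      -- Every class of degree m + 1 is ∂ of a class of degree m with coefficients in the cosyzygy,
      -- where the two products agree by induction, with p + 1 in place of p.
      obtain ⟨ε, rfl⟩ := Cohomology.δ_surjective k hS Cohomology.eq_zero_of_coind ε
      have hSN := hS.map_right_of_retraction k N (Coind.eval k A M) (Coind.eval_toCoind k A M)
        (Coind.eval_lact k A M)
      have h1 := hc.connecting_right n m p h N M (ModuleCat.of _ (Coind k A M))
        (ModuleCat.of _ (Cosyzygy k A M)) _ _ hS hSN γ ε
      have h2 := hc'.connecting_right n m p h N M (ModuleCat.of _ (Coind k A M))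
        (ModuleCat.of _ (Cosyzygy k A M)) _ _ hS hSN γ ε
      rw [ih] at h1
      have h3 := h1.symm.trans h2
      -- Both products appear with the same sign, which is cancelled.
      rcases neg_one_pow_eq_or ℤ (m + 1) with e | e
      · rwa [e, one_smul, one_smul] at h3
      · rw [e, neg_smul, neg_smul, one_smul, one_smul] at h3
        exact neg_injective h3
  funext n m p h N M
  exact LinearMap.ext₂ (hall m n p h N M)

end Main

end

end HochschildCap


theorem mainTheorem1 (k : Type u) (A : Type v) [CommRing k] [Ring A] [Algebra k A]
    [Module.Projective k A] :
    ∃! cap : HochschildCap.CapFamily.{u, v, w} k A, HochschildCap.IsCapProduct k A cap :=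
  ⟨HochschildCap.cap.{u, v, w} k A, HochschildCap.isCapProduct_cap.{u, v, w} k A,
    fun _ h => h.unique (HochschildCap.isCapProduct_cap.{u, v, w} k A)⟩
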